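/- **Setting.** Let $m,s\ge 1$ be integers, let $\mathcal K_1,\dots,\mathcal K_m,\mathcal G_1,\dots,\mathcal G_s$ be separable real Hilbert spaces, and let $\mathcal K=\bigoplus_i\mathcal K_i$, $\mathcal G=\bigoplus_k\mathcal G_k$ be the Hilbert direct sums. $\Gamma_0(H)$ is the class of proper lower semicontinuous convex functions $H\to\,]-\infty,+\infty]$; $f^*$ is the conjugate of $f$ and $\partial f$ its subdifferential; $(f\,\square\, g)(x)=\inf_y (f(y)+g(x-y))$; for set-valued operators $A\,\square\, B=(A^{-1}+B^{-1})^{-1}$. For a self-adjoint bounded operator $U$ that is strongly positive ($\langle Ux,x\rangle\ge\chi\|x\|^2$ for some $\chi>0$), $\|x\|_U^2=\langle Ux,x\rangle$ and $\operatorname{prox}_f^U(x)$ is the unique minimizer of $y\mapsto f(y)+\tfrac12\|x-y\|_U^2$. A function $f$ is uniformly convex at $x\in\operatorname{dom} f$ if there is an increasing $\psi:[0,\infty[\to[0,\infty]$ vanishing only at $0$ such that $f(ax+by)+ab\,\psi(\|x-y\|)\le af(x)+bf(y)$ for all $y$ and all $a,b>0$ with $a+b=1$. **Problem.** Let $z_i\in\mathcal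 K_i$, $f_i\in\Gamma_0(\mathcal K_i)$, $r_k\in\mathcal G_k$, $g_k\in\Gamma_0(\mathcal G_k)$, let $\ell_k\in\Gamma_0(\mathcal G_k)$ be strongly convex, let $L_{k,i}:\mathcal K_i\to\mathcal G_k$ be bounded linear, and let $\varphi:\mathcal K\to\mathbb R$ be convex and differentiable with Lipschitz gradient $\nabla\varphi=(\nabla_i\varphi)_{1\le i\le m}$. Suppose that there are $x'\in\mathcal K$ and $v'\in\mathcal G$ with $$v'_k\in(\partial\ell_k\,\square\,\partial g_k)\Big(\sum_{j}L_{k,j}x'_j-r_k\Big)\ (1\le k\le s),\qquad z_i\in\partial f_i(x'_i)+\sum_{k}L_{k,i}^*v'_k+\nabla_i\varphi(x')\ (1\le i\le m).$$ Let $\mathcal P$ be the set, assumed to be nonempty, of solutions of the primal problem $$\min_{x\in\mathcal K}\ \sum_{i}\big(f_i(x_i)-\langle x_i,z_i\rangle\big)+\sum_{k}(\ell_k\,\square\, g_k)\Big(\sum_{i}L_{k,i}x_i-r_k\Big)+\varphi(x),$$ and $\mathcal D$ the set of solutions of the dual problem $$\min_{v\in\mathcal G}\ \Big(\varphi^*\,\square\,\Big(\sum_{i}f_i^*\Big)\Big)\Big(\Big(z_i-\sum_{k}L_{k,i}^*v_k\Big)_{1\le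 i\le m}\Big)+\sum_{k}\big(\ell_k^*(v_k)+g_k^*(v_k)+\langle v_k,r_k\rangle\big),$$ where $\sum_i f_i^*$ denotes the function $y\mapsto\sum_i f_i^*(y_i)$ on $\mathcal K$. **Constants.** Let $V_i$ on $\mathcal K_i$ and $W_k$ on $\mathcal G_k$ be bounded, self-adjoint and strongly positive, and let $\nu_0,\mu_0>0$ be such that, for all $x,y\in\mathcal K$ and $v,w\in\mathcal G$, $$\sum_i\langle x_i-y_i,\nabla_i\varphi(x)-\nabla_i\varphi(y)\rangle\ge\nu_0\sum_i\|\nabla_i\varphi(x)-\nabla_i\varphi(y)\|_{V_i}^2,$$ $$\sum_k\langle v_k-w_k,\nabla\ell_k^*(v_k)-\nabla\ell_k^*(w_k)\rangle\ge\mu_0\sum_k\|\nabla\ell_k^*(v_k)-\nabla\ell_k^*(w_k)\|_{W_k}^2.$$ Put $Vx=(V_ix_i)_i$, $Wv=(W_kv_k)_k$, $Lx=(\sum_iL_{k,i}x_i)_k$, $\rho=\|\sqrt W L\sqrt V\|$, and $$\beta_\xi=(1-\rho^2)\min\Big\{\frac{\nu_0}{1+\xi\rho},\frac{\mu_0}{1+\xi^{-1}\rho}\Big\},\qquad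 \hat\xi=\frac{\nu_0-\mu_0+\sqrt{(\mu_0-\nu_0)^2+4\rho^2\nu_0\mu_0}}{2\mu_0\rho},\qquad \hat\beta=\beta_{\hat\xi}$$ (if $\rho=0$, then $\hat\beta=\min\{\nu_0,\mu_0\}$). Suppose that $\hat\beta>1/2$. Let $\varepsilon\in\,]0,\min\{1,\hat\beta\}[$, $\lambda_n\in[\varepsilon,1]$, $\alpha_n\in[0,1-\varepsilon]$. **Algorithm.** On a probability space, let $(a_n)_{n\in\mathbb N}$ be a $\mathcal K$-valued and $(b_n)_{n\in\mathbb N}$ a $\mathcal G$-valued square integrable random process, let $x_0,v_0$ be square integrable $\mathcal K$- and $\mathcal G$-valued random variables, $x_{-1}=x_0$, $v_{-1}=v_0$, and for every $n\in\mathbb N$, $1\le i\le m$, $1\le k\le s$ let $$\begin{aligned} c_{i,n}&=x_{i,n}+\alpha_n(x_{i,n}-x_{i,n-1}),\qquad d_{k,n}=v_{k,n}+\alpha_n(v_{k,n}-v_{k,n-1}),\\ t_{i,n}&=\textstyle\sum_kL_{k,i}^*d_{k,n}+a_{i,n},\qquad p_{i,n}=\operatorname{prox}_{f_i}^{V_i^{-1}}\big(c_{i,n}-V_i(t_{i,n}-z_i)\big),\\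 y_{i,n}&=2p_{i,n}-c_{i,n},\qquad x_{i,n+1}=x_{i,n}+\lambda_n(p_{i,n}-x_{i,n}),\\ u_{k,n}&=\textstyle\sum_iL_{k,i}y_{i,n}-b_{k,n},\qquad q_{k,n}=\operatorname{prox}_{g_k^*}^{W_k^{-1}}\big(d_{k,n}+W_k(u_{k,n}-r_k)\big),\\ v_{k,n+1}&=v_{k,n}+\lambda_n(q_{k,n}-v_{k,n}). \end{aligned}$$ Let $\mathcal F_n=\sigma\big((x_0,v_0),\dots,(x_n,v_n)\big)$ and suppose that (a) $\mathsf E[a_n\mid\mathcal F_n]=\nabla\varphi(c_n)$ and $\mathsf E[b_n\mid\mathcal F_n]=(\nabla\ell_k^*(d_{k,n}))_{1\le k\le s}$ a.s., for every $n$; (b) $\sum_n\mathsf E\big[\sum_i\|a_{i,n}-\nabla_i\varphi(c_n)\|^2+\sum_k\|b_{k,n}-\nabla\ell_k^*(d_{k,n})\|^2\,\big|\,\mathcal F_n\big]<+\infty$ a.s.; (c) $\max_i\sup_n\|x_{i,n}-x_{i,n-1}\|<\infty$ a.s., $\max_k\sup_n\|v_{k,n}-v_{k,n-1}\|<\infty$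 a.s., and $\sum_n\alpha_n<+\infty$. **Conclusion.** There is a random vector $(\overline x,\overline v)$ with values in $\mathcal K\times\mathcal G$, and in $\mathcal P\times\mathcal D$ almost surely, such that: (i) almost surely, $x_{i,n}\rightharpoonup\overline x_i$ for every $i$ and $v_{k,n}\rightharpoonup\overline v_k$ for every $k$ (weak convergence); (ii) for almost every $\omega$: if $\varphi$ is uniformly convex at $\overline x(\omega)$, then $x_{i,n}(\omega)\to\overline x_i(\omega)$ strongly for every $i$; (iii) for every $j\in\{1,\dots,s\}$ and almost every $\omega$: if $\ell_j^*$ is uniformly convex at $\overline v_j(\omega)$, then $v_{j,n}(\omega)\to\overline v_j(\omega)$ strongly; (iv) if $\varphi(x)=\sum_ih_i(x_i)$ for all $x$, with $h_i:\mathcal K_i\to\mathbb R$ convex and differentiable, then for every $j\in\{1,\dots,m\}$ and almost every $\omega$: if $h_j$ is uniformly convex at $\overline x_j(\omega)$, then $x_{j,n}(\omega)\to\overline x_j(\omega)$ strongly. -/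

import Mathlib

open MeasureTheory Filter Topology
open scoped NNReal ENNReal Pointwise

namespace PrimalDual

section ConvexAnalysis

variable {H : Type*} [NormedAddCommGroup H] [InnerProductSpace ℝ H]

/-- The class `Γ₀(H)` of proper lower semicontinuous convex functions `H → ]-∞, +∞]`. -/
structure IsGammaZero (f : H → EReal) : Prop where
  ne_bot : ∀ x, f x ≠ ⊥
  proper : ∃ x, f x ≠ ⊤
  lsc : LowerSemicontinuous f
  convex : ∀ x y : H, ∀ a b : ℝ, 0 < a → 0 < b → a + b = 1 →
    f (a • x + b • y) ≤ (a : EReal) * f x + (b : EReal) * f y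

/-- Strong convexity (with some constant `ρ > 0`) of a `]-∞, +∞]`-valued function. -/
def IsStronglyConvex (f : H → EReal) : Prop :=
  ∃ ρ : ℝ, 0 < ρ ∧ ∀ x y : H, ∀ a b : ℝ, 0 < a → 0 < b → a + b = 1 →
    f (a • x + b • y) + ((a * b * (ρ / 2) * ‖x - y‖ ^ 2 : ℝ) : EReal)
      ≤ (a : EReal) * f x + (b : EReal) * f y

/-- Uniform convexity of `f` at the point `x ∈ dom f`: there is an increasing modulus
`ψ : [0, +∞[ → [0, +∞]`, vanishing only at `0`, with
`f (a x + b y) + a b ψ(‖x - y‖) ≤ a f x + b f y` for all `y` and all `a, b > 0`, `a + b = 1`. -/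
def UniformlyConvexAt (f : H → EReal) (x : H) : Prop :=
  f x ≠ ⊤ ∧ ∃ ψ : ℝ≥0 → ℝ≥0∞, Monotone ψ ∧ (∀ t, ψ t = 0 ↔ t = 0) ∧
    ∀ y : H, ∀ a b : ℝ, 0 < a → 0 < b → a + b = 1 →
      f (a • x + b • y) + ((ENNReal.ofReal (a * b) * ψ ‖x - y‖₊ : ℝ≥0∞) : EReal)
        ≤ (a : EReal) * f x + (b : EReal) * f y

/-- The Fenchel conjugate `f* : u ↦ sup_x (⟨u, x⟩ - f x)`. -/
noncomputable def conjugate (f : H → EReal) (u : H) : EReal :=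
  ⨆ x : H, ((inner ℝ u x : ℝ) : EReal) - f x

/-- The infimal convolution `f □ g : x ↦ inf_y (f y + g (x - y))`. -/
noncomputable def infConv (f g : H → EReal) (x : H) : EReal :=
  ⨅ y : H, f y + g (x - y)

/-- The subdifferential of `f`, as a set-valued operator. -/
def subdifferential (f : H → EReal) (x : H) : Set H :=
  {u | ∀ y : H, ((inner ℝ (y - x) u : ℝ) : EReal) + f x ≤ f y}

/-- The inverse of a set-valued operator. -/
def setInv (A : H → Set H) (u : H) : Set H := {x | u ∈ A x}

/-- The parallel sum `A □ B = (A⁻¹ + B⁻¹)⁻¹` of two set-valued operators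
(`+` is the Minkowski sum of sets). -/
def parallelSum (A B : H → Set H) : H → Set H :=
  setInv (fun u => setInv A u + setInv B u)

/-- `‖x‖_U² = ⟨U x, x⟩`. -/
noncomputable def sqNorm (U : H →L[ℝ] H) (x : H) : ℝ := inner ℝ (U x) x

/-- The proximity operator of `f` in the metric of `U`: `prox f U x` is the minimizer of
`y ↦ f y + ½ ‖x - y‖_U²` (it exists and is unique for `f ∈ Γ₀(H)` and `U` self-adjoint and
strongly positive on a Hilbert space). -/
noncomputable def prox (f : H → EReal) (U : H →L[ℝ] H) (x : H) : H :=
  Classical.epsilon fun p : H =>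
    IsMinOn (fun y => f y + ((1 / 2 * sqNorm U (x - y) : ℝ) : EReal)) Set.univ p

/-- The positive square root of a positive operator: the (unique) positive `S` with `S ∘ S = T`. -/
noncomputable def opSqrt (T : H →L[ℝ] H) : H →L[ℝ] H :=
  Classical.epsilon fun S : H →L[ℝ] H => S.IsPositive ∧ S ∘L S = T

/-- Self-adjoint, strongly positive bounded operators. -/
def IsStronglyPositive [CompleteSpace H] (U : H →L[ℝ] H) : Prop :=
  IsSelfAdjoint U ∧ ∃ χ : ℝ, 0 < χ ∧ ∀ x : H, χ * ‖x‖ ^ 2 ≤ inner ℝ (U x) x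

/-- The gradient `∇f*` of the conjugate of `f` (for `f ∈ Γ₀(H)` strongly convex, `f*` is
real-valued and differentiable on the whole of `H`). -/
noncomputable def gradConj [CompleteSpace H] (f : H → EReal) : H → H :=
  gradient fun u => (conjugate f u).toReal

end ConvexAnalysis

section Constants

/-- `ξ̂ = (ν - μ + √((μ - ν)² + 4 ρ² ν μ)) / (2 μ ρ)`; for `ρ = 0` this is the junk value `0`,
but then `betaXi ν μ 0 ξ = min ν μ` does not depend on `ξ`. -/
noncomputable def xiHat (ν μ ρ : ℝ) : ℝ :=
  (ν - μ + Real.sqrt ((μ - ν) ^ 2 + 4 * ρ ^ 2 * ν * μ)) / (2 * μ * ρ)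

/-- `β_ξ = (1 - ρ²) min {ν (1 + ξ ρ)⁻¹, μ (1 + ξ⁻¹ ρ)⁻¹}`. -/
noncomputable def betaXi (ν μ ρ ξ : ℝ) : ℝ :=
  (1 - ρ ^ 2) * min (ν * (1 + ξ * ρ)⁻¹) (μ * (1 + ξ⁻¹ * ρ)⁻¹)

end Constants

section Blocks

variable {m s : ℕ}
variable {K : Fin m → Type*} [∀ i, NormedAddCommGroup (K i)] [∀ i, InnerProductSpace ℝ (K i)]
variable {G : Fin s → Type*} [∀ k, NormedAddCommGroup (G k)] [∀ k, InnerProductSpace ℝ (G k)]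

/-- The operator `x ↦ (∑ i, L k i (x i))_k` between the Hilbert direct sums. -/
noncomputable def blockOp (L : ∀ k i, K i →L[ℝ] G k) : PiLp 2 K →L[ℝ] PiLp 2 G :=
  ((PiLp.continuousLinearEquiv 2 ℝ G).symm : (∀ k, G k) →L[ℝ] PiLp 2 G) ∘L
    ContinuousLinearMap.pi fun k => ∑ i, L k i ∘L PiLp.proj 2 K i

/-- The operator `x ↦ (V i (x i))_i` on the Hilbert direct sum. -/
noncomputable def diagOp (V : ∀ i, K i →L[ℝ] K i) : PiLp 2 K →L[ℝ] PiLp 2 K :=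
  ((PiLp.continuousLinearEquiv 2 ℝ K).symm : (∀ i, K i) →L[ℝ] PiLp 2 K) ∘L
    ContinuousLinearMap.pi fun i => V i ∘L PiLp.proj 2 K i

/-- `‖√W L √V‖`. -/
noncomputable def rhoNorm (L : ∀ k i, K i →L[ℝ] G k) (V : ∀ i, K i →L[ℝ] K i)
    (W : ∀ k, G k →L[ℝ] G k) : ℝ :=
  ‖opSqrt (diagOp W) ∘L blockOp L ∘L opSqrt (diagOp V)‖

/-- The constant `β̂ = β_ξ` at `ξ = ξ̂`. -/
noncomputable def betaHat (ν μ : ℝ) (L : ∀ k i, K i →L[ℝ] G k) (V : ∀ i, K i →L[ℝ] K i)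
    (W : ∀ k, G k →L[ℝ] G k) : ℝ :=
  betaXi ν μ (rhoNorm L V W) (xiHat ν μ (rhoNorm L V W))

/-- The primal objective
`∑ i (f i (x i) - ⟨x i, z i⟩) + ∑ k (ℓ k □ g k) (∑ i L k i (x i) - r k) + φ x`. -/
noncomputable def primalObj (f : ∀ i, K i → EReal) (z : ∀ i, K i) (ℓ g : ∀ k, G k → EReal)
    (r : ∀ k, G k) (L : ∀ k i, K i →L[ℝ] G k) (φ : PiLp 2 K → ℝ) (x : PiLp 2 K) : EReal :=
  (∑ i, (f i (x i) - ((inner ℝ (x i) (z i) : ℝ) : EReal)))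
    + (∑ k, infConv (ℓ k) (g k) ((∑ i, L k i (x i)) - r k)) + (φ x : EReal)

/-- The dual objective
`(φ* □ ∑ i f i*) ((z i - ∑ k (L k i)* (v k))_i) + ∑ k (ℓ k* (v k) + g k* (v k) + ⟨v k, r k⟩)`. -/
noncomputable def dualObj [∀ i, CompleteSpace (K i)] [∀ k, CompleteSpace (G k)]
    (f : ∀ i, K i → EReal) (z : ∀ i, K i) (ℓ g : ∀ k, G k → EReal)
    (r : ∀ k, G k) (L : ∀ k i, K i →L[ℝ] G k) (φ : PiLp 2 K → ℝ) (v : PiLp 2 G) : EReal :=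
  infConv (conjugate fun x : PiLp 2 K => (φ x : EReal))
      (fun y : PiLp 2 K => ∑ i, conjugate (f i) (y i))
      (WithLp.toLp 2 fun i => z i - ∑ k, ContinuousLinearMap.adjoint (L k i) (v k))
    + ∑ k, (conjugate (ℓ k) (v k) + conjugate (g k) (v k) + ((inner ℝ (v k) (r k) : ℝ) : EReal))

/-- The set `𝒫` of solutions to the primal problem. -/
def primalSolutions (f : ∀ i, K i → EReal) (z : ∀ i, K i) (ℓ g : ∀ k, G k → EReal)
    (r : ∀ k, G k) (L : ∀ k i, K i →L[ℝ] G k) (φ : PiLp 2 K → ℝ) : Set (PiLp 2 K) :=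
  {x | IsMinOn (primalObj f z ℓ g r L φ) Set.univ x}

/-- The set `𝒟` of solutions to the dual problem. -/
def dualSolutions [∀ i, CompleteSpace (K i)] [∀ k, CompleteSpace (G k)]
    (f : ∀ i, K i → EReal) (z : ∀ i, K i) (ℓ g : ∀ k, G k → EReal)
    (r : ∀ k, G k) (L : ∀ k i, K i →L[ℝ] G k) (φ : PiLp 2 K → ℝ) : Set (PiLp 2 G) :=
  {v | IsMinOn (dualObj f z ℓ g r L φ) Set.univ v}

end Blocks

/-- `σ(X 0, …, X n)`. -/
@[reducible] def pastSigma {Ω E : Type*} [MeasurableSpace E] (X : ℕ → Ω → E) (n : ℕ) : MeasurableSpace Ω :=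
  ⨆ j ∈ Set.Iic n, MeasurableSpace.comap (X j) inferInstance

/-- Weak convergence in a Hilbert space. -/
def WeakTendsto {H : Type*} [NormedAddCommGroup H] [InnerProductSpace ℝ H]
    (u : ℕ → H) (x : H) : Prop :=
  Tendsto (fun n => toWeakSpace ℝ H (u n)) atTop (𝓝 (toWeakSpace ℝ H x))

end PrimalDual

open PrimalDual

/-! The primal and dual problems are solved together as one monotone inclusion on the product space.
With `A (x, v) = (∂f x - z + L* v) × (∂g* v + r - L x)` (`kktOp`) and `B (x, v) = (∇φ x, ∇ℓ* v)`
(`kktGrad`), the zeros of `A + B` are Kuhn-Tucker pairs, and such pairs solve the two problems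
(`mem_solutions_of_kkt_zero`). In the metric `U (x, v) = (V⁻¹ x - L* v, W⁻¹ v - L x)` the coupling
cancels from the primal row of `U + A`, so `J = (U + A)⁻¹` is computed by one primal proximal step
followed by one dual proximal step. The algorithm is therefore the stochastic inertial
forward-backward iteration `X (n + 1) = X n + lam n • (J (U (w n) - e n) - X n)`, where `w n = X n +
α n • (X n - X (n - 1))` and `e n` is an unbiased estimate of `B (w n)` (`kktResolvent_eq`). The
constant `β̂` is a cocoercivity constant of `B` relative to `U`, and `β̂ > 1/2` is what a unit step
needs (`exists_isForwardBackward_kkt`).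

Convergence rests on a pathwise descent inequality for the squared `U`-distance to a zero `z`
(`exists_relaxed_step_inequality`). The noise enters it in two ways: through its squared norm, and
through its inner product with the noiseless point `J (U w - B w) - z`. The latter is measurable
with respect to the past, so its conditional mean vanishes. The Robbins-Siegmund lemma
(`robbins_siegmund`) then yields, almost surely, convergence of the distance to `z`, `w n - J (U (w
n) - B (w n)) → 0` and `B (w n) → B z` strongly.

The exceptional null set depends on `z`. It is controlled by taking `z` in a countable dense set of
zeros, for which a version of Opial's argument still gives weak convergence
(`exists_innerTendsto_of_opial`); cluster points are zeros because the graph of `A` is weak-strong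
closed. Strong convergence comes from `B (w n) → B Xbar`: the gradients converge strongly to the
gradient at the limit, and uniform convexity at that limit turns this into strong convergence of the
arguments (`UniformlyConvexAt.tendsto`). -/

namespace PrimalDual

/-! ### Weak convergence along filters -/

section WeakLimits

variable {H : Type*} [NormedAddCommGroup H] [InnerProductSpace ℝ H] {ι : Type*}

/-- Weak convergence along a filter, tested with inner products. -/
def InnerTendsto (l : Filter ι) (u : ι → H) (x : H) : Prop :=
  ∀ h : H, Tendsto (fun n => inner ℝ (u n) h) l (𝓝 (inner ℝ x h))

/-- By the Riesz representation every continuous functional is an inner product, so testing against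
vectors tests the whole dual. -/
theorem InnerTendsto.weakTendsto [CompleteSpace H] {u : ℕ → H} {x : H}
    (h : InnerTendsto atTop u x) : WeakTendsto u x := by
  unfold WeakTendsto
  have hinj : Function.Injective ((topDualPairing ℝ H).flip) := by
    intro a b hab
    refine ext_inner_right ℝ fun v => ?_
    have := congrArg (fun F => F (InnerProductSpace.toDual ℝ H v)) hab
    simpa [topDualPairing, real_inner_comm] using this
  refine (WeakBilin.tendsto_iff_forall_eval_tendsto (B := (topDualPairing ℝ H).flip) hinj).2 ?_
  intro y
  have key : ∀ w : H, ((topDualPairing ℝ H).flip (toWeakSpace ℝ H w)) y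
      = inner ℝ w ((InnerProductSpace.toDual ℝ H).symm y) := by
    intro w
    rw [real_inner_comm, InnerProductSpace.toDual_symm_apply]
    rfl
  have := h ((InnerProductSpace.toDual ℝ H).symm y)
  simp only [key]
  exact this

theorem InnerTendsto.add {l : Filter ι} {u u' : ι → H} {x x' : H} (h : InnerTendsto l u x)
    (h' : InnerTendsto l u' x') : InnerTendsto l (fun n => u n + u' n) (x + x') := by
  intro v
  simpa only [inner_add_left] using (h v).add (h' v)

theorem innerTendsto_of_tendsto {l : Filter ι} {u : ι → H} {x : H} (h : Tendsto u l (𝓝 x)) :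
    InnerTendsto l u x := fun _ => h.inner tendsto_const_nhds

/-- A sequence at vanishing distance from a weakly convergent one has the same weak limit. -/
theorem InnerTendsto.of_sub {l : Filter ι} {u u' : ι → H} {x : H} (h : InnerTendsto l u x)
    (h' : Tendsto (fun n => u' n - u n) l (𝓝 0)) : InnerTendsto l u' x := by
  simpa using h.add (innerTendsto_of_tendsto h')

/-- The pairing of a bounded weakly convergent family with a strongly convergent one converges. -/
theorem InnerTendsto.inner_of_tendsto {l : Filter ι} {u s : ι → H} {x t : H} {C : ℝ}
    (h : InnerTendsto l u x) (hC : ∀ n, ‖u n‖ ≤ C) (hs : Tendsto s l (𝓝 t)) :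
    Tendsto (fun n => inner ℝ (u n) (s n)) l (𝓝 (inner ℝ x t)) := by
  have h0 : Tendsto (fun n => inner ℝ (u n) (s n - t)) l (𝓝 0) := by
    refine squeeze_zero_norm (a := fun n => C * ‖s n - t‖) (fun n => ?_) ?_
    · exact (norm_inner_le_norm _ _).trans (mul_le_mul_of_nonneg_right (hC n) (norm_nonneg _))
    · simpa using (tendsto_iff_norm_sub_tendsto_zero.1 hs).const_mul C
  have := h0.add (h t)
  simpa [inner_sub_right] using this

/-- Weak compactness of bounded families along ultrafilters. -/
theorem exists_innerTendsto_of_bounded [CompleteSpace H] (l : Ultrafilter ι) {u : ι → H} {C : ℝ}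
    (hC : ∀ n, ‖u n‖ ≤ C) : ∃ x, InnerTendsto (l : Filter ι) u x := by
  have hb : ∀ h : H, ∀ n, inner ℝ (u n) h ∈ Set.Icc (-(C * ‖h‖)) (C * ‖h‖) := by
    intro h n
    rw [Set.mem_Icc, ← abs_le]
    exact (abs_real_inner_le_norm _ _).trans (mul_le_mul_of_nonneg_right (hC n) (norm_nonneg _))
  have hex : ∀ h : H, ∃ t ∈ Set.Icc (-(C * ‖h‖)) (C * ‖h‖),
      Tendsto (fun n => inner ℝ (u n) h) (l : Filter ι) (𝓝 t) := by
    intro h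
    have := (isCompact_Icc (a := -(C * ‖h‖)) (b := C * ‖h‖)).ultrafilter_le_nhds
      (l.map fun n => inner ℝ (u n) h) (by
        rw [le_principal_iff]
        exact Filter.mem_map.2 (Filter.univ_mem' (hb h)))
    exact this
  choose T hT1 hT2 using hex
  -- The scalar limits depend linearly on `h` and are bounded by `C * ‖h‖`; the weak limit is the
  -- Riesz representative of this functional.
  let T' : H →ₗ[ℝ] ℝ :=
    { toFun := T
      map_add' := fun a b => by
        refine tendsto_nhds_unique (hT2 (a + b)) ?_
        simpa only [inner_add_right] using (hT2 a).add (hT2 b)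
      map_smul' := fun c a => by
        refine tendsto_nhds_unique (hT2 (c • a)) ?_
        simpa only [inner_smul_right, smul_eq_mul, RingHom.id_apply] using
          (hT2 a).const_mul c }
  let T'' : H →L[ℝ] ℝ := T'.mkContinuous C fun h => abs_le.2 (hT1 h)
  refine ⟨(InnerProductSpace.toDual ℝ H).symm T'', fun h => ?_⟩
  rw [InnerProductSpace.toDual_symm_apply]
  exact hT2 h

theorem sqNorm_smul (U : H →L[ℝ] H) (c : ℝ) (x : H) : sqNorm U (c • x) = c ^ 2 * sqNorm U x := by
  simp only [sqNorm, map_smul, inner_smul_left, inner_smul_right, RCLike.conj_to_real]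
  ring

theorem sqNorm_le (U : H →L[ℝ] H) (x : H) : sqNorm U x ≤ ‖U‖ * ‖x‖ ^ 2 := by
  calc sqNorm U x ≤ ‖U x‖ * ‖x‖ := real_inner_le_norm _ _
    _ ≤ (‖U‖ * ‖x‖) * ‖x‖ := by gcongr; exact U.le_opNorm x
    _ = _ := by ring

end WeakLimits

/-! ### Opial's argument in a variable metric -/

section Opial

variable {H : Type*} [NormedAddCommGroup H] [InnerProductSpace ℝ H] [CompleteSpace H]

theorem inner_map_symm {U : H →L[ℝ] H} (hU : IsSelfAdjoint U) (x y : H) :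
    inner ℝ (U x) y = inner ℝ x (U y) := by
  have := ContinuousLinearMap.isSelfAdjoint_iff_isSymmetric.1 hU
  exact this x y

theorem sqNorm_sub {U : H →L[ℝ] H} (hU : IsSelfAdjoint U) (x y : H) :
    sqNorm U (x - y) = sqNorm U x - 2 * inner ℝ (U x) y + sqNorm U y := by
  unfold sqNorm
  have := inner_map_symm hU x y
  rw [map_sub, inner_sub_left, inner_sub_right, inner_sub_right, real_inner_comm x (U y)]
  linarith

theorem sqNorm_add {U : H →L[ℝ] H} (hU : IsSelfAdjoint U) (x y : H) :
    sqNorm U (x + y) = sqNorm U x + 2 * inner ℝ (U x) y + sqNorm U y := by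
  have := sqNorm_sub hU x (-y)
  simp only [sub_neg_eq_add, inner_neg_right] at this
  rw [this]
  simp [sqNorm]

/-- Opial's argument for the metric of `U`, where the distances converge only for the points
of a dense subset `D` of the target set `Z`. -/
theorem exists_innerTendsto_of_opial {U : H →L[ℝ] H} (hU : IsSelfAdjoint U) {χ : ℝ} (hχ : 0 < χ)
    (hpos : ∀ x, χ * ‖x‖ ^ 2 ≤ sqNorm U x) {Z D : Set H} (hDne : D.Nonempty)
    (hD : Z ⊆ closure D) {x : ℕ → H}
    (hlim : ∀ z ∈ D, ∃ t, Tendsto (fun n => sqNorm U (x n - z)) atTop (𝓝 t))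
    (hclust : ∀ l : Ultrafilter ℕ, (l : Filter ℕ) ≤ atTop → ∀ y,
      InnerTendsto (l : Filter ℕ) x y → (∃ C, ∀ n, ‖x n‖ ≤ C) → y ∈ Z) :
    ∃ y ∈ Z, InnerTendsto atTop x y := by
  obtain ⟨z0, hz0⟩ := hDne
  have hbdd : ∃ C, ∀ n, ‖x n‖ ≤ C := by
    obtain ⟨t, ht⟩ := hlim z0 hz0
    obtain ⟨M, hM⟩ := ht.bddAbove_range
    refine ⟨Real.sqrt (M / χ) + ‖z0‖, fun n => ?_⟩
    have h1 : χ * ‖x n - z0‖ ^ 2 ≤ M := (hpos _).trans (hM ⟨n, rfl⟩)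
    have h2 : ‖x n - z0‖ ≤ Real.sqrt (M / χ) := by
      apply Real.le_sqrt_of_sq_le
      rw [le_div_iff₀ hχ]; linarith
    calc ‖x n‖ = ‖(x n - z0) + z0‖ := by simp
      _ ≤ ‖x n - z0‖ + ‖z0‖ := norm_add_le _ _
      _ ≤ _ := by gcongr
  obtain ⟨C, hC⟩ := hbdd
  have huniq : ∀ l l' : Ultrafilter ℕ, (l : Filter ℕ) ≤ atTop → (l' : Filter ℕ) ≤ atTop →
      ∀ y y', InnerTendsto (l : Filter ℕ) x y → InnerTendsto (l' : Filter ℕ) x y' → y = y' := by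
    intro l l' hl hl' y y' hy hy'
    have hyZ := hclust l hl y hy ⟨C, hC⟩
    have hyZ' := hclust l' hl' y' hy' ⟨C, hC⟩
    -- The quadratic term in `x n` cancels in the difference of the squared distances to `z` and
    -- `z'`. Hence `⟪x n, U (z - z')⟫` converges along the whole sequence, and both cluster points
    -- give the same value.
    have h1 : ∀ z ∈ D, ∀ z' ∈ D, inner ℝ (U (y - y')) (z - z') = 0 := by
      intro z hz z' hz'
      obtain ⟨t, ht⟩ := hlim z hz
      obtain ⟨t', ht'⟩ := hlim z' hz'
      have hconv : Tendsto (fun n => inner ℝ (x n) (U (z - z'))) atTop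
          (𝓝 ((t' - t + (sqNorm U z - sqNorm U z')) / 2)) := by
        have h3 := ((ht'.sub ht).add_const (sqNorm U z - sqNorm U z')).div_const 2
        refine h3.congr fun n => ?_
        rw [sqNorm_sub hU, sqNorm_sub hU, ← inner_map_symm hU, inner_sub_right]
        ring
      have e1 := tendsto_nhds_unique (hy (U (z - z'))) (hconv.mono_left hl)
      have e2 := tendsto_nhds_unique (hy' (U (z - z'))) (hconv.mono_left hl')
      rw [inner_map_symm hU, inner_sub_left, e1, e2, sub_self]
    have h2 : ∀ z ∈ closure D, ∀ z' ∈ closure D, inner ℝ (U (y - y')) (z - z') = 0 := by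
      intro z hz z' hz'
      have hcl : IsClosed {p : H × H | inner ℝ (U (y - y')) (p.1 - p.2) = 0} :=
        isClosed_eq (by fun_prop) continuous_const
      have hsub : closure (D ×ˢ D) ⊆ {p : H × H | inner ℝ (U (y - y')) (p.1 - p.2) = 0} :=
        closure_minimal (fun p hp => h1 p.1 hp.1 p.2 hp.2) hcl
      have : ((z, z') : H × H) ∈ closure (D ×ˢ D) := by
        rw [closure_prod_eq]; exact ⟨hz, hz'⟩
      exact hsub this
    -- By density the orthogonality holds on all of `Z`, which contains the two cluster points
    -- themselves: `‖y - y'‖_U² = 0`.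
    have h3 := h2 y (hD hyZ) y' (hD hyZ')
    have h4 := hpos (y - y')
    unfold sqNorm at h4
    rw [h3] at h4
    have h5 : ‖y - y'‖ ^ 2 = 0 := by
      have : 0 ≤ ‖y - y'‖ ^ 2 := by positivity
      nlinarith
    have : ‖y - y'‖ = 0 := by simpa using h5
    exact sub_eq_zero.1 (norm_eq_zero.1 this)
  obtain ⟨y, hy⟩ := exists_innerTendsto_of_bounded (Ultrafilter.of (atTop : Filter ℕ)) hC
  refine ⟨y, hclust _ (Ultrafilter.of_le _) y hy ⟨C, hC⟩, fun h => ?_⟩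
  rw [tendsto_iff_ultrafilter]
  intro l hl
  obtain ⟨y', hy'⟩ := exists_innerTendsto_of_bounded l hC
  have := huniq _ l (Ultrafilter.of_le _) hl y y' hy hy'
  rw [this]
  exact hy' h

end Opial

/-! ### Deterministic estimates for one forward-backward step -/

section ForwardBackward

variable {H : Type*} [NormedAddCommGroup H] [InnerProductSpace ℝ H] [CompleteSpace H]

/-- `A` is a monotone operator with `J = (U + A)⁻¹` defined everywhere, where `U` is self-adjoint
and strongly positive with inverse `R`, and `B` is `β`-cocoercive in the metric of `U`. -/
structure IsForwardBackward (U R : H →L[ℝ] H) (A : H → Set H) (J B : H → H) (χ β : ℝ) :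
    Prop where
  selfAdjoint : IsSelfAdjoint U
  pos : 0 < χ
  le_sqNorm : ∀ x, χ * ‖x‖ ^ 2 ≤ sqNorm U x
  right_inv : ∀ x, U (R x) = x
  monotone : ∀ x y u v, u ∈ A x → v ∈ A y → 0 ≤ inner ℝ (x - y) (u - v)
  resolvent : ∀ h, h - U (J h) ∈ A (J h)
  half_lt : 1 / 2 < β
  cocoercive : ∀ x y, β * sqNorm R (B x - B y) ≤ inner ℝ (x - y) (B x - B y)

namespace IsForwardBackward

variable {U R : H →L[ℝ] H} {A : H → Set H} {J B : H → H} {χ β : ℝ}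

theorem sqNorm_nonneg (h : IsForwardBackward U R A J B χ β) (x : H) : 0 ≤ sqNorm U x :=
  (mul_nonneg h.pos.le (by positivity)).trans (h.le_sqNorm x)

theorem sqNorm_inv (h : IsForwardBackward U R A J B χ β) (x : H) :
    sqNorm R x = sqNorm U (R x) := by
  unfold sqNorm
  rw [h.right_inv, real_inner_comm]

/-- The resolvent is firmly nonexpansive. -/
theorem sqNorm_resolvent_sub_le (h : IsForwardBackward U R A J B χ β) (x y : H) :
    sqNorm U (J x - J y) ≤ inner ℝ (J x - J y) (x - y) := by
  have h1 := h.monotone _ _ _ _ (h.resolvent x) (h.resolvent y)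
  have h2 : x - U (J x) - (y - U (J y)) = (x - y) - U (J x - J y) := by
    rw [map_sub]; abel
  rw [h2, inner_sub_right, ← inner_map_symm h.selfAdjoint] at h1
  unfold sqNorm
  linarith

theorem norm_resolvent_sub_le (h : IsForwardBackward U R A J B χ β) (x y : H) :
    ‖J x - J y‖ ≤ χ⁻¹ * ‖x - y‖ := by
  have h1 := (h.le_sqNorm _).trans ((h.sqNorm_resolvent_sub_le x y).trans (real_inner_le_norm _ _))
  rw [inv_mul_eq_div, le_div_iff₀ h.pos]
  rcases (norm_nonneg (J x - J y)).eq_or_lt with h0 | h0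
  · rw [← h0]; simp
  · refine le_of_mul_le_mul_left ?_ h0
    nlinarith

/-- From `x = U (R x)` one gets `‖x‖ ≤ ‖U‖ ‖R x‖`, and `‖x‖_R² = ‖R x‖_U²`. Writing `‖U‖ + 1` keeps
the denominator positive even on the trivial space. -/
theorem norm_sq_le_sqNorm_inv (h : IsForwardBackward U R A J B χ β) (x : H) :
    χ / (‖U‖ + 1) ^ 2 * ‖x‖ ^ 2 ≤ sqNorm R x := by
  rw [h.sqNorm_inv]
  refine le_trans ?_ (h.le_sqNorm _)
  have h1 : ‖x‖ ≤ (‖U‖ + 1) * ‖R x‖ := by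
    calc ‖x‖ = ‖U (R x)‖ := by rw [h.right_inv]
      _ ≤ ‖U‖ * ‖R x‖ := U.le_opNorm _
      _ ≤ _ := by gcongr; linarith
  have h2 : ‖x‖ ^ 2 ≤ (‖U‖ + 1) ^ 2 * ‖R x‖ ^ 2 := by
    rw [← mul_pow]; exact pow_le_pow_left₀ (norm_nonneg _) h1 2
  have h3 : (0:ℝ) < (‖U‖ + 1) ^ 2 := by positivity
  rw [div_mul_eq_mul_div, div_le_iff₀ h3]
  nlinarith [h.pos]

/-- Cocoercivity in the norm of the space. -/
theorem exists_cocoercive (h : IsForwardBackward U R A J B χ β) :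
    ∃ τ : ℝ, 0 < τ ∧ ∀ x y, τ * ‖B x - B y‖ ^ 2 ≤ inner ℝ (x - y) (B x - B y) := by
  have hβ : 0 < β := by linarith [h.half_lt]
  have := h.pos
  refine ⟨β * (χ / (‖U‖ + 1) ^ 2), by positivity, fun x y => ?_⟩
  refine le_trans ?_ (h.cocoercive x y)
  rw [mul_assoc]
  exact mul_le_mul_of_nonneg_left (h.norm_sq_le_sqNorm_inv _) hβ.le

theorem exists_lipschitz (h : IsForwardBackward U R A J B χ β) : ∃ C : ℝ≥0, LipschitzWith C B := by
  obtain ⟨τ, hτ, hc⟩ := h.exists_cocoercive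
  refine ⟨⟨τ⁻¹, (inv_pos.2 hτ).le⟩, LipschitzWith.of_dist_le_mul fun x y => ?_⟩
  rw [dist_eq_norm, dist_eq_norm]
  change _ ≤ τ⁻¹ * _
  have h1 := (hc x y).trans (real_inner_le_norm _ _)
  rw [inv_mul_eq_div, le_div_iff₀ hτ]
  rcases (norm_nonneg (B x - B y)).eq_or_lt with h0 | h0
  · rw [← h0]; simp
  · refine le_of_mul_le_mul_left ?_ h0
    nlinarith

theorem lipschitz_resolvent (h : IsForwardBackward U R A J B χ β) :
    ∃ C : ℝ≥0, LipschitzWith C J := by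
  refine ⟨⟨χ⁻¹, (inv_pos.2 h.pos).le⟩, LipschitzWith.of_dist_le_mul fun x y => ?_⟩
  rw [dist_eq_norm, dist_eq_norm]
  exact h.norm_resolvent_sub_le x y

/-- The graph of `A` is closed for the weak × strong topology, along bounded families. -/
theorem mem_of_innerTendsto (h : IsForwardBackward U R A J B χ β) {ι : Type*} {l : Filter ι}
    [l.NeBot] {x u : ι → H} {x' u' : H} {C : ℝ} (hx : InnerTendsto l x x') (hC : ∀ n, ‖x n‖ ≤ C)
    (hu : Tendsto u l (𝓝 u')) (hxu : ∀ n, u n ∈ A (x n)) : u' ∈ A x' := by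
  have key : ∀ y w, w ∈ A y → 0 ≤ inner ℝ (x' - y) (u' - w) := by
    intro y w hw
    have h1 : Tendsto (fun n => inner ℝ (x n) (u n - w) - inner ℝ y (u n - w)) l
        (𝓝 (inner ℝ x' (u' - w) - inner ℝ y (u' - w))) :=
      (hx.inner_of_tendsto hC (hu.sub_const w)).sub
        ((tendsto_const_nhds).inner (hu.sub_const w))
    rw [inner_sub_left]
    refine ge_of_tendsto' h1 fun n => ?_
    rw [← inner_sub_left]
    exact h.monotone _ _ _ _ (hxu n) hw
  -- Minty's argument: the graph point above `y = J (u' + U x')` is the one for which monotonicity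
  -- reads `-‖x' - y‖_U² ≥ 0`. This forces `x' = y`, and the resolvent inclusion is then the claim.
  have h1 := key _ _ (h.resolvent (u' + U x'))
  set y := J (u' + U x') with hy
  have h2 : u' - (u' + U x' - U y) = -U (x' - y) := by rw [map_sub]; abel
  rw [h2, inner_neg_right, ← inner_map_symm h.selfAdjoint] at h1
  have h3 := h.le_sqNorm (x' - y)
  unfold sqNorm at h3
  have h4 : ‖x' - y‖ ^ 2 ≤ 0 := by
    by_contra hcon
    push Not at hcon
    nlinarith [h.pos]
  have h5 : x' = y := by
    have : ‖x' - y‖ = 0 := by nlinarith [norm_nonneg (x' - y), sq_nonneg ‖x' - y‖]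
    exact sub_eq_zero.1 (norm_eq_zero.1 this)
  have h6 := h.resolvent (u' + U x')
  rw [← hy, ← h5] at h6
  simpa using h6

/-- The basic inequality for a perturbed forward-backward step. -/
theorem exists_step_inequality (h : IsForwardBackward U R A J B χ β) :
    ∃ σ : ℝ, 0 < σ ∧ ∀ w e z, -B z ∈ A z →
      sqNorm U (J (U w - (B w + e)) - z) ≤ sqNorm U (w - z)
        - σ * (‖w - J (U w - B w)‖ ^ 2 + ‖B w - B z‖ ^ 2) + 3 / χ * ‖e‖ ^ 2
        - 2 * inner ℝ (J (U w - B w) - z) e := by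
  have hβ := h.half_lt
  -- Cocoercivity supplies `-2 β ‖κ‖_U²`, where `κ = R (B w - B z)`. Young's inequality with weight
  -- `θ` bounds the cross term by `θ ‖w - y‖_U² + (β + 1/2) ‖κ‖_U²`. The remaining coefficients `1 -
  -- θ` and `β - 1/2` are positive exactly because `β > 1/2`.
  set θ : ℝ := (β + 1 / 2)⁻¹ with hθ
  have hθ0 : 0 < θ := by positivity
  have hθ1 : θ < 1 := inv_lt_one_of_one_lt₀ (by linarith)
  have hθi : θ * (β + 1 / 2) = 1 := inv_mul_cancel₀ (by linarith)
  have hχ := h.pos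
  set σ : ℝ := min ((1 - θ) / 2 * χ) ((β - 1 / 2) * (χ / (‖U‖ + 1) ^ 2)) with hσ
  have hσ1 : σ ≤ (1 - θ) / 2 * χ := min_le_left _ _
  have hσ2 : σ ≤ (β - 1 / 2) * (χ / (‖U‖ + 1) ^ 2) := min_le_right _ _
  refine ⟨σ, lt_min (by apply mul_pos <;> linarith) (mul_pos (by linarith) (by positivity)), ?_⟩
  intro w e z hz
  set y := J (U w - (B w + e)) with hy
  -- The noiseless point. Replacing `y` by `y'` makes the factor paired with `e` independent of `e`.
  -- The price is `2 χ⁻¹ ‖e‖²` from the inner product and `χ⁻¹ ‖e‖²` from the residual, hence the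
  -- constant `3 / χ`.
  set y' := J (U w - B w) with hy'
  set κ := R (B w - B z) with hκ
  have hUκ : U κ = B w - B z := h.right_inv _
  have hS := h.selfAdjoint
  have h1 := h.monotone _ _ _ _ (h.resolvent (U w - (B w + e))) hz
  rw [← hy] at h1
  have e1 : U w - (B w + e) - U y - -B z = U (w - y) - U κ - e := by
    rw [hUκ, map_sub]; abel
  rw [e1, inner_sub_right, inner_sub_right, ← inner_map_symm hS] at h1
  have e2 : sqNorm U (w - z) = sqNorm U (w - y) + 2 * inner ℝ (U (w - y)) (y - z)
      + sqNorm U (y - z) := by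
    rw [← sqNorm_add hS]; congr 1; abel
  have e3 : inner ℝ (U (w - y)) (y - z) = inner ℝ (U (y - z)) (w - y) := by
    rw [inner_map_symm hS, real_inner_comm]
  have h2 := h.cocoercive w z
  rw [h.sqNorm_inv, ← hκ, ← hUκ] at h2
  have e4 : inner ℝ (w - z) (U κ) = inner ℝ (w - y) (U κ) + inner ℝ (y - z) (U κ) := by
    rw [← inner_add_left]; congr 1; abel
  have h3 : 0 ≤ θ ^ 2 * sqNorm U (w - y) - 2 * θ * inner ℝ (w - y) (U κ) + sqNorm U κ := by
    have := h.sqNorm_nonneg (θ • (w - y) - κ)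
    rw [sqNorm_sub hS, sqNorm_smul, inner_map_symm hS, inner_smul_left] at this
    simp only [RCLike.conj_to_real] at this
    linarith
  have h3' : 2 * inner ℝ (w - y) (U κ) ≤ θ * sqNorm U (w - y) + (β + 1 / 2) * sqNorm U κ := by
    have hb : 0 < β + 1 / 2 := by linarith
    have := mul_nonneg hb.le h3
    have t1 : (β + 1 / 2) * (θ ^ 2 * sqNorm U (w - y) - 2 * θ * inner ℝ (w - y) (U κ) + sqNorm U κ)
      = θ * (θ * (β + 1 / 2)) * sqNorm U (w - y)
        - 2 * (θ * (β + 1 / 2)) * inner ℝ (w - y) (U κ) + (β + 1 / 2) * sqNorm U κ := by ring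
    rw [t1, hθi] at this
    linarith
  have h4 : sqNorm U (w - y') ≤ 2 * sqNorm U (w - y) + 2 * sqNorm U (y - y') := by
    have t1 := h.sqNorm_nonneg ((w - y) - (y - y'))
    have t2 : sqNorm U (w - y') = sqNorm U ((w - y) + (y - y')) := by congr 1; abel
    rw [sqNorm_sub hS] at t1
    rw [t2, sqNorm_add hS]
    linarith
  have h5 : ‖y - y'‖ ≤ χ⁻¹ * ‖e‖ := by
    have := h.norm_resolvent_sub_le (U w - (B w + e)) (U w - B w)
    rw [← hy, ← hy'] at this
    have t : U w - (B w + e) - (U w - B w) = -e := by abel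
    rwa [t, norm_neg] at this
  have h6 : |inner ℝ (y - y') e| ≤ χ⁻¹ * ‖e‖ ^ 2 := by
    refine (abs_real_inner_le_norm _ _).trans ?_
    calc ‖y - y'‖ * ‖e‖ ≤ (χ⁻¹ * ‖e‖) * ‖e‖ := by gcongr
      _ = _ := by ring
  have h7 : sqNorm U (y - y') ≤ χ⁻¹ * ‖e‖ ^ 2 := by
    have := h.sqNorm_resolvent_sub_le (U w - (B w + e)) (U w - B w)
    rw [← hy, ← hy'] at this
    have t : U w - (B w + e) - (U w - B w) = -e := by abel
    rw [t, inner_neg_right] at this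
    linarith [neg_abs_le (inner ℝ (y - y') e)]
  have e5 : inner ℝ (y - z) e = inner ℝ (y - y') e + inner ℝ (y' - z) e := by
    rw [← inner_add_left]; congr 1; abel
  have h8 := h.le_sqNorm (w - y')
  have h9 := h.norm_sq_le_sqNorm_inv (B w - B z)
  rw [h.sqNorm_inv, ← hκ] at h9
  have h10 : σ * ‖w - y'‖ ^ 2 ≤ (1 - θ) / 2 * sqNorm U (w - y') := by
    calc σ * ‖w - y'‖ ^ 2 ≤ ((1 - θ) / 2 * χ) * ‖w - y'‖ ^ 2 := by gcongr
      _ = (1 - θ) / 2 * (χ * ‖w - y'‖ ^ 2) := by ring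
      _ ≤ _ := by
        apply mul_le_mul_of_nonneg_left h8; linarith
  have h11 : σ * ‖B w - B z‖ ^ 2 ≤ (β - 1 / 2) * sqNorm U κ := by
    calc σ * ‖B w - B z‖ ^ 2 ≤ ((β - 1 / 2) * (χ / (‖U‖ + 1) ^ 2)) * ‖B w - B z‖ ^ 2 := by gcongr
      _ = (β - 1 / 2) * (χ / (‖U‖ + 1) ^ 2 * ‖B w - B z‖ ^ 2) := by ring
      _ ≤ _ := by
        apply mul_le_mul_of_nonneg_left h9; linarith
  have h12 : (1 - θ) / 2 * sqNorm U (w - y') ≤ (1 - θ) * (sqNorm U (w - y) + sqNorm U (y - y')) := by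
    have : 0 ≤ (1 - θ) / 2 := by linarith
    nlinarith
  have h13 : (1 - θ) * sqNorm U (y - y') ≤ χ⁻¹ * ‖e‖ ^ 2 := by
    have := h.sqNorm_nonneg (y - y')
    nlinarith
  have e6 : 3 / χ * ‖e‖ ^ 2 = 3 * (χ⁻¹ * ‖e‖ ^ 2) := by ring
  have h14 := neg_abs_le (inner ℝ (y - y') e)
  rw [e6]
  have e7 : inner ℝ (y - z) (U (w - y)) = inner ℝ (U (y - z)) (w - y) :=
    (inner_map_symm hS _ _).symm
  linarith

end IsForwardBackward

end ForwardBackward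

end PrimalDual

namespace PrimalDual

/-! ### The Robbins-Siegmund lemma -/

section RobbinsSiegmund

variable {Ω : Type*} {m0 : MeasurableSpace Ω} {P : Measure Ω} [IsFiniteMeasure P]
  {ℱ : Filtration ℕ m0}

/-- Nonnegativity and decreasing expectations bound `-M` in `L¹` by `∫ M 0`, so Doob's convergence
theorem for submartingales applies. -/
theorem ae_exists_tendsto_of_nonneg_supermartingale {M : ℕ → Ω → ℝ} (hM : Supermartingale M ℱ P)
    (h0 : ∀ n ω, 0 ≤ M n ω) : ∀ᵐ ω ∂P, ∃ c, Tendsto (fun n => M n ω) atTop (𝓝 c) := by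
  have hb : ∀ n, eLpNorm ((-M) n) 1 P ≤ (∫ ω, M 0 ω ∂P).toNNReal := by
    intro n
    rw [Pi.neg_apply, eLpNorm_neg, eLpNorm_one_eq_lintegral_enorm]
    have h1 : ∫⁻ ω, ‖M n ω‖ₑ ∂P = ENNReal.ofReal (∫ ω, M n ω ∂P) := by
      rw [ofReal_integral_eq_lintegral_ofReal (hM.integrable n) (ae_of_all _ (h0 n))]
      exact lintegral_congr fun ω => Real.enorm_of_nonneg (h0 n ω)
    rw [h1]
    have h2 := hM.setIntegral_le (Nat.zero_le n) (s := Set.univ) MeasurableSet.univ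
    rw [setIntegral_univ, setIntegral_univ] at h2
    exact ENNReal.ofReal_le_ofReal h2
  filter_upwards [hM.neg.exists_ae_tendsto_of_bdd hb] with ω ⟨c, hc⟩
  exact ⟨-c, by simpa using hc.neg⟩

/-- The Robbins–Siegmund lemma without multiplicative perturbations. -/
theorem robbins_siegmund_additive {X ξ η : ℕ → Ω → ℝ} (hX : StronglyAdapted ℱ X)
    (hξ : StronglyAdapted ℱ ξ) (hη : StronglyAdapted ℱ η) (hXi : ∀ n, Integrable (X n) P)
    (hξi : ∀ n, Integrable (ξ n) P) (hηi : ∀ n, Integrable (η n) P)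
    (hX0 : ∀ n ω, 0 ≤ X n ω) (hξ0 : ∀ n ω, 0 ≤ ξ n ω) (hη0 : ∀ n ω, 0 ≤ η n ω)
    (h : ∀ n, ∀ᵐ ω ∂P, (P[X (n + 1) | ℱ n]) ω ≤ X n ω + η n ω - ξ n ω)
    (hsum : ∀ᵐ ω ∂P, Summable fun n => η n ω) :
    ∀ᵐ ω ∂P, (∃ c, Tendsto (fun n => X n ω) atTop (𝓝 c)) ∧ Summable fun n => ξ n ω := by
  -- Localization: the process is stopped as soon as the accumulated `η` exceeds `N`. The event `T N
  -- (n + 1)` involves only `η 0, …, η n`, so it is already known at time `n`. After stopping, the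
  -- `X` part of `M` is set to `0`, which preserves the supermartingale property since `X ≥ 0`;
  -- adding `N` makes `M` nonnegative.
  let T : ℕ → ℕ → Set Ω := fun N n => {ω | ∑ j ∈ Finset.range n, η j ω ≤ N}
  let D : ℕ → ℕ → Ω → ℝ := fun N j => (T N (j + 1)).indicator (fun ω => ξ j ω - η j ω)
  let M : ℕ → ℕ → Ω → ℝ := fun N n ω =>
    (T N n).indicator (X n) ω + (N + ∑ j ∈ Finset.range n, D N j ω)
  have hTm : ∀ N n, MeasurableSet[ℱ n] (T N (n + 1)) := by
    intro N n
    have : StronglyMeasurable[ℱ n] fun ω => ∑ j ∈ Finset.range (n + 1), η j ω := by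
      refine Finset.stronglyMeasurable_fun_sum _ fun j hj => ?_
      exact (hη j).mono (ℱ.mono (Nat.lt_succ_iff.1 (Finset.mem_range.1 hj)))
    exact this.measurable measurableSet_Iic
  have hTm' : ∀ N n, MeasurableSet[ℱ n] (T N n) := by
    intro N n
    cases n with
    | zero => simp [T]
    | succ n => exact ℱ.mono (Nat.le_succ n) _ (hTm N n)
  have hanti : ∀ N i j, i ≤ j → T N j ⊆ T N i := by
    intro N i j hij ω hω
    have hω' : ∑ j ∈ Finset.range j, η j ω ≤ N := hω
    refine le_trans ?_ hω'
    exact Finset.sum_le_sum_of_subset_of_nonneg (Finset.range_mono hij) fun _ _ _ => hη0 _ _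
  have hDad : ∀ (N j n : ℕ), j ≤ n → StronglyMeasurable[ℱ n] (D N j) := by
    intro N j n hj
    exact (((hξ j).sub (hη j)).indicator (hTm N j)).mono (ℱ.mono hj)
  have hDi : ∀ N j : ℕ, Integrable (D N j) P := fun N j =>
    ((hξi j).sub (hηi j)).indicator (ℱ.le j _ (hTm N j))
  have hcad : ∀ N n k : ℕ, k ≤ n + 1 → StronglyMeasurable[ℱ n]
      fun ω => (N : ℝ) + ∑ j ∈ Finset.range k, D N j ω := by
    intro N n k hk
    refine stronglyMeasurable_const.add (Finset.stronglyMeasurable_fun_sum _ fun j hj => ?_)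
    exact hDad N j n (by have := Finset.mem_range.1 hj; omega)
  have hci : ∀ N k : ℕ, Integrable (fun ω => (N : ℝ) + ∑ j ∈ Finset.range k, D N j ω) P := by
    intro N k
    exact (integrable_const _).add (integrable_finsetSum _ fun j _ => hDi N j)
  have hsuper : ∀ N, Supermartingale (M N) ℱ P := by
    intro N
    refine supermartingale_nat (fun n => ?_) (fun n => ?_) fun n => ?_
    · exact ((hX n).indicator (hTm' N n)).add (hcad N n n (Nat.le_succ n))
    · exact ((hXi n).indicator (ℱ.le n _ (hTm' N n))).add (hci N n)
    · have e1 : P[M N (n + 1) | ℱ n] =ᵐ[P]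
          P[(T N (n + 1)).indicator (X (n + 1)) | ℱ n]
            + P[fun ω => (N : ℝ) + ∑ j ∈ Finset.range (n + 1), D N j ω | ℱ n] :=
        condExp_add ((hXi _).indicator (ℱ.le n _ (hTm N n))) (hci N (n + 1)) _
      have e2 := condExp_of_stronglyMeasurable (ℱ.le n) (hcad N n (n + 1) le_rfl) (hci N (n + 1))
      have e3 := condExp_indicator (hXi (n + 1)) (hTm N n)
      filter_upwards [e1, e3, h n] with ω h1 h3 h4
      rw [h1, Pi.add_apply, e2, h3]
      beta_reduce
      rw [Finset.sum_range_succ]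
      by_cases hω : ω ∈ T N (n + 1)
      · have hω' := hanti N n (n + 1) (Nat.le_succ n) hω
        simp only [M, D, Set.indicator_of_mem hω, Set.indicator_of_mem hω']
        linarith
      · have := Set.indicator_nonneg (s := T N n) (f := X n) (fun ω _ => hX0 n ω) ω
        simp only [M, D, Set.indicator_of_notMem hω]
        linarith
  have hMnn : ∀ N n ω, 0 ≤ M N n ω := by
    intro N n ω
    have h1 := Set.indicator_nonneg (s := T N n) (f := X n) (fun ω _ => hX0 n ω) ω
    -- Either the last event still holds, and then the full sum is at most `N`, or the last term
    -- vanishes and the induction hypothesis applies.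
    have h2 : ∑ j ∈ Finset.range n, (T N (j + 1)).indicator (η j) ω ≤ N := by
      induction n with
      | zero => simp
      | succ n ih =>
        by_cases hω : ω ∈ T N (n + 1)
        · refine le_trans (Finset.sum_le_sum fun j _ => ?_) hω
          exact Set.indicator_le_self' (fun _ _ => hη0 j _) ω
        · rw [Finset.sum_range_succ, Set.indicator_of_notMem hω, add_zero]
          exact ih (Set.indicator_nonneg (fun ω _ => hX0 n ω) ω)
    have h3 : ∑ j ∈ Finset.range n, -(T N (j + 1)).indicator (η j) ω
        ≤ ∑ j ∈ Finset.range n, D N j ω := by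
      refine Finset.sum_le_sum fun j _ => ?_
      by_cases hω : ω ∈ T N (j + 1)
      · simp only [D, Set.indicator_of_mem hω]
        linarith [hξ0 j ω]
      · simp [D, Set.indicator_of_notMem hω]
    rw [Finset.sum_neg_distrib] at h3
    simp only [M]
    linarith
  have hconv : ∀ᵐ ω ∂P, ∀ N : ℕ, ∃ c, Tendsto (fun n => M N n ω) atTop (𝓝 c) :=
    ae_all_iff.2 fun N => ae_exists_tendsto_of_nonneg_supermartingale (hsuper N) (hMnn N)
  filter_upwards [hconv, hsum] with ω h1 h2
  -- For this `N` the path is never stopped, so `M N n` equals `X n + N + ∑ (ξ - η)` for every `n`.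
  obtain ⟨N, hN⟩ := exists_nat_ge (∑' n, η n ω)
  have hT : ∀ n, ω ∈ T N n := fun n => (h2.sum_le_tsum _ fun _ _ => hη0 _ _).trans hN
  obtain ⟨c, hc⟩ := h1 N
  have h3 : Tendsto (fun n => X n ω + ∑ j ∈ Finset.range n, ξ j ω) atTop
      (𝓝 (c - N + ∑' n, η n ω)) := by
    refine ((hc.sub_const (N : ℝ)).add h2.hasSum.tendsto_sum_nat).congr fun n => ?_
    simp only [M, D, Set.indicator_of_mem (hT _), Finset.sum_sub_distrib]
    ring
  obtain ⟨C, hC⟩ := h3.bddAbove_range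
  have h4 : Summable fun n => ξ n ω := by
    refine summable_of_sum_range_le (c := C) (fun n => hξ0 n ω) fun n => ?_
    have := hC ⟨n, rfl⟩
    have h5 := hX0 n ω
    simp only at this
    linarith
  refine ⟨⟨_, (h3.sub h4.hasSum.tendsto_sum_nat).congr fun n => ?_⟩, h4⟩
  ring

/-- The Robbins–Siegmund lemma. -/
theorem robbins_siegmund {X ξ η : ℕ → Ω → ℝ} {γ : ℕ → ℝ} (hX : StronglyAdapted ℱ X)
    (hξ : StronglyAdapted ℱ ξ) (hη : StronglyAdapted ℱ η) (hXi : ∀ n, Integrable (X n) P)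
    (hξi : ∀ n, Integrable (ξ n) P) (hηi : ∀ n, Integrable (η n) P)
    (hX0 : ∀ n ω, 0 ≤ X n ω) (hξ0 : ∀ n ω, 0 ≤ ξ n ω) (hη0 : ∀ n ω, 0 ≤ η n ω)
    (hγ0 : ∀ n, 0 ≤ γ n) (hγ : Summable γ)
    (h : ∀ n, ∀ᵐ ω ∂P, (P[X (n + 1) | ℱ n]) ω ≤ (1 + γ n) * X n ω + η n ω - ξ n ω)
    (hsum : ∀ᵐ ω ∂P, Summable fun n => η n ω) :
    ∀ᵐ ω ∂P, (∃ c, Tendsto (fun n => X n ω) atTop (𝓝 c)) ∧ Summable fun n => ξ n ω := by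
  -- Multiplying the recursion by `c (n + 1)` absorbs the factor `1 + γ n`. Since `exp (-∑ γ) ≤ c n
  -- ≤ 1`, the weights can be divided out at the end.
  let c : ℕ → ℝ := fun n => ∏ j ∈ Finset.range n, (1 + γ j)⁻¹
  have hpos : ∀ n, 0 < 1 + γ n := fun n => by linarith [hγ0 n]
  have hc0 : ∀ n, 0 < c n := fun n => Finset.prod_pos fun j _ => inv_pos.2 (hpos j)
  have hcs : ∀ n, c (n + 1) * (1 + γ n) = c n := by
    intro n
    simp only [c, Finset.prod_range_succ]
    rw [mul_assoc, inv_mul_cancel₀ (hpos n).ne', mul_one]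
  have hanti : Antitone c := antitone_nat_of_succ_le fun n => by
    have := hcs n
    nlinarith [hc0 (n + 1), hγ0 n]
  have hc1 : ∀ n, c n ≤ 1 := fun n => by
    have := hanti (Nat.zero_le n)
    simpa [c] using this
  have hlow : ∀ n, Real.exp (-∑' j, γ j) ≤ c n := by
    intro n
    have h1 : Real.exp (-∑ j ∈ Finset.range n, γ j) ≤ c n := by
      rw [← Finset.sum_neg_distrib, Real.exp_sum]
      refine Finset.prod_le_prod (fun _ _ => (Real.exp_pos _).le) fun j _ => ?_
      rw [Real.exp_neg]
      exact inv_anti₀ (hpos j) (by linarith [Real.add_one_le_exp (γ j)])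
    refine le_trans (Real.exp_le_exp.2 ?_) h1
    exact neg_le_neg (hγ.sum_le_tsum _ fun _ _ => hγ0 _)
  have hbb : BddBelow (Set.range c) := ⟨0, by rintro _ ⟨n, rfl⟩; exact (hc0 n).le⟩
  have hclim := tendsto_atTop_ciInf hanti hbb
  have hcinf : 0 < ⨅ n, c n := (Real.exp_pos _).trans_le (le_ciInf hlow)
  have key := robbins_siegmund_additive (P := P) (ℱ := ℱ) (X := fun n ω => c n * X n ω)
    (ξ := fun n ω => c (n + 1) * ξ n ω) (η := fun n ω => c (n + 1) * η n ω)
    (fun n => (hX n).const_mul _) (fun n => (hξ n).const_mul _) (fun n => (hη n).const_mul _)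
    (fun n => (hXi n).const_mul _) (fun n => (hξi n).const_mul _) (fun n => (hηi n).const_mul _)
    (fun n ω => mul_nonneg (hc0 _).le (hX0 n ω)) (fun n ω => mul_nonneg (hc0 _).le (hξ0 n ω))
    (fun n ω => mul_nonneg (hc0 _).le (hη0 n ω)) (fun n => by
      have e1 := condExp_smul (μ := P) (c (n + 1)) (X (n + 1)) (ℱ n)
      filter_upwards [e1, h n] with ω h1 h2
      have h3 : (P[fun ω => c (n + 1) * X (n + 1) ω | ℱ n]) ω
          = c (n + 1) * (P[X (n + 1) | ℱ n]) ω := h1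
      rw [h3, ← hcs n]
      have := mul_le_mul_of_nonneg_left h2 (hc0 (n + 1)).le
      linarith) (by
      filter_upwards [hsum] with ω hω
      exact hω.of_nonneg_of_le (fun n => mul_nonneg (hc0 _).le (hη0 n ω)) fun n =>
        mul_le_of_le_one_left (hη0 n ω) (hc1 _))
  filter_upwards [key] with ω ⟨⟨t, ht⟩, hs⟩
  refine ⟨⟨_, (ht.div hclim hcinf.ne').congr fun n => ?_⟩, ?_⟩
  · exact mul_div_cancel_left₀ _ (hc0 n).ne'
  · refine (hs.mul_left (Real.exp (-∑' j, γ j))⁻¹).of_nonneg_of_le (fun n => hξ0 n ω) fun n => ?_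
    rw [inv_mul_eq_div, le_div_iff₀ (Real.exp_pos _), mul_comm]
    exact mul_le_mul_of_nonneg_right (hlow _) (hξ0 n ω)

end RobbinsSiegmund

end PrimalDual

namespace PrimalDual

/-! ### Measurability of weak limits -/

section Measurability

variable {H : Type*} [NormedAddCommGroup H] [InnerProductSpace ℝ H]
  [SecondCountableTopology H] [MeasurableSpace H] [BorelSpace H] {Ω : Type*} [MeasurableSpace Ω]

/-- Weakly measurable maps into a separable Hilbert space are measurable. -/
theorem measurable_of_inner {f : Ω → H} (h : ∀ y : H, Measurable fun ω => inner ℝ (f ω) y) :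
    Measurable f := by
  obtain ⟨D, hDc, hDd⟩ := TopologicalSpace.exists_countable_dense H
  have hball : ∀ y r, MeasurableSet (f ⁻¹' Metric.closedBall y r) := by
    intro y r
    rcases lt_or_ge r 0 with hr | hr
    · simp [Metric.closedBall_eq_empty.2 hr]
    -- A closed ball is a countable intersection of half-space conditions: by density the conditions
    -- extend to every direction, in particular to `f ω - y` itself.
    have e : f ⁻¹' Metric.closedBall y r
        = ⋂ d ∈ D, {ω | inner ℝ (f ω) d - inner ℝ y d ≤ r * ‖d‖} := by
      ext ω
      simp only [Set.mem_preimage, Metric.mem_closedBall, Set.mem_iInter, Set.mem_ofPred_eq,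
        dist_eq_norm, ← inner_sub_left]
      constructor
      · intro hω d _
        exact (real_inner_le_norm _ _).trans (mul_le_mul_of_nonneg_right hω (norm_nonneg _))
      · intro hω
        have hcl : IsClosed {d : H | inner ℝ (f ω - y) d ≤ r * ‖d‖} :=
          isClosed_le (by fun_prop) (by fun_prop)
        have h1 : closure D ⊆ {d : H | inner ℝ (f ω - y) d ≤ r * ‖d‖} :=
          closure_minimal (fun d hd => hω d hd) hcl
        have h2 : inner ℝ (f ω - y) (f ω - y) ≤ r * ‖f ω - y‖ := by
          apply h1
          rw [hDd.closure_eq]; trivial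
        rw [real_inner_self_eq_norm_sq] at h2
        by_contra hcon
        push Not at hcon
        nlinarith
    rw [e]
    refine MeasurableSet.biInter hDc fun d _ => ?_
    exact measurableSet_le ((h d).sub_const _) measurable_const
  refine measurable_of_isOpen fun s hs => ?_
  have h1 : ∃ I : Set (H × ℚ), I.Countable ∧ s = ⋃ p ∈ I, Metric.closedBall p.1 (p.2 : ℝ) := by
    refine ⟨{p | p.1 ∈ D ∧ Metric.closedBall p.1 (p.2 : ℝ) ⊆ s}, ?_, ?_⟩
    · have hc : (D ×ˢ (Set.univ : Set ℚ)).Countable := hDc.prod Set.countable_univ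
      exact hc.mono fun p hp => Set.mem_prod.2 ⟨hp.1, Set.mem_univ _⟩
    · refine Set.Subset.antisymm (fun x hx => ?_) (Set.iUnion₂_subset fun p hp => hp.2)
      obtain ⟨δ, hδ, hsub⟩ := Metric.isOpen_iff.1 hs x hx
      obtain ⟨q, hq1, hq2⟩ := exists_rat_btwn (show (0 : ℝ) < δ / 2 by linarith)
      obtain ⟨d, hd, hdx⟩ := hDd.exists_dist_lt x hq1
      simp only [Set.mem_iUnion]
      refine ⟨(d, q), ⟨hd, fun y hy => hsub ?_⟩, hdx.le⟩
      rw [Metric.mem_closedBall] at hy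
      rw [Metric.mem_ball]
      have := dist_triangle y d x
      rw [dist_comm d x] at this
      linarith
  obtain ⟨I, hI, rfl⟩ := h1
  rw [Set.preimage_iUnion₂]
  exact MeasurableSet.biUnion hI fun p _ => hball _ _

end Measurability

/-! ### Square integrability -/

section Integrability

variable {H : Type*} [NormedAddCommGroup H] {Ω : Type*} {m0 : MeasurableSpace Ω} {P : Measure Ω}

theorem integrable_norm_sq_of_memLp {f : Ω → H} (hf : MemLp f 2 P) :
    Integrable (fun ω => ‖f ω‖ ^ 2) P :=
  (memLp_two_iff_integrable_sq_norm hf.1).1 hf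

theorem memLp_comp_of_lipschitz [IsFiniteMeasure P] {T : H → H} {C : ℝ≥0} (hT : LipschitzWith C T)
    {f : Ω → H} (hf : MemLp f 2 P) : MemLp (fun ω => T (f ω)) 2 P := by
  have h1 : LipschitzWith C fun x => T x - T 0 :=
    LipschitzWith.of_dist_le_mul fun x y => by
      simpa [dist_eq_norm] using hT.dist_le_mul x y
  have h2 : MemLp (fun ω => T (f ω) - T 0) 2 P :=
    h1.comp_memLp (by simp) hf
  convert h2.add (memLp_const (T 0)) using 1
  ext ω
  simp

theorem integrable_inner_of_memLp [InnerProductSpace ℝ H] {f g : Ω → H} (hf : MemLp f 2 P) (hg : MemLp g 2 P) :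
    Integrable (fun ω => inner ℝ (f ω) (g ω)) P := by
  refine ((integrable_norm_sq_of_memLp hf).add (integrable_norm_sq_of_memLp hg)).mono'
    (hf.1.inner hg.1) (ae_of_all _ fun ω => ?_)
  refine (norm_inner_le_norm _ _).trans ?_
  simp only [Pi.add_apply]
  nlinarith [sq_nonneg (‖f ω‖ - ‖g ω‖), sq_nonneg ‖f ω‖, sq_nonneg ‖g ω‖]

end Integrability

/-! ### Almost sure convergence of the stochastic forward-backward iteration -/

section StochasticForwardBackward

variable {H : Type*} [NormedAddCommGroup H] [InnerProductSpace ℝ H] [CompleteSpace H]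
  {Ω : Type*} {m0 : MeasurableSpace Ω} {P : Measure Ω} [IsProbabilityMeasure P]
  {U R : H →L[ℝ] H} {A : H → Set H} {J B : H → H} {χ β : ℝ}

/-- The pathwise inequality for an inertial relaxed forward-backward step. -/
theorem IsForwardBackward.exists_relaxed_step_inequality
    (fb : IsForwardBackward U R A J B χ β) {ε : ℝ} (hε : 0 < ε) :
    ∃ σ : ℝ, 0 < σ ∧ ∀ (x x' e z : H) (α lam : ℝ), -B z ∈ A z → 0 ≤ α → α ≤ 1 → ε ≤ lam →
      lam ≤ 1 → ∀ w, w = x + α • (x - x') →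
      sqNorm U (x + lam • (J (U w - (B w + e)) - x) - z)
        ≤ (1 + α) * sqNorm U (x - z) + 2 * ‖U‖ * (α * ‖x - x'‖ ^ 2) + 3 / χ * ‖e‖ ^ 2
          - 2 * lam * inner ℝ (J (U w - B w) - z) e
          - σ * (‖w - J (U w - B w)‖ ^ 2 + ‖B w - B z‖ ^ 2) := by
  obtain ⟨σ, hσ, hstep⟩ := fb.exists_step_inequality
  refine ⟨ε * σ, mul_pos hε hσ, ?_⟩
  intro x x' e z α lam hz hα0 hα1 hlε hl1 w hw
  have h1 := hstep w e z hz
  set y := J (U w - (B w + e)) with hy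
  have hS := fb.selfAdjoint
  have hl0 : 0 ≤ lam := hε.le.trans hlε
  -- Relaxation costs nothing, by convexity of the squared norm; the descent term keeps the factor
  -- `lam ≥ ε`, hence the final constant `ε * σ`.
  have h2 : sqNorm U (x + lam • (y - x) - z)
      ≤ (1 - lam) * sqNorm U (x - z) + lam * sqNorm U (y - z) := by
    have e1 : x + lam • (y - x) - z = (x - z) + lam • ((y - z) - (x - z)) := by
      simp only [smul_sub]; abel
    have e2 := sqNorm_sub hS (y - z) (x - z)
    have e3 := fb.sqNorm_nonneg ((y - z) - (x - z))
    rw [e1, sqNorm_add hS, sqNorm_smul, inner_smul_right, inner_sub_right]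
    rw [e2] at e3 ⊢
    have e4 : inner ℝ (U (x - z)) (y - z) = inner ℝ (U (y - z)) (x - z) := by
      rw [inner_map_symm hS, real_inner_comm]
    have e5 : inner ℝ (U (x - z)) (x - z) = sqNorm U (x - z) := rfl
    rw [e4, e5]
    nlinarith [mul_nonneg (mul_nonneg hl0 (sub_nonneg.2 hl1)) e3]
  -- The inertial cross term is split by `2 ⟪p, q⟫ ≤ ‖p‖² + ‖q‖²`, and `α² ≤ α` gives the second
  -- copy of `α ‖x - x'‖²`.
  have h3 : sqNorm U (w - z) ≤ (1 + α) * sqNorm U (x - z) + 2 * ‖U‖ * (α * ‖x - x'‖ ^ 2) := by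
    have e1 : w - z = (x - z) + α • (x - x') := by rw [hw]; abel
    have e2 := fb.sqNorm_nonneg ((x - z) - (x - x'))
    rw [sqNorm_sub hS] at e2
    have e3 := sqNorm_le U (x - x')
    rw [e1, sqNorm_add hS, sqNorm_smul, inner_smul_right]
    have e4 := fb.sqNorm_nonneg (x - x')
    have e5 : α ^ 2 * sqNorm U (x - x') ≤ α * sqNorm U (x - x') := by
      apply mul_le_mul_of_nonneg_right _ e4
      nlinarith
    have e6 := mul_nonneg hα0 e2
    have e7 := mul_le_mul_of_nonneg_left e3 hα0
    nlinarith
  have h4 := fb.sqNorm_nonneg (x - z)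
  have h5 : 0 ≤ ‖w - J (U w - B w)‖ ^ 2 + ‖B w - B z‖ ^ 2 := by positivity
  have h6 : ε * (σ * (‖w - J (U w - B w)‖ ^ 2 + ‖B w - B z‖ ^ 2))
      ≤ lam * (σ * (‖w - J (U w - B w)‖ ^ 2 + ‖B w - B z‖ ^ 2)) :=
    mul_le_mul_of_nonneg_right hlε (mul_nonneg hσ.le h5)
  have h7 : lam * (3 / χ * ‖e‖ ^ 2) ≤ 3 / χ * ‖e‖ ^ 2 := by
    have := fb.pos
    exact mul_le_of_le_one_left (by positivity) hl1
  have h8 : lam * (α * sqNorm U (x - z)) ≤ α * sqNorm U (x - z) :=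
    mul_le_of_le_one_left (mul_nonneg hα0 h4) hl1
  have h9 : lam * (2 * ‖U‖ * (α * ‖x - x'‖ ^ 2)) ≤ 2 * ‖U‖ * (α * ‖x - x'‖ ^ 2) :=
    mul_le_of_le_one_left (by positivity) hl1
  have h11 : lam * sqNorm U (y - z) ≤ lam * ((1 + α) * sqNorm U (x - z)
      + 2 * ‖U‖ * (α * ‖x - x'‖ ^ 2) - σ * (‖w - J (U w - B w)‖ ^ 2 + ‖B w - B z‖ ^ 2)
      + 3 / χ * ‖e‖ ^ 2 - 2 * inner ℝ (J (U w - B w) - z) e) := by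
    apply mul_le_mul_of_nonneg_left _ hl0
    linarith
  linarith

/-- Distances to a zero of `A + B` converge, and the residuals are summable, almost surely. -/
theorem IsForwardBackward.ae_exists_tendsto
    (fb : IsForwardBackward U R A J B χ β) {ℱ : Filtration ℕ m0} {x w g : ℕ → Ω → H}
    {α lam : ℕ → ℝ} {ε : ℝ} (hε : 0 < ε) (hlam : ∀ n, lam n ∈ Set.Icc ε 1)
    (hα : ∀ n, α n ∈ Set.Icc 0 1) (hαsum : Summable α)
    (hxad : StronglyAdapted ℱ x) (hx2 : ∀ n, MemLp (x n) 2 P) (hg2 : ∀ n, MemLp (g n) 2 P)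
    (hw : ∀ n ω, w n ω = x n ω + α n • (x n ω - x (n - 1) ω))
    (hx : ∀ n ω, x (n + 1) ω = x n ω + lam n • (J (U (w n ω) - g n ω) - x n ω))
    (hE : ∀ n, P[g n | ℱ n] =ᵐ[P] fun ω => B (w n ω))
    (hvar : ∀ᵐ ω ∂P, Summable fun n => (P[fun ω' => ‖g n ω' - B (w n ω')‖ ^ 2 | ℱ n]) ω)
    (hbdd : ∀ᵐ ω ∂P, BddAbove (Set.range fun n => ‖x n ω - x (n - 1) ω‖))
    {z : H} (hz : -B z ∈ A z) :
    ∀ᵐ ω ∂P, (∃ t, Tendsto (fun n => sqNorm U (x n ω - z)) atTop (𝓝 t)) ∧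
      Tendsto (fun n => w n ω - J (U (w n ω) - B (w n ω))) atTop (𝓝 0) ∧
      Tendsto (fun n => B (w n ω)) atTop (𝓝 (B z)) := by
  obtain ⟨σ, hσ, hstep⟩ := fb.exists_relaxed_step_inequality hε
  obtain ⟨CB, hCB⟩ := fb.exists_lipschitz
  obtain ⟨CJ, hCJ⟩ := fb.lipschitz_resolvent
  have hχ := fb.pos
  let y : ℕ → Ω → H := fun n ω => J (U (w n ω) - B (w n ω))
  let e : ℕ → Ω → H := fun n ω => g n ω - B (w n ω)
  have hxprev : ∀ n, StronglyMeasurable[ℱ n] (x (n - 1)) := fun n =>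
    (hxad (n - 1)).mono (ℱ.mono (Nat.sub_le n 1))
  have hweq : ∀ n, w n = fun ω => x n ω + α n • (x n ω - x (n - 1) ω) := fun n => funext (hw n)
  have hwad : ∀ n, StronglyMeasurable[ℱ n] (w n) := by
    intro n
    rw [hweq]
    exact (hxad n).add (((hxad n).sub (hxprev n)).const_smul _)
  have hw2 : ∀ n, MemLp (w n) 2 P := by
    intro n
    rw [hweq]
    exact (hx2 n).add (((hx2 n).sub (hx2 (n - 1))).const_smul (α n))
  have hBad : ∀ n, StronglyMeasurable[ℱ n] fun ω => B (w n ω) := fun n =>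
    hCB.continuous.comp_stronglyMeasurable (hwad n)
  have hB2 : ∀ n, MemLp (fun ω => B (w n ω)) 2 P := fun n => memLp_comp_of_lipschitz hCB (hw2 n)
  have hUB2 : ∀ n, MemLp (fun ω => U (w n ω) - B (w n ω)) 2 P := fun n =>
    (U.comp_memLp' (hw2 n)).sub (hB2 n)
  have hyad : ∀ n, StronglyMeasurable[ℱ n] (y n) := fun n =>
    hCJ.continuous.comp_stronglyMeasurable
      ((U.continuous.comp_stronglyMeasurable (hwad n)).sub (hBad n))
  have hy2 : ∀ n, MemLp (y n) 2 P := fun n => memLp_comp_of_lipschitz hCJ (hUB2 n)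
  have he2 : ∀ n, MemLp (e n) 2 P := fun n => (hg2 n).sub (hB2 n)
  have heE : ∀ n, P[e n | ℱ n] =ᵐ[P] 0 := by
    intro n
    have h1 : P[e n | ℱ n] =ᵐ[P] P[g n | ℱ n] - P[fun ω => B (w n ω) | ℱ n] :=
      condExp_sub ((hg2 n).integrable one_le_two) ((hB2 n).integrable one_le_two) _
    rw [condExp_of_stronglyMeasurable (ℱ.le n) (hBad n) ((hB2 n).integrable one_le_two)] at h1
    filter_upwards [h1, hE n] with ω h2 h3
    rw [h2, Pi.sub_apply, h3]
    simp
  let X : ℕ → Ω → ℝ := fun n ω => sqNorm U (x n ω - z)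
  let ξ : ℕ → Ω → ℝ := fun n ω => σ * (‖w n ω - y n ω‖ ^ 2 + ‖B (w n ω) - B z‖ ^ 2)
  let V : ℕ → Ω → ℝ := fun n => P[fun ω' => ‖e n ω'‖ ^ 2 | ℱ n]
  let ζ : ℕ → Ω → ℝ := fun n ω => 2 * ‖U‖ * (α n * ‖x n ω - x (n - 1) ω‖ ^ 2)
  -- A conditional expectation is nonnegative only almost everywhere; the absolute value makes `η`
  -- nonnegative at every point, as `robbins_siegmund` requires.
  let η : ℕ → Ω → ℝ := fun n ω => ζ n ω + 3 / χ * |V n ω|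
  have hdx2 : ∀ n, MemLp (fun ω => x n ω - x (n - 1) ω) 2 P := fun n => (hx2 n).sub (hx2 (n - 1))
  have hxz2 : ∀ n, MemLp (fun ω => x n ω - z) 2 P := fun n => (hx2 n).sub (memLp_const z)
  have hXad : StronglyAdapted ℱ X := fun n => by
    have h1 : StronglyMeasurable[ℱ n] fun ω => x n ω - z := (hxad n).sub stronglyMeasurable_const
    exact (U.continuous.comp_stronglyMeasurable h1).inner h1
  have hXi : ∀ n, Integrable (X n) P := fun n =>
    integrable_inner_of_memLp (U.comp_memLp' (hxz2 n)) (hxz2 n)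
  have hξad : StronglyAdapted ℱ ξ := fun n => by
    exact ((((hwad n).sub (hyad n)).norm.pow 2).add
      (((hBad n).sub stronglyMeasurable_const).norm.pow 2)).const_mul σ
  have hξi : ∀ n, Integrable (ξ n) P := fun n =>
    ((integrable_norm_sq_of_memLp ((hw2 n).sub (hy2 n))).add
      (integrable_norm_sq_of_memLp ((hB2 n).sub (memLp_const (B z))))).const_mul σ
  have hζad : StronglyAdapted ℱ ζ := fun n => by
    exact ((((hxad n).sub (hxprev n)).norm.pow 2).const_mul _).const_mul _
  have hζi : ∀ n, Integrable (ζ n) P := fun n =>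
    ((integrable_norm_sq_of_memLp (hdx2 n)).const_mul _).const_mul _
  have hVi : ∀ n, Integrable (V n) P := fun n => integrable_condExp
  have hηad : StronglyAdapted ℱ η := fun n =>
    (hζad n).add (StronglyMeasurable.const_mul (f := fun ω => |V n ω|)
      (stronglyMeasurable_condExp (f := fun ω' => ‖e n ω'‖ ^ 2)).norm (3 / χ))
  have hηi : ∀ n, Integrable (η n) P := fun n => (hζi n).add ((hVi n).norm.const_mul _)
  have hα0 : ∀ n, 0 ≤ α n := fun n => (hα n).1
  have hξ0 : ∀ n ω, 0 ≤ ξ n ω := fun n ω => by positivity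
  have hζ0 : ∀ n ω, 0 ≤ ζ n ω := fun n ω => by
    have := hα0 n
    positivity
  have hη0 : ∀ n ω, 0 ≤ η n ω := fun n ω => by
    have := hζ0 n ω
    positivity
  have hrec : ∀ n, ∀ᵐ ω ∂P, (P[X (n + 1) | ℱ n]) ω ≤ (1 + α n) * X n ω + η n ω - ξ n ω := by
    intro n
    let S : Ω → ℝ := fun ω => (1 + α n) * X n ω + ζ n ω - ξ n ω
    let I : Ω → ℝ := fun ω => inner ℝ (y n ω - z) (e n ω)
    have hyz2 : MemLp (fun ω => y n ω - z) 2 P := (hy2 n).sub (memLp_const z)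
    have hIi : Integrable I P := integrable_inner_of_memLp hyz2 (he2 n)
    have hSad : StronglyMeasurable[ℱ n] S :=
      (((hXad n).const_mul _).add (hζad n)).sub (hξad n)
    have hSi : Integrable S P := (((hXi n).const_mul _).add (hζi n)).sub (hξi n)
    have hei := integrable_norm_sq_of_memLp (he2 n)
    have hle : X (n + 1) ≤ᵐ[P] S + ((3 / χ) • (fun ω => ‖e n ω‖ ^ 2) + (-(2 * lam n)) • I) := by
      refine ae_of_all _ fun ω => ?_
      have := hstep (x n ω) (x (n - 1) ω) (e n ω) z (α n) (lam n) hz (hα n).1 (hα n).2 (hlam n).1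
        (hlam n).2 (w n ω) (hw n ω)
      have e1 : B (w n ω) + e n ω = g n ω := by simp [e]
      rw [e1, ← hx n ω] at this
      simp only [Pi.add_apply, Pi.smul_apply, smul_eq_mul, S, I, X, ζ, ξ, y] at this ⊢
      linarith
    -- The factor `y n - z` is known at time `n` and can be pulled out of the conditional
    -- expectation, leaving the conditional mean of the noise, which is zero.
    have hIE : P[I | ℱ n] =ᵐ[P] 0 := by
      have h1 := condExp_bilin_of_stronglyMeasurable_left (m := ℱ n) (μ := P) (innerSL ℝ (E := H))
        (f := fun ω => y n ω - z) (g := e n) ((hyad n).sub stronglyMeasurable_const) hIi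
        ((he2 n).integrable one_le_two)
      refine h1.trans ?_
      filter_upwards [heE n] with ω h2
      rw [h2]
      simp
    have h1 := condExp_mono (m := ℱ n) (hXi (n + 1))
      (hSi.add ((hei.smul (3 / χ)).add (hIi.smul (-(2 * lam n))))) hle
    have h2 := condExp_add hSi ((hei.smul (3 / χ)).add (hIi.smul (-(2 * lam n)))) (ℱ n)
    have h3 := condExp_add (hei.smul (3 / χ)) (hIi.smul (-(2 * lam n))) (ℱ n)
    have h4 := condExp_smul (μ := P) (3 / χ) (fun ω => ‖e n ω‖ ^ 2) (ℱ n)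
    have h5 := condExp_smul (μ := P) (-(2 * lam n)) I (ℱ n)
    rw [condExp_of_stronglyMeasurable (ℱ.le n) hSad hSi] at h2
    filter_upwards [h1, h2, h3, h4, h5, hIE] with ω k1 k2 k3 k4 k5 k6
    rw [k2, Pi.add_apply, k3, Pi.add_apply, k4, k5, Pi.smul_apply, Pi.smul_apply, k6] at k1
    refine k1.trans ?_
    simp only [S, η, Pi.zero_apply, smul_eq_mul]
    have : 3 / χ * (P[fun ω' => ‖e n ω'‖ ^ 2 | ℱ n]) ω ≤ 3 / χ * |V n ω| :=
      mul_le_mul_of_nonneg_left (le_abs_self _) (by positivity)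
    linarith
  have hηsum : ∀ᵐ ω ∂P, Summable fun n => η n ω := by
    filter_upwards [hvar, hbdd] with ω h1 h2
    obtain ⟨M, hM⟩ := h2
    refine Summable.add ?_ (h1.abs.mul_left _)
    refine Summable.mul_left _ ?_
    refine (hαsum.mul_right (M ^ 2)).of_nonneg_of_le (fun n => mul_nonneg (hα0 n) (by positivity))
      fun n => mul_le_mul_of_nonneg_left ?_ (hα0 n)
    exact pow_le_pow_left₀ (norm_nonneg _) (hM ⟨n, rfl⟩) 2
  filter_upwards [robbins_siegmund hXad hξad hηad hXi hξi hηi (fun n ω => fb.sqNorm_nonneg _) hξ0 hη0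
    hα0 hαsum hrec hηsum] with ω ⟨h1, h2⟩
  have h3 : Tendsto (fun n => ‖w n ω - y n ω‖ ^ 2 + ‖B (w n ω) - B z‖ ^ 2) atTop (𝓝 0) := by
    have := (h2.tendsto_atTop_zero).const_mul σ⁻¹
    rw [mul_zero] at this
    refine this.congr fun n => ?_
    exact inv_mul_cancel_left₀ hσ.ne' _
  refine ⟨h1, ?_, ?_⟩
  · have h4 : Tendsto (fun n => ‖w n ω - y n ω‖ ^ 2) atTop (𝓝 0) :=
      squeeze_zero (fun n => by positivity) (fun n => le_add_of_nonneg_right (by positivity)) h3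
    have h5 := h4.sqrt
    simp only [Real.sqrt_zero, Real.sqrt_sq (norm_nonneg _)] at h5
    exact tendsto_zero_iff_norm_tendsto_zero.2 h5
  · have h4 : Tendsto (fun n => ‖B (w n ω) - B z‖ ^ 2) atTop (𝓝 0) :=
      squeeze_zero (fun n => by positivity) (fun n => le_add_of_nonneg_left (by positivity)) h3
    have h5 := h4.sqrt
    simp only [Real.sqrt_zero, Real.sqrt_sq (norm_nonneg _)] at h5
    exact tendsto_iff_norm_sub_tendsto_zero.2 h5

/-- The resolvent is Lipschitz, so each step preserves square integrability. The induction is strong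
because `w n` also involves `x (n - 1)`. -/
theorem IsForwardBackward.memLp
    (fb : IsForwardBackward U R A J B χ β) {x w g : ℕ → Ω → H} {α lam : ℕ → ℝ}
    (hx0 : MemLp (x 0) 2 P) (hg2 : ∀ n, MemLp (g n) 2 P)
    (hw : ∀ n ω, w n ω = x n ω + α n • (x n ω - x (n - 1) ω))
    (hx : ∀ n ω, x (n + 1) ω = x n ω + lam n • (J (U (w n ω) - g n ω) - x n ω)) (n : ℕ) :
    MemLp (x n) 2 P := by
  obtain ⟨CJ, hCJ⟩ := fb.lipschitz_resolvent
  induction n using Nat.strong_induction_on with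
  | _ n ih =>
    cases n with
    | zero => exact hx0
    | succ n =>
      have h1 := ih n (Nat.lt_succ_self n)
      have h2 := ih (n - 1) (by omega)
      have hw2 : MemLp (w n) 2 P := by
        rw [show w n = fun ω => x n ω + α n • (x n ω - x (n - 1) ω) from funext (hw n)]
        exact h1.add ((h1.sub h2).const_smul (α n))
      rw [show x (n + 1) = fun ω => x n ω + lam n • (J (U (w n ω) - g n ω) - x n ω) from
        funext (hx n)]
      exact h1.add (((memLp_comp_of_lipschitz hCJ ((U.comp_memLp' hw2).sub (hg2 n))).sub
        h1).const_smul (lam n))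

/-- Almost sure weak convergence of the stochastic inertial forward-backward algorithm. -/
theorem IsForwardBackward.exists_ae_innerTendsto [SecondCountableTopology H] [MeasurableSpace H]
    [BorelSpace H]
    (fb : IsForwardBackward U R A J B χ β) {ℱ : Filtration ℕ m0} {x w g : ℕ → Ω → H}
    {α lam : ℕ → ℝ} {ε : ℝ} (hε : 0 < ε) (hlam : ∀ n, lam n ∈ Set.Icc ε 1)
    (hα : ∀ n, α n ∈ Set.Icc 0 1) (hαsum : Summable α)
    (hxad : StronglyAdapted ℱ x) (hx0 : MemLp (x 0) 2 P) (hg2 : ∀ n, MemLp (g n) 2 P)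
    (hw : ∀ n ω, w n ω = x n ω + α n • (x n ω - x (n - 1) ω))
    (hx : ∀ n ω, x (n + 1) ω = x n ω + lam n • (J (U (w n ω) - g n ω) - x n ω))
    (hE : ∀ n, P[g n | ℱ n] =ᵐ[P] fun ω => B (w n ω))
    (hvar : ∀ᵐ ω ∂P, Summable fun n => (P[fun ω' => ‖g n ω' - B (w n ω')‖ ^ 2 | ℱ n]) ω)
    (hbdd : ∀ᵐ ω ∂P, BddAbove (Set.range fun n => ‖x n ω - x (n - 1) ω‖))
    (hZ : ∃ z, -B z ∈ A z) :
    ∃ xbar : Ω → H, Measurable xbar ∧ ∀ᵐ ω ∂P, -B (xbar ω) ∈ A (xbar ω) ∧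
      InnerTendsto atTop (fun n => x n ω) (xbar ω) ∧
      Tendsto (fun n => w n ω - x n ω) atTop (𝓝 0) ∧
      Tendsto (fun n => B (w n ω)) atTop (𝓝 (B (xbar ω))) := by
  have hx2 := fb.memLp hx0 hg2 hw hx
  set Z : Set H := {z | -B z ∈ A z} with hZdef
  obtain ⟨z0, hz0⟩ : Z.Nonempty := hZ
  -- Each zero brings its own null set; a countable dense set of zeros makes their union null.
  obtain ⟨D, hDZ, hDc, hDd⟩ :=
    TopologicalSpace.IsSeparable.exists_countable_dense_subset (TopologicalSpace.IsSeparable.of_separableSpace Z)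
  have hDne : D.Nonempty := by
    rw [← closure_nonempty_iff]
    exact ⟨z0, hDd hz0⟩
  have hall : ∀ᵐ ω ∂P, ∀ z ∈ D, (∃ t, Tendsto (fun n => sqNorm U (x n ω - z)) atTop (𝓝 t)) ∧
      Tendsto (fun n => w n ω - J (U (w n ω) - B (w n ω))) atTop (𝓝 0) ∧
      Tendsto (fun n => B (w n ω)) atTop (𝓝 (B z)) := by
    rw [ae_ball_iff hDc]
    intro z hz
    exact fb.ae_exists_tendsto hε hlam hα hαsum hxad hx2 hg2 hw hx hE hvar hbdd (hDZ hz)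
  have hgood : ∀ᵐ ω ∂P, ∃ y, -B y ∈ A y ∧ InnerTendsto atTop (fun n => x n ω) y ∧
      Tendsto (fun n => w n ω - x n ω) atTop (𝓝 0) ∧
      Tendsto (fun n => B (w n ω)) atTop (𝓝 (B y)) := by
    filter_upwards [hall, hbdd] with ω h1 h2
    obtain ⟨z1, hz1⟩ := hDne
    obtain ⟨-, hres, hBz⟩ := h1 z1 hz1
    have hwx : Tendsto (fun n => w n ω - x n ω) atTop (𝓝 0) := by
      obtain ⟨M, hM⟩ := h2
      have h3 : Tendsto (fun n => α n * M) atTop (𝓝 0) := by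
        simpa using hαsum.tendsto_atTop_zero.mul_const M
      refine squeeze_zero_norm (fun n => ?_) h3
      rw [hw, add_sub_cancel_left, norm_smul, Real.norm_of_nonneg (hα n).1]
      exact mul_le_mul_of_nonneg_left (hM ⟨n, rfl⟩) (hα n).1
    obtain ⟨τ, hτ, hcoco⟩ := fb.exists_cocoercive
    have hclust : ∀ l : Ultrafilter ℕ, (l : Filter ℕ) ≤ atTop → ∀ y,
        InnerTendsto (l : Filter ℕ) (fun n => x n ω) y → (∃ C, ∀ n, ‖x n ω‖ ≤ C) →
        -B y ∈ A y ∧ B y = B z1 := by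
      intro l hl y hy ⟨C, hC⟩
      have hwy : InnerTendsto (l : Filter ℕ) (fun n => w n ω) y := hy.of_sub (hwx.mono_left hl)
      obtain ⟨C1, hC1⟩ := hwx.norm.bddAbove_range
      have hCw : ∀ n, ‖w n ω‖ ≤ C1 + C := fun n => by
        calc ‖w n ω‖ = ‖(w n ω - x n ω) + x n ω‖ := by simp
          _ ≤ ‖w n ω - x n ω‖ + ‖x n ω‖ := norm_add_le _ _
          _ ≤ _ := add_le_add (hC1 ⟨n, rfl⟩) (hC n)
      have hBl := hBz.mono_left hl
      -- Cocoercivity at `(w n, y)` in the limit: the right side pairs a weakly null family with a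
      -- strongly convergent one and vanishes, so `τ ‖B z1 - B y‖² ≤ 0`.
      have hBy : B y = B z1 := by
        have k1 : Tendsto (fun n => inner ℝ (w n ω) (B (w n ω) - B y)
            - inner ℝ y (B (w n ω) - B y)) (l : Filter ℕ)
            (𝓝 (inner ℝ y (B z1 - B y) - inner ℝ y (B z1 - B y))) :=
          (hwy.inner_of_tendsto hCw (hBl.sub_const _)).sub
            (tendsto_const_nhds.inner (hBl.sub_const _))
        have k2 : Tendsto (fun n => τ * ‖B (w n ω) - B y‖ ^ 2) (l : Filter ℕ)
            (𝓝 (τ * ‖B z1 - B y‖ ^ 2)) := ((hBl.sub_const _).norm.pow 2).const_mul τ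
        have k3 := le_of_tendsto_of_tendsto' k2 k1 fun n => by
          rw [← inner_sub_left]
          exact hcoco _ _
        rw [sub_self] at k3
        have k4 : ‖B z1 - B y‖ ^ 2 ≤ 0 := by
          by_contra hcon
          push Not at hcon
          nlinarith
        have k5 : ‖B z1 - B y‖ = 0 := by nlinarith [norm_nonneg (B z1 - B y), sq_nonneg ‖B z1 - B y‖]
        exact (sub_eq_zero.1 (norm_eq_zero.1 k5)).symm
      refine ⟨?_, hBy⟩
      have hresl := hres.mono_left hl
      obtain ⟨C2, hC2⟩ := hres.norm.bddAbove_range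
      have hyh : InnerTendsto (l : Filter ℕ) (fun n => J (U (w n ω) - B (w n ω))) y := by
        refine hwy.of_sub ?_
        simpa using hresl.neg
      have hCy : ∀ n, ‖J (U (w n ω) - B (w n ω))‖ ≤ (C1 + C) + C2 := fun n => by
        calc ‖J (U (w n ω) - B (w n ω))‖
            = ‖w n ω - (w n ω - J (U (w n ω) - B (w n ω)))‖ := by simp
          _ ≤ ‖w n ω‖ + ‖w n ω - J (U (w n ω) - B (w n ω))‖ := norm_sub_le _ _
          _ ≤ _ := add_le_add (hCw n) (hC2 ⟨n, rfl⟩)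
      -- These are elements of `A` at the resolvent points. They converge strongly to `-B y` while
      -- the points converge weakly to `y`, so closedness of the graph applies.
      have hu : Tendsto (fun n => U (w n ω) - B (w n ω) - U (J (U (w n ω) - B (w n ω))))
          (l : Filter ℕ) (𝓝 (-B y)) := by
        have k1 : Tendsto (fun n => U (w n ω - J (U (w n ω) - B (w n ω))) - B (w n ω))
            (l : Filter ℕ) (𝓝 (U 0 - B z1)) :=
          ((U.continuous.tendsto 0).comp hresl).sub hBl
        rw [map_zero, zero_sub, ← hBy] at k1
        refine k1.congr fun n => ?_
        rw [map_sub]; abel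
      exact fb.mem_of_innerTendsto hyh hCy hu fun n => fb.resolvent _
    obtain ⟨y, hyZ, hy⟩ := exists_innerTendsto_of_opial fb.selfAdjoint fb.pos fb.le_sqNorm
      (Z := {y | -B y ∈ A y ∧ B y = B z1}) ⟨z1, hz1⟩ (fun y hy => hDd hy.1)
      (fun z hz => (h1 z hz).1) hclust
    exact ⟨y, hyZ.1, hy, hwx, by rw [hyZ.2]; exact hBz⟩
  -- The limit is chosen off a measurable null set and put to `0` on it; its inner products are then
  -- pointwise limits of measurable functions everywhere.
  obtain ⟨N, hN, hNm, hNae⟩ : ∃ N : Set Ω, P N = 0 ∧ MeasurableSet N ∧ ∀ ω, ω ∉ N →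
      ∃ y, -B y ∈ A y ∧ InnerTendsto atTop (fun n => x n ω) y ∧
      Tendsto (fun n => w n ω - x n ω) atTop (𝓝 0) ∧
      Tendsto (fun n => B (w n ω)) atTop (𝓝 (B y)) := by
    obtain ⟨N, h1, h2, h3⟩ := exists_measurable_superset_of_null (ae_iff.1 hgood)
    exact ⟨N, h3, h2, fun ω hω => by_contra fun hcon => hω (h1 hcon)⟩
  choose! f hf using hNae
  refine ⟨Nᶜ.indicator f, ?_, ?_⟩
  · refine measurable_of_inner fun h => ?_
    have hmeas : ∀ n, Measurable fun ω => Nᶜ.indicator (fun ω => inner ℝ (x n ω) h) ω := by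
      intro n
      refine Measurable.indicator ?_ hNm.compl
      exact (((hxad n).mono (ℱ.le n)).inner stronglyMeasurable_const).measurable
    refine measurable_of_tendsto_metrizable hmeas ?_
    rw [tendsto_pi_nhds]
    intro ω
    by_cases hω : ω ∈ N
    · simp [hω]
    · have hω' : ω ∈ Nᶜ := hω
      simp only [Set.indicator_of_mem hω']
      exact (hf ω hω).2.1 h
  · have : ∀ᵐ ω ∂P, ω ∉ N := measure_eq_zero_iff_ae_notMem.1 hN
    filter_upwards [this] with ω hω
    have hω' : ω ∈ Nᶜ := hω
    rw [Set.indicator_of_mem hω']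
    exact hf ω hω

end StochasticForwardBackward

end PrimalDual

namespace PrimalDual

/-! ### Strongly convex functions and their minimizers -/

section ConvexFunctions

variable {H : Type*} [NormedAddCommGroup H] [InnerProductSpace ℝ H]

theorem IsGammaZero.exists_coe {f : H → EReal} (hf : IsGammaZero f) {x : H} (h : f x ≠ ⊤) :
    ∃ r : ℝ, f x = r := ⟨(f x).toReal, (EReal.coe_toReal h (hf.ne_bot x)).symm⟩

/-- Strong convexity with modulus `ρ` (convexity when `ρ = 0`). -/
def HasConvexModulus (f : H → EReal) (ρ : ℝ) : Prop :=
  ∀ x y : H, ∀ a b : ℝ, 0 < a → 0 < b → a + b = 1 →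
    f (a • x + b • y) + ((a * b * (ρ / 2) * ‖x - y‖ ^ 2 : ℝ) : EReal)
      ≤ (a : EReal) * f x + (b : EReal) * f y

theorem IsGammaZero.hasConvexModulus {f : H → EReal} (hf : IsGammaZero f) :
    HasConvexModulus f 0 := by
  intro x y a b ha hb hab
  simpa using hf.convex x y a b ha hb hab

theorem HasConvexModulus.coe_le {f : H → EReal} {ρ : ℝ} (hf : HasConvexModulus f ρ) {x y : H}
    {r t : ℝ} (hx : f x = r) (hy : f y = t) {a b : ℝ} (ha : 0 < a) (hb : 0 < b) (hab : a + b = 1) :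
    f (a • x + b • y) + ((a * b * (ρ / 2) * ‖x - y‖ ^ 2 : ℝ) : EReal)
      ≤ ((a * r + b * t : ℝ) : EReal) := by
  have := hf x y a b ha hb hab
  rw [hx, hy] at this
  exact_mod_cast this

theorem add_coe_ne_top {x : EReal} {r : ℝ} : x + (r : EReal) ≠ ⊤ ↔ x ≠ ⊤ := by
  induction x with
  | bot => simp
  | top => simp
  | coe x => simp [← EReal.coe_add]

theorem HasConvexModulus.add_coe {f : H → EReal} {q : H → ℝ} {ρ σ : ℝ} (h0 : ∀ x, f x ≠ ⊥)
    (hf : HasConvexModulus f ρ)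
    (hq : ∀ x y : H, ∀ a b : ℝ, 0 < a → 0 < b → a + b = 1 →
      q (a • x + b • y) + a * b * (σ / 2) * ‖x - y‖ ^ 2 ≤ a * q x + b * q y) :
    HasConvexModulus (fun x => f x + (q x : EReal)) (ρ + σ) := by
  intro x y a b ha hb hab
  by_cases hx : f x = ⊤
  · have h1 : (a : EReal) * (f x + (q x : EReal)) = ⊤ := by
      rw [hx, EReal.top_add_coe, EReal.coe_mul_top_of_pos ha]
    have h2 : (b : EReal) * (f y + (q y : EReal)) ≠ ⊥ := by
      have := h0 y
      induction h : f y with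
      | bot => exact absurd h this
      | top => rw [EReal.top_add_coe, EReal.coe_mul_top_of_pos hb]; simp
      | coe t => exact_mod_cast EReal.coe_ne_bot _
    rw [h1, EReal.top_add_of_ne_bot h2]
    exact le_top
  by_cases hy : f y = ⊤
  · have h1 : (b : EReal) * (f y + (q y : EReal)) = ⊤ := by
      rw [hy, EReal.top_add_coe, EReal.coe_mul_top_of_pos hb]
    have h2 : (a : EReal) * (f x + (q x : EReal)) ≠ ⊥ := by
      have := h0 x
      induction h : f x with
      | bot => exact absurd h this
      | top => exact absurd h hx
      | coe t => exact_mod_cast EReal.coe_ne_bot _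
    rw [h1, EReal.add_top_of_ne_bot h2]
    exact le_top
  obtain ⟨r, hr⟩ : ∃ r : ℝ, f x = r := ⟨_, (EReal.coe_toReal hx (h0 x)).symm⟩
  obtain ⟨t, ht⟩ : ∃ r : ℝ, f y = r := ⟨_, (EReal.coe_toReal hy (h0 y)).symm⟩
  have h1 := hf.coe_le hr ht ha hb hab
  have h2 := hq x y a b ha hb hab
  have hz : f (a • x + b • y) ≠ ⊤ := by
    intro h
    rw [h, EReal.top_add_coe] at h1
    exact EReal.coe_ne_top _ (top_le_iff.1 h1)
  obtain ⟨c, hc⟩ : ∃ r : ℝ, f (a • x + b • y) = r := ⟨_, (EReal.coe_toReal hz (h0 _)).symm⟩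
  simp only [hr, ht, hc] at h1 ⊢
  norm_cast at h1 ⊢
  nlinarith

theorem IsGammaZero.add_coe {f : H → EReal} (hf : IsGammaZero f) {q : H → ℝ} (hq : Continuous q)
    (hqc : ∀ x y : H, ∀ a b : ℝ, 0 < a → 0 < b → a + b = 1 →
      q (a • x + b • y) ≤ a * q x + b * q y) :
    IsGammaZero (fun x => f x + (q x : EReal)) where
  ne_bot x := by
    have := hf.ne_bot x
    induction h : f x with
    | bot => exact absurd h this
    | top => simp
    | coe t => exact_mod_cast EReal.coe_ne_bot _
  proper := by
    obtain ⟨x, hx⟩ := hf.proper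
    exact ⟨x, add_coe_ne_top.2 hx⟩
  lsc := by
    have h1 : LowerSemicontinuous fun x => (q x : EReal) :=
      (continuous_coe_real_ereal.comp hq).lowerSemicontinuous
    refine hf.lsc.add' h1 fun x => ?_
    exact EReal.continuousAt_add (Or.inr (EReal.coe_ne_bot _)) (Or.inr (EReal.coe_ne_top _))
  convex x y a b ha hb hab := by
    have := (hf.hasConvexModulus.add_coe (q := q) (σ := 0) hf.ne_bot (by simpa using hqc))
      x y a b ha hb hab
    simpa using this

/-- A strongly convex function in `Γ₀(H)` is bounded below. -/
theorem IsGammaZero.exists_lower_bound {f : H → EReal} (hf : IsGammaZero f) {ρ : ℝ} (hρ : 0 < ρ)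
    (hsc : HasConvexModulus f ρ) : ∃ c : ℝ, ∀ x, (c : EReal) ≤ f x := by
  obtain ⟨x0, hx0⟩ := hf.proper
  obtain ⟨r, hr⟩ := hf.exists_coe hx0
  have h1 : ((r - 1 : ℝ) : EReal) < f x0 := by
    rw [hr]; exact_mod_cast sub_one_lt r
  -- Lower semicontinuity bounds `f` below on a ball around `x0`. A point at distance `D ≥ δ` is
  -- compared with the point at distance `η` on the segment from `x0`. Strong convexity gives `f x ≥
  -- r - k D + ρ D² / 2`, and the minimum over `D` is `r - k² / (2 ρ)`.
  obtain ⟨δ, hδ, hball⟩ := Metric.eventually_nhds_iff.1 (hf.lsc x0 _ h1)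
  set η := δ / 2 with hη
  have hη0 : 0 < η := by positivity
  set k := 1 / η + ρ * η / 2 with hk
  refine ⟨min (r - 1) (r - k ^ 2 / (2 * ρ)), fun x => ?_⟩
  by_cases hx : f x = ⊤
  · rw [hx]; exact le_top
  obtain ⟨t, ht⟩ := hf.exists_coe hx
  rcases lt_or_ge (dist x x0) δ with hd | hd
  · refine le_trans ?_ (hball hd).le
    exact_mod_cast min_le_left _ _
  rw [dist_eq_norm] at hd
  set D := ‖x - x0‖ with hD
  have hD0 : 0 < D := hδ.trans_le hd
  set b := η / D with hb
  have hb0 : 0 < b := by positivity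
  have hbD : b * D = η := div_mul_cancel₀ _ hD0.ne'
  have hb1 : b < 1 := by
    rw [hb, div_lt_one hD0]; linarith
  have h2 := hsc.coe_le hr ht (a := 1 - b) (b := b) (by linarith) hb0 (by ring)
  have h3 : ((r - 1 : ℝ) : EReal) < f ((1 - b) • x0 + b • x) := by
    apply hball
    rw [dist_eq_norm]
    have : (1 - b) • x0 + b • x - x0 = b • (x - x0) := by
      rw [sub_smul, one_smul, smul_sub]; abel
    rw [this, norm_smul, Real.norm_of_nonneg hb0.le, ← hD, hbD]
    linarith
  have h4 : ((r - 1 + (1 - b) * b * (ρ / 2) * ‖x0 - x‖ ^ 2 : ℝ) : EReal)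
      ≤ (((1 - b) * r + b * t : ℝ) : EReal) := by
    refine le_trans ?_ h2
    rw [EReal.coe_add]
    gcongr
  have h5 : r - 1 + (1 - b) * b * (ρ / 2) * ‖x0 - x‖ ^ 2 ≤ (1 - b) * r + b * t := by
    exact_mod_cast h4
  rw [norm_sub_rev, ← hD] at h5
  rw [ht]
  norm_cast
  refine (min_le_right _ _).trans ?_
  have h6 : b * (r - k ^ 2 / (2 * ρ)) ≤ b * t := by
    have e1 : b * (k * D) = 1 + b * D * ρ * η / 2 := by
      rw [hk]
      have : b * ((1 / η + ρ * η / 2) * D) = (b * D) * (1 / η) + (b * D) * ρ * η / 2 := by ring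
      rw [this, hbD, mul_one_div_cancel hη0.ne']
    have e2 : k * D ≤ ρ / 2 * D ^ 2 + k ^ 2 / (2 * ρ) := by
      have : 0 ≤ (ρ * D - k) ^ 2 / (2 * ρ) := by positivity
      have e : (ρ * D - k) ^ 2 / (2 * ρ) = ρ / 2 * D ^ 2 + k ^ 2 / (2 * ρ) - k * D := by
        field_simp; ring
      linarith
    have e3 := mul_le_mul_of_nonneg_left e2 hb0.le
    have e4 : (1 - b) * b * (ρ / 2) * D ^ 2 = b * (ρ / 2 * D ^ 2) - b * D * (ρ / 2) * (b * D) := by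
      ring
    rw [e4] at h5
    have e5 : b * D * (ρ / 2) * (b * D) = b * D * ρ * η / 2 := by rw [hbD]; ring
    rw [e5] at h5
    linarith
  exact le_of_mul_le_mul_left h6 hb0

/-- A strongly convex function in `Γ₀(H)` has a minimizer. -/
theorem IsGammaZero.exists_isMinOn [CompleteSpace H] {f : H → EReal} (hf : IsGammaZero f)
    (hsc : IsStronglyConvex f) : ∃ p, IsMinOn f Set.univ p := by
  obtain ⟨ρ, hρ, hmod⟩ := hsc
  have hmod : HasConvexModulus f ρ := hmod
  obtain ⟨c, hc⟩ := hf.exists_lower_bound hρ hmod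
  set S : Set ℝ := {t | ∃ x, f x = t} with hS
  have hSne : S.Nonempty := by
    obtain ⟨x, hx⟩ := hf.proper
    obtain ⟨r, hr⟩ := hf.exists_coe hx
    exact ⟨r, x, hr⟩
  have hSb : BddBelow S := by
    refine ⟨c, ?_⟩
    rintro t ⟨x, hx⟩
    have := hc x
    rw [hx] at this
    exact_mod_cast this
  set m := sInf S with hm
  have hex : ∀ n : ℕ, ∃ x, ∃ t : ℝ, f x = t ∧ t < m + 1 / ((n : ℝ) + 1) := by
    intro n
    obtain ⟨t, ⟨x, hx⟩, ht⟩ := exists_lt_of_csInf_lt hSne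
      (show sInf S < m + 1 / ((n : ℝ) + 1) by
        rw [← hm]; exact lt_add_of_pos_right _ Nat.one_div_pos_of_nat)
    exact ⟨x, t, hx, ht⟩
  choose x t hx ht using hex
  have hmle : ∀ y : H, (m : EReal) ≤ f y := by
    intro y
    by_cases hy : f y = ⊤
    · rw [hy]; exact le_top
    obtain ⟨r, hr⟩ := hf.exists_coe hy
    rw [hr]
    exact_mod_cast csInf_le hSb ⟨y, hr⟩
  -- The value at the midpoint is at least `m`, so the midpoint gain `ρ / 8 * ‖x n - x k‖²` is at
  -- most `1 / (N + 1)`: the minimizing sequence is Cauchy.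
  have hdist : ∀ n k N, N ≤ n → N ≤ k → dist (x n) (x k) ≤ Real.sqrt (8 / ρ * (1 / ((N : ℝ) + 1))) := by
    intro n k N hn hk
    have h1 := hmod.coe_le (hx n) (hx k) (a := 1 / 2) (b := 1 / 2) (by norm_num) (by norm_num)
      (by norm_num)
    have h2 : ((m + 1 / 2 * (1 / 2) * (ρ / 2) * ‖x n - x k‖ ^ 2 : ℝ) : EReal)
        ≤ ((1 / 2 * t n + 1 / 2 * t k : ℝ) : EReal) := by
      refine le_trans ?_ h1
      rw [EReal.coe_add]
      gcongr
      exact hmle _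
    have h3 : m + 1 / 2 * (1 / 2) * (ρ / 2) * ‖x n - x k‖ ^ 2 ≤ 1 / 2 * t n + 1 / 2 * t k := by
      exact_mod_cast h2
    have h4 : t n ≤ m + 1 / ((N : ℝ) + 1) := (ht n).le.trans (by gcongr)
    have h5 : t k ≤ m + 1 / ((N : ℝ) + 1) := (ht k).le.trans (by gcongr)
    rw [dist_eq_norm]
    apply Real.le_sqrt_of_sq_le
    rw [div_mul_eq_mul_div, le_div_iff₀ hρ]
    linarith
  have hcau : CauchySeq x := by
    refine cauchySeq_of_le_tendsto_0 _ hdist ?_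
    have h1 := (tendsto_one_div_add_atTop_nhds_zero_nat (𝕜 := ℝ)).const_mul (8 / ρ)
    simpa using h1.sqrt
  obtain ⟨p, hp⟩ := cauchySeq_tendsto_of_complete hcau
  refine ⟨p, fun y _ => ?_⟩
  refine le_trans ?_ (hmle y)
  by_contra hcon
  push Not at hcon
  obtain ⟨d, hd1, hd2⟩ := EReal.lt_iff_exists_real_btwn.1 hcon
  have h1 := hp.eventually (hf.lsc p _ hd2)
  have h2 : ∀ᶠ n : ℕ in atTop, m + 1 / ((n : ℝ) + 1) < d := by
    have h3 : Tendsto (fun n : ℕ => m + 1 / ((n : ℝ) + 1)) atTop (𝓝 (m + 0)) :=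
      tendsto_const_nhds.add tendsto_one_div_add_atTop_nhds_zero_nat
    rw [add_zero] at h3
    exact h3.eventually_lt_const (by exact_mod_cast hd1)
  obtain ⟨n, hn1, hn2⟩ := (h1.and h2).exists
  rw [hx n] at hn1
  have : d < t n := by exact_mod_cast hn1
  linarith [ht n]

end ConvexFunctions

/-! ### Subdifferentials and proximity operators -/

section Subdifferential

variable {H : Type*} [NormedAddCommGroup H] [InnerProductSpace ℝ H]

theorem IsGammaZero.ne_top_of_mem_subdifferential {f : H → EReal} (hf : IsGammaZero f) {x u : H}
    (hu : u ∈ subdifferential f x) : f x ≠ ⊤ := by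
  obtain ⟨y, hy⟩ := hf.proper
  intro hx
  have := hu y
  rw [hx, EReal.coe_add_top] at this
  exact hy (top_le_iff.1 this)

theorem IsGammaZero.exists_coe_of_mem_subdifferential {f : H → EReal} (hf : IsGammaZero f)
    {x u : H} (hu : u ∈ subdifferential f x) : ∃ r : ℝ, f x = r :=
  hf.exists_coe (hf.ne_top_of_mem_subdifferential hu)

theorem inner_add_le_of_mem_subdifferential {f : H → EReal} {x y u : H} {r t : ℝ}
    (hu : u ∈ subdifferential f x) (hx : f x = r) (hy : f y = t) : inner ℝ (y - x) u + r ≤ t := by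
  have := hu y
  rw [hx, hy] at this
  exact_mod_cast this

theorem IsGammaZero.inner_sub_nonneg {f : H → EReal} (hf : IsGammaZero f) {x y u v : H}
    (hu : u ∈ subdifferential f x) (hv : v ∈ subdifferential f y) :
    0 ≤ inner ℝ (x - y) (u - v) := by
  obtain ⟨r, hr⟩ := hf.exists_coe_of_mem_subdifferential hu
  obtain ⟨t, ht⟩ := hf.exists_coe_of_mem_subdifferential hv
  have h1 := inner_add_le_of_mem_subdifferential hu hr ht
  have h2 := inner_add_le_of_mem_subdifferential hv ht hr
  have h3 : inner ℝ (y - x) u = -inner ℝ (x - y) u := by rw [← inner_neg_left, neg_sub]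
  rw [inner_sub_right]
  linarith

/-- A minimizer of the tilted function `f - ⟪u, ·⟫`, which is still strongly convex, is such a
point. -/
theorem exists_mem_subdifferential_of_stronglyConvex [CompleteSpace H] {f : H → EReal}
    (hf : IsGammaZero f) (hsc : IsStronglyConvex f) (u : H) : ∃ x, u ∈ subdifferential f x := by
  obtain ⟨ρ, hρ, hmod⟩ := hsc
  have hlin : ∀ x y : H, ∀ a b : ℝ, -inner ℝ u (a • x + b • y) = a * -inner ℝ u x + b * -inner ℝ u y := by
    intro x y a b
    rw [inner_add_right, inner_smul_right, inner_smul_right]; ring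
  have h1 : IsGammaZero fun x => f x + ((-inner ℝ u x : ℝ) : EReal) :=
    hf.add_coe (by fun_prop) fun x y a b _ _ _ => (hlin x y a b).le
  have h2 : HasConvexModulus (fun x => f x + ((-inner ℝ u x : ℝ) : EReal)) (ρ + 0) :=
    HasConvexModulus.add_coe hf.ne_bot hmod fun x y a b _ _ _ => by
      rw [hlin]; simp
  obtain ⟨p, hp⟩ := h1.exists_isMinOn ⟨ρ + 0, by simpa using hρ, h2⟩
  refine ⟨p, fun y => ?_⟩
  have h3 : f p + ((-inner ℝ u p : ℝ) : EReal) ≤ f y + ((-inner ℝ u y : ℝ) : EReal) :=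
    hp (Set.mem_univ y)
  by_cases hy : f y = ⊤
  · rw [hy]; exact le_top
  obtain ⟨t, ht⟩ := hf.exists_coe hy
  have hpt : f p ≠ ⊤ := by
    intro h
    rw [h, EReal.top_add_coe, ht, ← EReal.coe_add] at h3
    exact EReal.coe_ne_top _ (top_le_iff.1 h3)
  obtain ⟨r, hr⟩ := hf.exists_coe hpt
  rw [hr, ht] at h3 ⊢
  norm_cast at h3 ⊢
  rw [real_inner_comm, inner_sub_right]
  linarith

/-- This identity gives both the strong convexity of the proximal objective and its first-order
optimality condition. -/
theorem sqNorm_convex_combination {U : H →L[ℝ] H} [CompleteSpace H] (hU : IsSelfAdjoint U)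
    (x y z : H) {a b : ℝ} (hab : a + b = 1) :
    sqNorm U (x - (a • y + b • z))
      = a * sqNorm U (x - y) + b * sqNorm U (x - z) - a * b * sqNorm U (y - z) := by
  have e1 : x - (a • y + b • z) = a • (x - y) + b • (x - z) := by
    have : x = a • x + b • x := by rw [← add_smul, hab, one_smul]
    nth_rewrite 1 [this]
    simp only [smul_sub]; abel
  have e2 : y - z = (x - z) - (x - y) := by abel
  rw [e1, e2, sqNorm_add hU, sqNorm_sub hU (x - z) (x - y), sqNorm_smul, sqNorm_smul, map_smul, inner_smul_left,
    inner_smul_right]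
  simp only [RCLike.conj_to_real]
  rw [inner_map_symm hU (x - z), real_inner_comm]
  have hb : b = 1 - a := by linarith
  subst hb
  ring

theorem continuous_sqNorm_sub (U : H →L[ℝ] H) (x : H) :
    Continuous fun y => 1 / 2 * sqNorm U (x - y) := by
  unfold sqNorm
  fun_prop

/-- Fermat's rule by hand: the value at `p` is compared with the value at `(1 - b) • p + b • y`,
convexity of `f` is used, and after division by `b` the error `b / 2 * ‖p - y‖_U²` vanishes as `b →
0`. -/
theorem mem_subdifferential_of_isMinOn [CompleteSpace H] {f : H → EReal} (hf : IsGammaZero f)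
    {U : H →L[ℝ] H} (hU : IsSelfAdjoint U) {x p : H}
    (hp : IsMinOn (fun y => f y + ((1 / 2 * sqNorm U (x - y) : ℝ) : EReal)) Set.univ p) :
    U (x - p) ∈ subdifferential f p := by
  intro y
  by_cases hy : f y = ⊤
  · rw [hy]; exact le_top
  obtain ⟨t, ht⟩ := hf.exists_coe hy
  have hmin : ∀ w, f p + ((1 / 2 * sqNorm U (x - p) : ℝ) : EReal)
      ≤ f w + ((1 / 2 * sqNorm U (x - w) : ℝ) : EReal) := fun w => hp (Set.mem_univ w)
  have hpt : f p ≠ ⊤ := by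
    intro h
    have h3 := hmin y
    rw [h, EReal.top_add_coe, ht, ← EReal.coe_add] at h3
    exact EReal.coe_ne_top _ (top_le_iff.1 h3)
  obtain ⟨r, hr⟩ := hf.exists_coe hpt
  rw [hr, ht]
  norm_cast
  have key : ∀ b : ℝ, 0 < b → b < 1 →
      inner ℝ (y - p) (U (x - p)) + r - t ≤ b * (1 / 2 * sqNorm U (p - y)) := by
    intro b hb0 hb1
    have hab : (1 - b) + b = 1 := by ring
    have h1 := hmin ((1 - b) • p + b • y)
    have h2 := hf.hasConvexModulus.coe_le hr ht (sub_pos.2 hb1) hb0 hab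
    simp only [zero_div, mul_zero, zero_mul, EReal.coe_zero, add_zero] at h2
    have h3 : ((r + 1 / 2 * sqNorm U (x - p) : ℝ) : EReal)
        ≤ (((1 - b) * r + b * t + 1 / 2 * sqNorm U (x - ((1 - b) • p + b • y)) : ℝ) : EReal) := by
      rw [hr, ← EReal.coe_add] at h1
      refine h1.trans ?_
      rw [EReal.coe_add]
      gcongr
    have h4 : r + 1 / 2 * sqNorm U (x - p)
        ≤ (1 - b) * r + b * t + 1 / 2 * sqNorm U (x - ((1 - b) • p + b • y)) := by
      exact_mod_cast h3
    rw [sqNorm_convex_combination hU x p y hab] at h4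
    have e1 : sqNorm U (x - y)
        = sqNorm U (x - p) + 2 * inner ℝ (U (x - p)) (p - y) + sqNorm U (p - y) := by
      rw [← sqNorm_add hU]; congr 1; abel
    have e2 : inner ℝ (y - p) (U (x - p)) = -inner ℝ (U (x - p)) (p - y) := by
      rw [real_inner_comm, ← inner_neg_right, neg_sub]
    rw [e1] at h4
    rw [e2]
    refine le_of_mul_le_mul_left ?_ hb0
    linarith
  have hlim : Tendsto (fun b : ℝ => b * (1 / 2 * sqNorm U (p - y))) (𝓝[>] 0) (𝓝 0) := by
    have : Tendsto (fun b : ℝ => b * (1 / 2 * sqNorm U (p - y))) (𝓝 0)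
        (𝓝 (0 * (1 / 2 * sqNorm U (p - y)))) := tendsto_id.mul_const _
    rw [zero_mul] at this
    exact this.mono_left nhdsWithin_le_nhds
  have := ge_of_tendsto hlim (b := inner ℝ (y - p) (U (x - p)) + r - t) (by
    filter_upwards [Ioo_mem_nhdsGT (show (0 : ℝ) < 1 by norm_num)] with b hb
    exact key b hb.1 hb.2)
  linarith

/-- The defining inclusion of the proximity operator. -/
theorem map_sub_prox_mem_subdifferential [CompleteSpace H] {f : H → EReal} (hf : IsGammaZero f)
    {U : H →L[ℝ] H} (hU : IsStronglyPositive U) (x : H) :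
    U (x - prox f U x) ∈ subdifferential f (prox f U x) := by
  obtain ⟨hS, χ, hχ, hpos⟩ := hU
  have hpos : ∀ y, χ * ‖y‖ ^ 2 ≤ sqNorm U y := hpos
  have hq : ∀ y z : H, ∀ a b : ℝ, 0 < a → 0 < b → a + b = 1 →
      1 / 2 * sqNorm U (x - (a • y + b • z)) + a * b * (χ / 2) * ‖y - z‖ ^ 2
        ≤ a * (1 / 2 * sqNorm U (x - y)) + b * (1 / 2 * sqNorm U (x - z)) := by
    intro y z a b ha hb hab
    rw [sqNorm_convex_combination hS x y z hab]
    have := mul_le_mul_of_nonneg_left (hpos (y - z)) (mul_pos ha hb).le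
    linarith
  have h1 : IsGammaZero fun y => f y + ((1 / 2 * sqNorm U (x - y) : ℝ) : EReal) :=
    hf.add_coe (continuous_sqNorm_sub U x) fun y z a b ha hb hab => by
      refine le_trans ?_ (hq y z a b ha hb hab)
      exact le_add_of_nonneg_right (by positivity)
  have h2 : HasConvexModulus (fun y => f y + ((1 / 2 * sqNorm U (x - y) : ℝ) : EReal)) (0 + χ) :=
    HasConvexModulus.add_coe hf.ne_bot hf.hasConvexModulus hq
  have h3 := h1.exists_isMinOn ⟨0 + χ, by simpa using hχ, h2⟩
  exact mem_subdifferential_of_isMinOn hf hS (Classical.epsilon_spec h3)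

/-- Minty surjectivity of `Id + ∂f`, witnessed by the proximity operator for the identity metric. -/
theorem IsGammaZero.exists_mem_subdifferential [CompleteSpace H] {f : H → EReal}
    (hf : IsGammaZero f) (x : H) : ∃ p, x - p ∈ subdifferential f p := by
  have h : IsStronglyPositive (ContinuousLinearMap.id ℝ H) :=
    ⟨IsSelfAdjoint.one _, 1, one_pos, fun x => by simp⟩
  exact ⟨_, map_sub_prox_mem_subdifferential hf h x⟩

end Subdifferential

/-! ### Conjugation and the gradient of the conjugate -/

section Conjugate

variable {H : Type*} [NormedAddCommGroup H] [InnerProductSpace ℝ H]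

theorem le_conjugate (f : H → EReal) (u : H) {x : H} {r : ℝ} (hx : f x = r) :
    ((inner ℝ u x - r : ℝ) : EReal) ≤ conjugate f u := by
  refine le_trans ?_ (le_iSup (fun x : H => ((inner ℝ u x : ℝ) : EReal) - f x) x)
  rw [hx, EReal.coe_sub]

theorem conjugate_eq_of_mem_subdifferential {f : H → EReal} {x u : H} {r : ℝ} (hx : f x = r)
    (hu : u ∈ subdifferential f x) : conjugate f u = ((inner ℝ u x - r : ℝ) : EReal) := by
  refine le_antisymm (iSup_le fun y => ?_) (le_conjugate f u hx)
  have h1 := hu y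
  rw [hx] at h1
  induction h : f y with
  | bot =>
    rw [h] at h1
    exact absurd (le_bot_iff.1 h1) (by exact_mod_cast EReal.coe_ne_bot _)
  | top => simp
  | coe t =>
    rw [h] at h1
    norm_cast at h1 ⊢
    rw [real_inner_comm, inner_sub_right] at h1
    linarith

theorem mem_subdifferential_conjugate {f : H → EReal} {x u : H} {r : ℝ} (hx : f x = r)
    (hu : u ∈ subdifferential f x) : x ∈ subdifferential (conjugate f) u := by
  intro v
  rw [conjugate_eq_of_mem_subdifferential hx hu]
  refine le_trans ?_ (le_conjugate f v hx)
  norm_cast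
  rw [inner_sub_left]
  linarith

theorem IsGammaZero.conjugate [CompleteSpace H] {f : H → EReal} (hf : IsGammaZero f) :
    IsGammaZero (conjugate f) where
  ne_bot u := by
    obtain ⟨x, hx⟩ := hf.proper
    obtain ⟨r, hr⟩ := hf.exists_coe hx
    intro h
    have := le_conjugate f u hr
    rw [h] at this
    exact EReal.coe_ne_bot _ (le_bot_iff.1 this)
  proper := by
    -- The conjugate is finite at every subgradient of `f`, and the proximal point of `0` provides
    -- one.
    obtain ⟨p, hp⟩ := hf.exists_mem_subdifferential 0
    obtain ⟨r, hr⟩ := hf.exists_coe_of_mem_subdifferential hp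
    refine ⟨0 - p, ?_⟩
    rw [conjugate_eq_of_mem_subdifferential hr hp]
    exact EReal.coe_ne_top _
  lsc := by
    refine lowerSemicontinuous_iSup fun x => ?_
    induction h : f x with
    | bot => exact absurd h (hf.ne_bot x)
    | top => simpa using lowerSemicontinuous_const
    | coe t =>
      simp only [← EReal.coe_sub]
      exact (continuous_coe_real_ereal.comp (by fun_prop)).lowerSemicontinuous
  convex u v a b ha hb hab := by
    refine iSup_le fun x => ?_
    induction h : f x with
    | bot => exact absurd h (hf.ne_bot x)
    | top => simp
    | coe t =>
      have h1 := le_conjugate f u h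
      have h2 := le_conjugate f v h
      have h3 : ((a * (inner ℝ u x - t) : ℝ) : EReal) ≤ (a : EReal) * PrimalDual.conjugate f u := by
        rw [EReal.coe_mul]
        exact mul_le_mul_of_nonneg_left h1 (by exact_mod_cast ha.le)
      have h4 : ((b * (inner ℝ v x - t) : ℝ) : EReal) ≤ (b : EReal) * PrimalDual.conjugate f v := by
        rw [EReal.coe_mul]
        exact mul_le_mul_of_nonneg_left h2 (by exact_mod_cast hb.le)
      refine le_trans ?_ (add_le_add h3 h4)
      norm_cast
      rw [inner_add_left, inner_smul_left, inner_smul_left]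
      simp only [RCLike.conj_to_real]
      have : b = 1 - a := by linarith
      subst this
      linarith

/-- Biconjugation is avoided. With `p` such that `x + u - p ∈ ∂f p`, one has `p ∈ ∂f* (x + u - p)`,
and monotonicity of `∂f*` against `x ∈ ∂f* u` yields `-‖p - x‖² ≥ 0`. Hence `p = x`. -/
theorem IsGammaZero.mem_subdifferential_of_conjugate [CompleteSpace H] {f : H → EReal}
    (hf : IsGammaZero f) {x u : H} (h : x ∈ subdifferential (PrimalDual.conjugate f) u) :
    u ∈ subdifferential f x := by
  obtain ⟨p, hp⟩ := hf.exists_mem_subdifferential (x + u)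
  obtain ⟨r, hr⟩ := hf.exists_coe_of_mem_subdifferential hp
  have h1 := hf.conjugate.inner_sub_nonneg (mem_subdifferential_conjugate hr hp) h
  have e : x + u - p - u = -(p - x) := by abel
  rw [e, inner_neg_left, real_inner_self_eq_norm_sq] at h1
  have h2 : ‖p - x‖ = 0 := by nlinarith [norm_nonneg (p - x), sq_nonneg ‖p - x‖]
  have h3 : p = x := sub_eq_zero.1 (norm_eq_zero.1 h2)
  rw [h3] at hp
  simpa using hp

theorem IsGammaZero.mem_subdifferential_conjugate_iff [CompleteSpace H] {f : H → EReal}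
    (hf : IsGammaZero f) {x u : H} :
    x ∈ subdifferential (PrimalDual.conjugate f) u ↔ u ∈ subdifferential f x :=
  ⟨hf.mem_subdifferential_of_conjugate, fun h => by
    obtain ⟨r, hr⟩ := hf.exists_coe_of_mem_subdifferential h
    exact mem_subdifferential_conjugate hr h⟩

/-- Subgradients of a strongly convex function are strongly monotone. -/
theorem exists_norm_sub_le_of_stronglyConvex {f : H → EReal} (hf : IsGammaZero f)
    (hsc : IsStronglyConvex f) : ∃ C : ℝ, 0 ≤ C ∧ ∀ x y u v, u ∈ subdifferential f x →
      v ∈ subdifferential f y → ‖x - y‖ ≤ C * ‖u - v‖ := by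
  obtain ⟨ρ, hρ, hmod⟩ := hsc
  have hmod : HasConvexModulus f ρ := hmod
  -- Testing the subgradient only at the midpoint gives `ρ / 4` instead of the sharp `ρ / 2`, but
  -- needs no limit; the resulting Lipschitz constant is `2 / ρ`.
  have key : ∀ x y u r t, u ∈ subdifferential f x → f x = (r : ℝ) → f y = (t : ℝ) →
      inner ℝ (y - x) u + r + ρ / 4 * ‖x - y‖ ^ 2 ≤ t := by
    intro x y u r t hu hr ht
    have h1 := hmod.coe_le hr ht (a := 1 / 2) (b := 1 / 2) (by norm_num) (by norm_num) (by norm_num)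
    have h2 := hu ((1 / 2 : ℝ) • x + (1 / 2 : ℝ) • y)
    rw [hr] at h2
    have h3 := (add_le_add_left h2 _).trans h1
    have e : (1 / 2 : ℝ) • x + (1 / 2 : ℝ) • y - x = (1 / 2 : ℝ) • (y - x) := by
      rw [smul_sub]
      have : x = (1 / 2 : ℝ) • x + (1 / 2 : ℝ) • x := by rw [← add_smul]; norm_num
      nth_rewrite 2 [this]
      abel
    rw [e, inner_smul_left] at h3
    simp only [RCLike.conj_to_real] at h3
    norm_cast at h3
    linarith
  refine ⟨2 / ρ, by positivity, fun x y u v hu hv => ?_⟩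
  obtain ⟨r, hr⟩ := hf.exists_coe_of_mem_subdifferential hu
  obtain ⟨t, ht⟩ := hf.exists_coe_of_mem_subdifferential hv
  have h1 := key x y u r t hu hr ht
  have h2 := key y x v t r hv ht hr
  have h3 : inner ℝ (y - x) u = -inner ℝ (x - y) u := by rw [← inner_neg_left, neg_sub]
  have h4 := real_inner_le_norm (x - y) (u - v)
  rw [inner_sub_right] at h4
  rw [norm_sub_rev y x] at h2
  rw [div_mul_eq_mul_div, le_div_iff₀ hρ]
  rcases (norm_nonneg (x - y)).eq_or_lt with h0 | h0
  · rw [← h0]; simp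
  · refine le_of_mul_le_mul_left ?_ h0
    nlinarith

/-- If `y` is a subgradient of `f*` at `v`, then the two subgradient inequalities place `f* v - f* u
- ⟪v - u, x⟫` between `0` and `⟪v - u, y - x⟫`. The latter is at most `C ‖v - u‖²` because strong
convexity of `f` makes the subgradients of `f*` Lipschitz. Every `v` is a subgradient of `f`, so
`f*` is finite everywhere and `toReal` loses nothing. -/
theorem hasGradientAt_conjugate [CompleteSpace H] {f : H → EReal} (hf : IsGammaZero f)
    (hsc : IsStronglyConvex f) {x u : H} (hu : u ∈ subdifferential f x) :
    HasGradientAt (fun u => (conjugate f u).toReal) x u := by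
  obtain ⟨C, hC0, hC⟩ := exists_norm_sub_le_of_stronglyConvex hf hsc
  have hle : ∀ x u v, u ∈ subdifferential f x →
      inner ℝ (v - u) x + (conjugate f u).toReal ≤ (conjugate f v).toReal := by
    intro x u v hu
    obtain ⟨y, hy⟩ := exists_mem_subdifferential_of_stronglyConvex hf hsc v
    obtain ⟨r, hr⟩ := hf.exists_coe_of_mem_subdifferential hu
    obtain ⟨t, ht⟩ := hf.exists_coe_of_mem_subdifferential hy
    have h1 := mem_subdifferential_conjugate hr hu v
    rw [conjugate_eq_of_mem_subdifferential hr hu, conjugate_eq_of_mem_subdifferential ht hy] at h1 ⊢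
    rw [EReal.toReal_coe, EReal.toReal_coe]
    exact_mod_cast h1
  rw [hasGradientAt_iff_isLittleO]
  have hO : (fun v => (conjugate f v).toReal - (conjugate f u).toReal - inner ℝ x (v - u))
      =O[𝓝 u] fun v => ‖v - u‖ ^ 2 := by
    refine Asymptotics.IsBigO.of_bound C (Eventually.of_forall fun v => ?_)
    obtain ⟨y, hy⟩ := exists_mem_subdifferential_of_stronglyConvex hf hsc v
    have h1 := hle x u v hu
    have h2 := hle y v u hy
    have h3 : inner ℝ (u - v) y = -inner ℝ (v - u) y := by rw [← inner_neg_left, neg_sub]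
    have h4 := real_inner_le_norm (v - u) (y - x)
    rw [inner_sub_right] at h4
    have h5 := mul_le_mul_of_nonneg_left (hC y x v u hy hu) (norm_nonneg (v - u))
    rw [real_inner_comm x (v - u)] at *
    rw [Real.norm_eq_abs, norm_pow, norm_norm, abs_of_nonneg (by linarith)]
    nlinarith
  refine hO.trans_isLittleO ?_
  have h1 : (fun v : H => ‖v - u‖ ^ 2) = fun v => ‖v - u‖ * ‖v - u‖ := by ext; ring
  rw [h1]
  have h2 : (fun v : H => ‖v - u‖) =o[𝓝 u] fun _ => (1 : ℝ) := by
    rw [Asymptotics.isLittleO_one_iff]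
    have : Tendsto (fun v : H => ‖v - u‖) (𝓝 u) (𝓝 ‖u - u‖) := by
      apply Continuous.tendsto; fun_prop
    simpa using this
  have h3 := h2.mul_isBigO (Asymptotics.isBigO_refl (fun v : H => ‖v - u‖) (𝓝 u))
  simp only [one_mul] at h3
  exact h3.of_norm_right

theorem gradConj_eq [CompleteSpace H] {f : H → EReal} (hf : IsGammaZero f)
    (hsc : IsStronglyConvex f) {x u : H} (hu : u ∈ subdifferential f x) : gradConj f u = x :=
  (hasGradientAt_conjugate hf hsc hu).gradient

theorem mem_subdifferential_gradConj [CompleteSpace H] {f : H → EReal} (hf : IsGammaZero f)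
    (hsc : IsStronglyConvex f) (u : H) : u ∈ subdifferential f (gradConj f u) := by
  obtain ⟨x, hx⟩ := exists_mem_subdifferential_of_stronglyConvex hf hsc u
  rwa [gradConj_eq hf hsc hx]

end Conjugate

/-! ### Gradients of convex functions -/

section Gradient

variable {H : Type*} [NormedAddCommGroup H] [InnerProductSpace ℝ H] [CompleteSpace H]

/-- On the line through `x` and `y` this says that a one-variable convex function has slope on `[0,
1]` at least its derivative at `0`. -/
theorem add_inner_gradient_le {φ : H → ℝ} (hc : ConvexOn ℝ Set.univ φ) (hd : Differentiable ℝ φ)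
    (x y : H) : φ x + inner ℝ (y - x) (gradient φ x) ≤ φ y := by
  let γ : ℝ → ℝ := fun t => φ (AffineMap.lineMap x y t)
  have hγ : ConvexOn ℝ Set.univ γ := by
    have := hc.comp_affineMap (AffineMap.lineMap x y)
    rw [Set.preimage_univ] at this
    exact this
  have hline : HasDerivAt (fun t : ℝ => AffineMap.lineMap x y t) (y - x) 0 := by
    exact AffineMap.hasDerivAt_lineMap
  have hg : HasDerivAt γ (inner ℝ (y - x) (gradient φ x)) 0 := by
    have h1 : HasFDerivAt φ (InnerProductSpace.toDual ℝ H (gradient φ x))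
        (AffineMap.lineMap x y (0 : ℝ)) := by
      rw [AffineMap.lineMap_apply_zero]
      exact (hd x).hasGradientAt.hasFDerivAt
    have h2 := h1.comp_hasDerivAt (0 : ℝ) hline
    rw [InnerProductSpace.toDual_apply_apply, real_inner_comm] at h2
    exact h2
  have := hγ.le_slope_of_hasDerivAt (Set.mem_univ 0) (Set.mem_univ 1) one_pos hg
  simp only [slope_def_field, γ, AffineMap.lineMap_apply_zero, AffineMap.lineMap_apply_one,
    sub_zero, div_one] at this
  linarith

theorem gradient_mem_subdifferential {φ : H → ℝ} (hc : ConvexOn ℝ Set.univ φ)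
    (hd : Differentiable ℝ φ) (x : H) :
    gradient φ x ∈ subdifferential (fun x => (φ x : EReal)) x := by
  intro y
  have := add_inner_gradient_le hc hd x y
  change ((inner ℝ (y - x) (gradient φ x) : ℝ) : EReal) + (φ x : EReal) ≤ (φ y : EReal)
  norm_cast
  linarith

end Gradient

/-! ### From convergence of subgradients to strong convergence -/

section UniformConvexity

variable {H : Type*} [NormedAddCommGroup H] [InnerProductSpace ℝ H]

/-- If `f` is uniformly convex at `x`, then strong convergence of subgradients along a bounded
sequence to a subgradient at `x` forces strong convergence of the sequence to `x`. -/
theorem UniformlyConvexAt.tendsto {f : H → EReal} {x : H} (hf : UniformlyConvexAt f x)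
    (hbot : ∀ y, f y ≠ ⊥) {c u : ℕ → H} {u' : H} {C : ℝ} (hC : ∀ n, ‖c n‖ ≤ C)
    (hu : ∀ n, u n ∈ subdifferential f (c n)) (hu' : u' ∈ subdifferential f x)
    (hlim : Tendsto u atTop (𝓝 u')) : Tendsto c atTop (𝓝 x) := by
  obtain ⟨hx, ψ, hmono, hψ0, hψ⟩ := hf
  obtain ⟨r, hr⟩ : ∃ r : ℝ, f x = r := ⟨_, (EReal.coe_toReal hx (hbot x)).symm⟩
  -- Three inequalities are added: uniform convexity at the midpoint of `x` and `c n`, the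
  -- subgradient `u'` tested at that midpoint, and the subgradient `u n` tested at `x`.
  have key : ∀ n, ENNReal.ofReal (1 / 2 * (1 / 2)) * ψ ‖x - c n‖₊
      ≤ ENNReal.ofReal (1 / 2 * inner ℝ (c n - x) (u n - u')) := by
    intro n
    have h1 := hu n x
    have hcn : f (c n) ≠ ⊤ := by
      intro h
      rw [h, hr, EReal.coe_add_top] at h1
      exact EReal.coe_ne_top _ (top_le_iff.1 h1)
    obtain ⟨t, ht⟩ : ∃ r : ℝ, f (c n) = r := ⟨_, (EReal.coe_toReal hcn (hbot _)).symm⟩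
    have h2 := inner_add_le_of_mem_subdifferential (hu n) ht hr
    have h3 := hψ (c n) (1 / 2) (1 / 2) (by norm_num) (by norm_num) (by norm_num)
    have h4 := hu' ((1 / 2 : ℝ) • x + (1 / 2 : ℝ) • c n)
    have h5 := (add_le_add_left h4 _).trans h3
    have e : (1 / 2 : ℝ) • x + (1 / 2 : ℝ) • c n - x = (1 / 2 : ℝ) • (c n - x) := by
      rw [smul_sub]
      have : x = (1 / 2 : ℝ) • x + (1 / 2 : ℝ) • x := by rw [← add_smul]; norm_num
      nth_rewrite 2 [this]
      abel
    rw [e, hr, ht, inner_smul_left] at h5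
    simp only [RCLike.conj_to_real] at h5
    have h6 : inner ℝ (x - c n) (u n) = -inner ℝ (c n - x) (u n) := by
      rw [← inner_neg_left, neg_sub]
    generalize hE : ENNReal.ofReal (1 / 2 * (1 / 2)) * ψ ‖x - c n‖₊ = E at h5 ⊢
    have hEt : E ≠ ⊤ := by
      rintro rfl
      rw [EReal.coe_ennreal_top] at h5
      norm_cast at h5
    lift E to ℝ≥0 using hEt
    have h7 : 1 / 2 * inner ℝ (c n - x) u' + r + (E : ℝ) ≤ 1 / 2 * r + 1 / 2 * t := by
      have : (((E : ℝ≥0∞)) : EReal) = ((E : ℝ) : EReal) := rfl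
      rw [this] at h5
      exact_mod_cast h5
    rw [ENNReal.le_ofReal_iff_toReal_le ENNReal.coe_ne_top]
    · rw [ENNReal.coe_toReal, inner_sub_right]
      linarith
    · have := E.2
      rw [inner_sub_right]
      change 0 ≤ (E : ℝ) at this
      linarith
  have hzero : Tendsto (fun n => ENNReal.ofReal (1 / 2 * inner ℝ (c n - x) (u n - u'))) atTop
      (𝓝 0) := by
    have h1 : Tendsto (fun n => 1 / 2 * inner ℝ (c n - x) (u n - u')) atTop (𝓝 0) := by
      refine squeeze_zero_norm (a := fun n => 1 / 2 * ((C + ‖x‖) * ‖u n - u'‖)) (fun n => ?_) ?_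
      · rw [norm_mul, Real.norm_of_nonneg (by norm_num : (0 : ℝ) ≤ 1 / 2)]
        gcongr
        refine (norm_inner_le_norm _ _).trans ?_
        gcongr
        exact (norm_sub_le _ _).trans (by gcongr; exact hC n)
      · simpa only [mul_zero] using ((tendsto_iff_norm_sub_tendsto_zero.1 hlim).const_mul
          (C + ‖x‖)).const_mul (1 / 2)
    simpa using ENNReal.tendsto_ofReal h1
  rw [Metric.tendsto_atTop']
  intro δ hδ
  -- By monotonicity of `ψ`, a distance of at least `δ` would keep the left side of `key` above this
  -- positive threshold.
  have hδψ : 0 < ENNReal.ofReal (1 / 2 * (1 / 2)) * ψ δ.toNNReal := by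
    refine ENNReal.mul_pos (by simp) fun h => ?_
    have := (hψ0 _).1 h
    exact hδ.not_ge (Real.toNNReal_eq_zero.1 this)
  obtain ⟨N, hN⟩ := eventually_atTop.1 (hzero.eventually_lt_const hδψ)
  refine ⟨N, fun n hn => ?_⟩
  by_contra hcon
  push Not at hcon
  have h1 := (key n).trans_lt (hN n hn.le)
  have h2 : ψ δ.toNNReal ≤ ψ ‖x - c n‖₊ := by
    apply hmono
    rw [dist_comm, dist_eq_norm] at hcon
    exact Real.toNNReal_le_iff_le_coe.2 hcon
  exact absurd h1 (not_lt.2 (by gcongr))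

end UniformConvexity

end PrimalDual

namespace PrimalDual

/-! ### Inverses and square roots of strongly positive operators -/

section StronglyPositive

variable {H : Type*} [NormedAddCommGroup H] [InnerProductSpace ℝ H] [CompleteSpace H]

/-- Coercivity makes `V` invertible, so that `V.inverse` is the true inverse and not the default
value `0`. -/
theorem IsStronglyPositive.isUnit {V : H →L[ℝ] H} (hV : IsStronglyPositive V) : IsUnit V := by
  obtain ⟨-, χ, hχ, hpos⟩ := hV
  refine ContinuousLinearMap.isUnit_of_forall_le_norm_inner_map V (c := ⟨χ, hχ.le⟩) hχ fun x => ?_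
  change ‖x‖ ^ 2 * χ ≤ _
  rw [mul_comm]
  exact (hpos x).trans (le_abs_self _)

theorem IsStronglyPositive.apply_inverse {V : H →L[ℝ] H} (hV : IsStronglyPositive V) (x : H) :
    V (V.inverse x) = x := by
  have := Ring.mul_inverse_cancel V hV.isUnit
  rw [ContinuousLinearMap.ringInverse_eq_inverse] at this
  exact congrArg (fun T : H →L[ℝ] H => T x) this

theorem IsStronglyPositive.inverse_apply {V : H →L[ℝ] H} (hV : IsStronglyPositive V) (x : H) :
    V.inverse (V x) = x := by
  have := Ring.inverse_mul_cancel V hV.isUnit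
  rw [ContinuousLinearMap.ringInverse_eq_inverse] at this
  exact congrArg (fun T : H →L[ℝ] H => T x) this

theorem IsStronglyPositive.sqNorm_inverse {V : H →L[ℝ] H} (hV : IsStronglyPositive V) (x : H) :
    sqNorm V.inverse x = sqNorm V (V.inverse x) := by
  unfold sqNorm
  rw [hV.apply_inverse, real_inner_comm]

theorem IsStronglyPositive.sqNorm_nonneg {V : H →L[ℝ] H} (hV : IsStronglyPositive V) (x : H) :
    0 ≤ sqNorm V x := by
  obtain ⟨-, χ, hχ, hpos⟩ := hV
  exact (mul_nonneg hχ.le (by positivity)).trans (hpos x)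

theorem IsStronglyPositive.inverse {V : H →L[ℝ] H} (hV : IsStronglyPositive V) :
    IsStronglyPositive V.inverse := by
  have hV' := hV
  obtain ⟨hS, χ, hχ, hpos⟩ := hV'
  refine ⟨?_, χ / (‖V‖ + 1) ^ 2, by positivity, fun x => ?_⟩
  · rw [ContinuousLinearMap.isSelfAdjoint_iff_isSymmetric]
    intro x y
    have := inner_map_symm hS (V.inverse x) (V.inverse y)
    rw [hV.apply_inverse, hV.apply_inverse] at this
    exact this.symm
  · have h1 : ‖x‖ ≤ (‖V‖ + 1) * ‖V.inverse x‖ := by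
      calc ‖x‖ = ‖V (V.inverse x)‖ := by rw [hV.apply_inverse]
        _ ≤ ‖V‖ * ‖V.inverse x‖ := V.le_opNorm _
        _ ≤ _ := by gcongr; linarith
    have h2 : ‖x‖ ^ 2 ≤ (‖V‖ + 1) ^ 2 * ‖V.inverse x‖ ^ 2 := by
      rw [← mul_pow]; exact pow_le_pow_left₀ (norm_nonneg _) h1 2
    have h3 := hpos (V.inverse x)
    rw [hV.apply_inverse, real_inner_comm] at h3
    refine le_trans ?_ h3
    have h4 : (0 : ℝ) < (‖V‖ + 1) ^ 2 := by positivity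
    rw [div_mul_eq_mul_div, div_le_iff₀ h4]
    nlinarith

/-- If `‖X‖ < 1` and `X` is self-adjoint, then `Y = (X + Y²) / 2` has a self-adjoint solution. -/
theorem exists_selfAdjoint_fixedPoint {X : H →L[ℝ] H} (hX : IsSelfAdjoint X) (hX1 : ‖X‖ < 1) :
    ∃ Y : H →L[ℝ] H, IsSelfAdjoint Y ∧ ‖Y‖ < 1 ∧ (2 : ℝ) • Y = X + Y * Y := by
  set r := ‖X‖ with hr
  let S : Set (H →L[ℝ] H) := {Y | IsSelfAdjoint Y ∧ ‖Y‖ ≤ r}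
  have hSc : IsComplete S := by
    apply IsClosed.isComplete
    refine IsClosed.inter ?_ (isClosed_le continuous_norm continuous_const)
    exact isClosed_eq continuous_star continuous_id
  -- A fixed point satisfies `(1 - Y)² = 1 - X`. On the self-adjoint operators of norm at most `r =
  -- ‖X‖`, `F` is a self-map because `(r + r²) / 2 ≤ r`, and a contraction of ratio `r`.
  let F : (H →L[ℝ] H) → (H →L[ℝ] H) := fun Y => (1 / 2 : ℝ) • (X + Y * Y)
  have hmaps : Set.MapsTo F S S := by
    rintro Y ⟨hY1, hY2⟩
    refine ⟨?_, ?_⟩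
    · refine IsSelfAdjoint.smul (IsSelfAdjoint.all _) (hX.add ?_)
      rw [IsSelfAdjoint, star_mul, hY1.star_eq]
    · have h1 : ‖Y * Y‖ ≤ r * r := (norm_mul_le _ _).trans (by gcongr)
      have h0 : 0 ≤ r := norm_nonneg _
      calc ‖F Y‖ = 1 / 2 * ‖X + Y * Y‖ := by
            simp only [F, norm_smul]
            rw [Real.norm_of_nonneg (by norm_num)]
        _ ≤ 1 / 2 * (r + r * r) := by
            gcongr
            exact (norm_add_le _ _).trans (by gcongr)
        _ ≤ r := by nlinarith
  have hcontr : ContractingWith ⟨r, norm_nonneg _⟩ (hmaps.restrict F S S) := by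
    refine ⟨?_, LipschitzWith.of_dist_le_mul ?_⟩
    · exact hX1
    · rintro ⟨Y, hY1, hY2⟩ ⟨Y', hY1', hY2'⟩
      change dist (F Y) (F Y') ≤ r * dist Y Y'
      rw [dist_eq_norm, dist_eq_norm]
      have e : F Y - F Y' = (1 / 2 : ℝ) • (Y * (Y - Y') + (Y - Y') * Y') := by
        simp only [F, ← smul_sub]
        congr 1
        noncomm_ring
      rw [e, norm_smul, Real.norm_of_nonneg (by norm_num)]
      have h1 : ‖Y * (Y - Y')‖ ≤ r * ‖Y - Y'‖ := (norm_mul_le _ _).trans (by gcongr)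
      have h2 : ‖(Y - Y') * Y'‖ ≤ ‖Y - Y'‖ * r := (norm_mul_le _ _).trans (by gcongr)
      have h3 := norm_add_le (Y * (Y - Y')) ((Y - Y') * Y')
      linarith
  have h0 : (0 : H →L[ℝ] H) ∈ S := ⟨IsSelfAdjoint.zero _, by simp [hr]⟩
  obtain ⟨Y, hYS, hYf, -⟩ := ContractingWith.exists_fixedPoint' hSc hmaps hcontr h0 (edist_ne_top _ _)
  refine ⟨Y, hYS.1, hYS.2.trans_lt hX1, ?_⟩
  have h2 : (1 / 2 : ℝ) • (X + Y * Y) = Y := hYf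
  nth_rewrite 1 [← h2]
  rw [smul_smul]
  norm_num

theorem isPositive_of_symm {S : H →L[ℝ] H} (hS : IsSelfAdjoint S) (h : ∀ x, 0 ≤ inner ℝ (S x) x) :
    S.IsPositive := by
  rw [ContinuousLinearMap.isPositive_def']
  exact ⟨hS, fun x => h x⟩

/-- Strongly positive operators have a positive square root. -/
theorem IsStronglyPositive.exists_sqrt {V : H →L[ℝ] H} (hV : IsStronglyPositive V) :
    ∃ S : H →L[ℝ] H, S.IsPositive ∧ S ∘L S = V := by
  obtain ⟨hS, χ, hχ, hpos⟩ := hV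
  set M := ‖V‖ + 1 with hM
  have hM0 : 0 < M := by positivity
  -- With this scaling `‖x - c V x‖² ≤ (1 - 2 c χ + c² M²) ‖x‖² = (1 - c χ) ‖x‖²`, so `X = 1 - c V`
  -- has norm below `1`. Then `(1 - Y)² = c V`, and `(1 - Y) / √c` is the root; it is positive since
  -- `‖Y‖ < 1`.
  set c := χ / M ^ 2 with hc
  have hc0 : 0 < c := by positivity
  set X : H →L[ℝ] H := 1 - c • V with hX
  have hXs : IsSelfAdjoint X :=
    (IsSelfAdjoint.one _).sub (IsSelfAdjoint.smul (IsSelfAdjoint.all _) hS)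
  have hXn : ‖X‖ < 1 := by
    set k := Real.sqrt (1 - χ * c) with hk
    have hk1 : k < 1 := by
      rw [hk, Real.sqrt_lt' one_pos]
      nlinarith [mul_pos hχ hc0]
    have hk2 : 1 - χ * c ≤ k ^ 2 := by
      rcases le_or_gt 0 (1 - χ * c) with h | h
      · rw [hk, Real.sq_sqrt h]
      · exact h.le.trans (sq_nonneg _)
    refine lt_of_le_of_lt (X.opNorm_le_bound (Real.sqrt_nonneg _) fun x => ?_) hk1
    have hxx : X x = x - c • V x := rfl
    have h1 : ‖X x‖ ^ 2 ≤ (k * ‖x‖) ^ 2 := by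
      rw [hxx, norm_sub_sq_real, norm_smul, inner_smul_right, Real.norm_of_nonneg hc0.le,
        real_inner_comm]
      have h2 : ‖V x‖ ^ 2 ≤ M ^ 2 * ‖x‖ ^ 2 := by
        rw [← mul_pow]
        refine pow_le_pow_left₀ (norm_nonneg _) ((V.le_opNorm x).trans ?_) 2
        gcongr
        linarith
      have h3 := hpos x
      have h4 : c * M ^ 2 = χ := div_mul_cancel₀ _ (by positivity)
      have h5 := mul_le_mul_of_nonneg_left h2 (sq_nonneg c)
      have h6 := mul_le_mul_of_nonneg_left h3 hc0.le
      have h7 : c ^ 2 * (M ^ 2 * ‖x‖ ^ 2) = c * (χ * ‖x‖ ^ 2) := by rw [← h4]; ring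
      have h8 := mul_le_mul_of_nonneg_right hk2 (sq_nonneg ‖x‖)
      rw [mul_pow, mul_pow]
      nlinarith
    exact (sq_le_sq₀ (norm_nonneg _) (mul_nonneg (Real.sqrt_nonneg _) (norm_nonneg _))).1 h1
  obtain ⟨Y, hY1, hY2, hY3⟩ := exists_selfAdjoint_fixedPoint hXs hXn
  set d := (Real.sqrt c)⁻¹ with hd
  have hd0 : 0 ≤ d := by positivity
  have hdd : d * d * c = 1 := by
    rw [hd, ← mul_inv, Real.mul_self_sqrt hc0.le, inv_mul_cancel₀ hc0.ne']
  refine ⟨d • (1 - Y), isPositive_of_symm ?_ fun x => ?_, ?_⟩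
  · exact IsSelfAdjoint.smul (IsSelfAdjoint.all _) ((IsSelfAdjoint.one _).sub hY1)
  · have e : (d • (1 - Y)) x = d • (x - Y x) := rfl
    rw [e, inner_smul_left, inner_sub_left, real_inner_self_eq_norm_sq]
    apply mul_nonneg hd0
    have h1 := (real_inner_le_norm (Y x) x).trans
      (mul_le_mul_of_nonneg_right (Y.le_opNorm x) (norm_nonneg x))
    nlinarith [sq_nonneg ‖x‖]
  · have e1 : (1 - Y) * (1 - Y) = c • V := by
      have : (1 - Y) * (1 - Y) = 1 - (2 : ℝ) • Y + Y * Y := by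
        rw [two_smul]; noncomm_ring
      rw [this, hY3, hX]
      abel
    change (d • (1 - Y)) * (d • (1 - Y)) = V
    rw [smul_mul_smul_comm, e1, smul_smul, hdd, one_smul]

theorem IsStronglyPositive.opSqrt_spec {V : H →L[ℝ] H} (hV : IsStronglyPositive V) :
    (opSqrt V).IsPositive ∧ opSqrt V ∘L opSqrt V = V :=
  Classical.epsilon_spec hV.exists_sqrt

/-- The vector `√V V⁻¹ x` plays the role of `V^(-1/2) x`. -/
theorem IsStronglyPositive.exists_opSqrt_eq {V : H →L[ℝ] H} (hV : IsStronglyPositive V) (x : H) :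
    ∃ k, opSqrt V k = x ∧ ‖k‖ ^ 2 = sqNorm V.inverse x := by
  obtain ⟨h1, h2⟩ := hV.opSqrt_spec
  have h3 : ∀ y, opSqrt V (opSqrt V y) = V y := fun y => congrArg (fun T : H →L[ℝ] H => T y) h2
  refine ⟨opSqrt V (V.inverse x), by rw [h3, hV.apply_inverse], ?_⟩
  rw [← real_inner_self_eq_norm_sq, inner_map_symm h1.isSelfAdjoint, h3, hV.apply_inverse, sqNorm]

/-- Young's inequality for the pairing of `V` and `V⁻¹`. -/
theorem IsStronglyPositive.two_mul_inner_le {V : H →L[ℝ] H} (hV : IsStronglyPositive V) {t : ℝ}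
    (ht : 0 < t) (u x : H) : 2 * inner ℝ u x ≤ t⁻¹ * sqNorm V u + t * sqNorm V.inverse x := by
  have h1 := hV.sqNorm_nonneg (u - t • V.inverse x)
  rw [sqNorm_sub hV.1, sqNorm_smul, inner_smul_right, inner_map_symm hV.1, hV.apply_inverse,
    ← hV.sqNorm_inverse] at h1
  have h2 := mul_nonneg (inv_pos.2 ht).le h1
  have e : t⁻¹ * (sqNorm V u - 2 * (t * inner ℝ u x) + t ^ 2 * sqNorm V.inverse x)
      = t⁻¹ * sqNorm V u - 2 * (t⁻¹ * t) * inner ℝ u x + (t⁻¹ * t) * t * sqNorm V.inverse x := by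
    ring
  rw [e, inv_mul_cancel₀ ht.ne'] at h2
  linarith

end StronglyPositive

theorem inner_prod_eq {E₁ E₂ : Type*} [NormedAddCommGroup E₁] [InnerProductSpace ℝ E₁]
    [NormedAddCommGroup E₂] [InnerProductSpace ℝ E₂] (x y : WithLp 2 (E₁ × E₂)) :
    inner ℝ x y = inner ℝ x.fst y.fst + inner ℝ x.snd y.snd := rfl

/-! ### The primal-dual metric -/

section PrimalDualMetric

variable {E₁ : Type*} [NormedAddCommGroup E₁] [InnerProductSpace ℝ E₁] [CompleteSpace E₁]
  {E₂ : Type*} [NormedAddCommGroup E₂] [InnerProductSpace ℝ E₂] [CompleteSpace E₂]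

/-- The operator `(x, v) ↦ (V⁻¹ x - L* v, W⁻¹ v - L x)`. -/
noncomputable def primalDualMetric (V : E₁ →L[ℝ] E₁) (W : E₂ →L[ℝ] E₂) (L : E₁ →L[ℝ] E₂) :
    WithLp 2 (E₁ × E₂) →L[ℝ] WithLp 2 (E₁ × E₂) :=
  ((WithLp.prodContinuousLinearEquiv 2 ℝ E₁ E₂).symm : E₁ × E₂ →L[ℝ] WithLp 2 (E₁ × E₂)) ∘L
    ((V.inverse ∘L WithLp.fstL 2 ℝ E₁ E₂
        - ContinuousLinearMap.adjoint L ∘L WithLp.sndL 2 ℝ E₁ E₂).prod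
      (W.inverse ∘L WithLp.sndL 2 ℝ E₁ E₂ - L ∘L WithLp.fstL 2 ℝ E₁ E₂))

theorem primalDualMetric_fst (V : E₁ →L[ℝ] E₁) (W : E₂ →L[ℝ] E₂) (L : E₁ →L[ℝ] E₂)
    (h : WithLp 2 (E₁ × E₂)) : (primalDualMetric V W L h).fst
      = V.inverse h.fst - ContinuousLinearMap.adjoint L h.snd := rfl

theorem primalDualMetric_snd (V : E₁ →L[ℝ] E₁) (W : E₂ →L[ℝ] E₂) (L : E₁ →L[ℝ] E₂)
    (h : WithLp 2 (E₁ × E₂)) : (primalDualMetric V W L h).snd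
      = W.inverse h.snd - L h.fst := rfl

variable {V : E₁ →L[ℝ] E₁} {W : E₂ →L[ℝ] E₂} {L : E₁ →L[ℝ] E₂}

theorem sqNorm_primalDualMetric (h : WithLp 2 (E₁ × E₂)) :
    sqNorm (primalDualMetric V W L) h
      = sqNorm V.inverse h.fst + sqNorm W.inverse h.snd - 2 * inner ℝ (L h.fst) h.snd := by
  unfold sqNorm
  rw [inner_prod_eq, primalDualMetric_fst, primalDualMetric_snd, inner_sub_left, inner_sub_left,
    ContinuousLinearMap.adjoint_inner_left, real_inner_comm (L h.fst)]
  ring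

theorem isSelfAdjoint_primalDualMetric (hV : IsStronglyPositive V) (hW : IsStronglyPositive W) :
    IsSelfAdjoint (primalDualMetric V W L) := by
  rw [ContinuousLinearMap.isSelfAdjoint_iff_isSymmetric]
  intro x y
  change inner ℝ (primalDualMetric V W L x) y = inner ℝ x (primalDualMetric V W L y)
  rw [inner_prod_eq, inner_prod_eq, primalDualMetric_fst, primalDualMetric_snd,
    primalDualMetric_fst, primalDualMetric_snd, inner_sub_left, inner_sub_left, inner_sub_right,
    inner_sub_right, ContinuousLinearMap.adjoint_inner_left, ContinuousLinearMap.adjoint_inner_right,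
    inner_map_symm hV.inverse.1, inner_map_symm hW.inverse.1]
  ring

/-- Substituting `x = √V k` and `v = √W l` turns the coupling into `⟪T k, l⟫` with `T = √W L √V`, to
which Young's inequality applies. The weight is `s = 1` for strong positivity of the metric and is
tuned to the constants for cocoercivity. -/
theorem two_mul_abs_inner_le (hV : IsStronglyPositive V) (hW : IsStronglyPositive W) {s : ℝ}
    (hs : 0 < s) (x : E₁) (v : E₂) :
    2 * |inner ℝ (L x) v| ≤ ‖opSqrt W ∘L L ∘L opSqrt V‖
      * (s * sqNorm V.inverse x + s⁻¹ * sqNorm W.inverse v) := by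
  obtain ⟨k, hk, hk2⟩ := hV.exists_opSqrt_eq x
  obtain ⟨l, hl, hl2⟩ := hW.exists_opSqrt_eq v
  have h1 : inner ℝ (L x) v = inner ℝ ((opSqrt W ∘L L ∘L opSqrt V) k) l := by
    rw [← hl, ← hk]
    exact (inner_map_symm hW.opSqrt_spec.1.isSelfAdjoint _ _).symm
  rw [← hk2, ← hl2, h1]
  set T := opSqrt W ∘L L ∘L opSqrt V
  have h2 : |inner ℝ (T k) l| ≤ ‖T‖ * (‖k‖ * ‖l‖) := by
    refine (abs_real_inner_le_norm _ _).trans ?_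
    rw [← mul_assoc]
    exact mul_le_mul_of_nonneg_right (T.le_opNorm k) (norm_nonneg _)
  have h3 : 2 * (‖k‖ * ‖l‖) ≤ s * ‖k‖ ^ 2 + s⁻¹ * ‖l‖ ^ 2 := by
    have := mul_nonneg (inv_pos.2 hs).le (sq_nonneg (s * ‖k‖ - ‖l‖))
    have e : s⁻¹ * (s * ‖k‖ - ‖l‖) ^ 2
        = (s⁻¹ * s) * s * ‖k‖ ^ 2 - 2 * (s⁻¹ * s) * (‖k‖ * ‖l‖) + s⁻¹ * ‖l‖ ^ 2 := by ring
    rw [e, inv_mul_cancel₀ hs.ne'] at this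
    linarith
  have h4 := mul_le_mul_of_nonneg_left h3 (norm_nonneg T)
  linarith

theorem isStronglyPositive_primalDualMetric (hV : IsStronglyPositive V)
    (hW : IsStronglyPositive W) (hρ : ‖opSqrt W ∘L L ∘L opSqrt V‖ < 1) :
    IsStronglyPositive (primalDualMetric V W L) := by
  obtain ⟨-, χ₁, hχ₁, hp₁⟩ := hV.inverse
  obtain ⟨-, χ₂, hχ₂, hp₂⟩ := hW.inverse
  refine ⟨isSelfAdjoint_primalDualMetric hV hW,
    (1 - ‖opSqrt W ∘L L ∘L opSqrt V‖) * min χ₁ χ₂,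
    mul_pos (by linarith) (lt_min hχ₁ hχ₂), fun h => ?_⟩
  change _ ≤ sqNorm (primalDualMetric V W L) h
  rw [sqNorm_primalDualMetric, WithLp.prod_norm_sq_eq_of_L2]
  have h1 := two_mul_abs_inner_le (L := L) hV hW one_pos h.fst h.snd
  set ρ := ‖opSqrt W ∘L L ∘L opSqrt V‖
  have h2 : min χ₁ χ₂ * ‖h.fst‖ ^ 2 ≤ sqNorm V.inverse h.fst :=
    (mul_le_mul_of_nonneg_right (min_le_left _ _) (by positivity)).trans (hp₁ _)
  have h3 : min χ₁ χ₂ * ‖h.snd‖ ^ 2 ≤ sqNorm W.inverse h.snd :=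
    (mul_le_mul_of_nonneg_right (min_le_right _ _) (by positivity)).trans (hp₂ _)
  have h4 := mul_le_mul_of_nonneg_left (add_le_add h2 h3) (sub_nonneg.2 hρ.le)
  have h5 := le_abs_self (inner ℝ (L h.fst) h.snd)
  rw [inv_one, one_mul, one_mul] at h1
  linarith

/-- Upper bound for the norm dual to that of `primalDualMetric`. -/
theorem sqNorm_inverse_primalDualMetric_le (hV : IsStronglyPositive V) (hW : IsStronglyPositive W)
    {ρ : ℝ} (hρ : ‖opSqrt W ∘L L ∘L opSqrt V‖ = ρ) (hρ1 : ρ < 1) {s : ℝ} (hs : 0 < s)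
    (hs1 : ρ * s < 1) (hs2 : ρ * s⁻¹ < 1) (u : WithLp 2 (E₁ × E₂)) :
    sqNorm (primalDualMetric V W L).inverse u
      ≤ (1 - ρ * s)⁻¹ * sqNorm V u.fst + (1 - ρ * s⁻¹)⁻¹ * sqNorm W u.snd := by
  have hU := isStronglyPositive_primalDualMetric (L := L) hV hW (hρ ▸ hρ1)
  set h := (primalDualMetric V W L).inverse u with hh
  -- The dual norm is written in the variational form `2 ⟪u, h⟫ - ‖h‖_U²` with `h = U⁻¹ u`. The
  -- coupling in `‖h‖_U²` leaves the weights `1 - ρ s` and `1 - ρ s⁻¹`, and Young's inequality with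
  -- these weights removes `h`.
  have h1 : sqNorm (primalDualMetric V W L).inverse u
      = 2 * inner ℝ u h - sqNorm (primalDualMetric V W L) h := by
    rw [hU.sqNorm_inverse, ← hh]
    have : sqNorm (primalDualMetric V W L) h = inner ℝ u h := by
      rw [sqNorm, hh, hU.apply_inverse]
    linarith
  have h2 := two_mul_abs_inner_le (L := L) hV hW hs h.fst h.snd
  rw [hρ] at h2
  have h3 := le_abs_self (inner ℝ (L h.fst) h.snd)
  have h4 := hV.two_mul_inner_le (sub_pos.2 hs1) u.fst h.fst
  have h5 := hW.two_mul_inner_le (sub_pos.2 hs2) u.snd h.snd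
  rw [h1, inner_prod_eq, sqNorm_primalDualMetric]
  linarith

end PrimalDualMetric

/-! ### The constant `β̂` -/

section Constants

theorem xiHat_pos {ν μ ρ : ℝ} (hν : 0 < ν) (hμ : 0 < μ) (hρ : 0 < ρ) : 0 < xiHat ν μ ρ := by
  unfold xiHat
  apply div_pos _ (by positivity)
  have h1 : 0 < 4 * ρ ^ 2 * ν * μ := by positivity
  have h2 : |μ - ν| < Real.sqrt ((μ - ν) ^ 2 + 4 * ρ ^ 2 * ν * μ) := by
    apply Real.lt_sqrt_of_sq_lt
    rw [sq_abs]
    linarith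
  linarith [le_abs_self (μ - ν)]

/-- The choice `s = (ξ + ρ) / (1 + ξ ρ)` gives `1 - ρ s = (1 - ρ²) / (1 + ξ ρ)` and `1 - ρ s⁻¹ = (1
- ρ²) / (1 + ξ⁻¹ ρ)`, so the last two bounds are the two entries of the minimum defining `β_ξ`. Of
`ξ = ξ̂` only positivity matters. The bound `ρ < 1` is forced by `β_ξ > 0`. -/
theorem exists_scaling_of_half_lt_betaXi {ν μ ρ : ℝ} (hν : 0 < ν) (hμ : 0 < μ) (hρ : 0 ≤ ρ)
    (hβ : 1 / 2 < betaXi ν μ ρ (xiHat ν μ ρ)) :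
    ρ < 1 ∧ ∃ s : ℝ, 0 < s ∧ ρ * s < 1 ∧ ρ * s⁻¹ < 1 ∧
      betaXi ν μ ρ (xiHat ν μ ρ) * (1 - ρ * s)⁻¹ ≤ ν ∧
      betaXi ν μ ρ (xiHat ν μ ρ) * (1 - ρ * s⁻¹)⁻¹ ≤ μ := by
  rcases hρ.eq_or_lt with h0 | hρ0
  -- For `ρ = 0` the default value of `xiHat` is harmless: `ξ` enters `betaXi` only through products
  -- with `ρ`.
  · refine ⟨by rw [← h0]; norm_num, 1, one_pos, ?_⟩
    rw [← h0]
    simp [betaXi]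
  set ξ := xiHat ν μ ρ with hξ
  have hξ0 : 0 < ξ := xiHat_pos hν hμ hρ0
  set a := 1 + ξ * ρ with ha
  set b := 1 + ξ⁻¹ * ρ with hb
  have ha0 : 0 < a := by positivity
  have hb0 : 0 < b := by positivity
  have hmin : 0 < min (ν * a⁻¹) (μ * b⁻¹) := lt_min (by positivity) (by positivity)
  have hbeta : betaXi ν μ ρ ξ = (1 - ρ ^ 2) * min (ν * a⁻¹) (μ * b⁻¹) := rfl
  have hpos : 0 < 1 - ρ ^ 2 := by
    by_contra hcon
    push Not at hcon
    rw [hbeta] at hβ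
    nlinarith
  have hρ1 : ρ < 1 := by nlinarith
  have e1 : 1 - ρ * ((ξ + ρ) / a) = (1 - ρ ^ 2) / a := by
    rw [eq_div_iff ha0.ne', sub_mul, mul_assoc, div_mul_cancel₀ _ ha0.ne', ha]; ring
  have e2 : 1 - ρ * ((ξ + ρ) / a)⁻¹ = (1 - ρ ^ 2) / b := by
    have h1 : ξ + ρ = ξ * b := by
      rw [hb, mul_add, ← mul_assoc, mul_inv_cancel₀ hξ0.ne']; ring
    rw [inv_div, h1, eq_div_iff hb0.ne', sub_mul]
    have h2 : ρ * (a / (ξ * b)) * b = ρ * (ξ⁻¹ * a) := by field_simp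
    rw [h2, ha, hb]
    field_simp
    ring
  refine ⟨hρ1, (ξ + ρ) / a, by positivity, ?_, ?_, ?_, ?_⟩
  · have : 0 < (1 - ρ ^ 2) / a := by positivity
    linarith
  · have : 0 < (1 - ρ ^ 2) / b := by positivity
    linarith
  · rw [e1, hbeta, inv_div]
    calc (1 - ρ ^ 2) * min (ν * a⁻¹) (μ * b⁻¹) * (a / (1 - ρ ^ 2))
        ≤ (1 - ρ ^ 2) * (ν * a⁻¹) * (a / (1 - ρ ^ 2)) := by
          gcongr
          exact min_le_left _ _
      _ = ν := by field_simp
  · rw [e2, hbeta, inv_div]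
    calc (1 - ρ ^ 2) * min (ν * a⁻¹) (μ * b⁻¹) * (b / (1 - ρ ^ 2))
        ≤ (1 - ρ ^ 2) * (μ * b⁻¹) * (b / (1 - ρ ^ 2)) := by
          gcongr
          exact min_le_right _ _
      _ = μ := by field_simp

end Constants

end PrimalDual

namespace PrimalDual

theorem infConv_le_of_eq_coe {H : Type*} [NormedAddCommGroup H] {f g : H → EReal} {x y : H} {r t : ℝ}
    (hx : f x = r) (hy : g y = t) :
    infConv f g (x + y) ≤ ((r + t : ℝ) : EReal) := by
  refine (iInf_le _ x).trans ?_
  rw [add_sub_cancel_left, hx, hy, EReal.coe_add]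

/-! ### Infimal convolutions and common subgradients -/

section InfConv

variable {H : Type*} [NormedAddCommGroup H] [InnerProductSpace ℝ H]

theorem coe_le_of_mem_subdifferential {f : H → EReal} {x u : H} {r : ℝ} (hx : f x = r)
    (hu : u ∈ subdifferential f x) (y : H) : ((inner ℝ (y - x) u + r : ℝ) : EReal) ≤ f y := by
  have := hu y
  rwa [hx, ← EReal.coe_add] at this

/-- For each splitting `w = a + (w - a)` the two subgradient inequalities add up to a bound free of
`a`. Together with `infConv_le_of_eq_coe` it shows that the infimum at `x + y` is attained by `(x,
y)`; both the primal and the dual objective use this. -/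
theorem le_infConv_of_mem_subdifferential {f g : H → EReal} {x y u : H} {r t : ℝ} (hx : f x = r)
    (hy : g y = t) (hu : u ∈ subdifferential f x) (hu' : u ∈ subdifferential g y) (w : H) :
    ((inner ℝ (w - (x + y)) u + (r + t) : ℝ) : EReal) ≤ infConv f g w := by
  refine le_iInf fun a => ?_
  refine le_trans ?_ (add_le_add (coe_le_of_mem_subdifferential hx hu a)
    (coe_le_of_mem_subdifferential hy hu' (w - a)))
  rw [← EReal.coe_add, EReal.coe_le_coe_iff]
  have e : w - (x + y) = (a - x) + (w - a - y) := by abel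
  rw [e, inner_add_left]
  linarith

end InfConv

theorem coe_finsetSum_ereal {ι : Type*} (s : Finset ι) (f : ι → ℝ) :
    ((∑ i ∈ s, f i : ℝ) : EReal) = ∑ i ∈ s, (f i : EReal) := by
  classical
  induction s using Finset.induction_on with
  | empty => simp
  | insert a s ha ih => rw [Finset.sum_insert ha, Finset.sum_insert ha, EReal.coe_add, ih]

/-! ### The Kuhn-Tucker operator on the product space -/

section Blocks

variable {m s : ℕ}
variable {K : Fin m → Type*} [∀ i, NormedAddCommGroup (K i)] [∀ i, InnerProductSpace ℝ (K i)]
variable {G : Fin s → Type*} [∀ k, NormedAddCommGroup (G k)] [∀ k, InnerProductSpace ℝ (G k)]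

theorem blockOp_apply (L : ∀ k i, K i →L[ℝ] G k) (x : PiLp 2 K) (k : Fin s) :
    blockOp L x k = ∑ i, L k i (x i) := by
  simp [blockOp]

theorem diagOp_apply (V : ∀ i, K i →L[ℝ] K i) (x : PiLp 2 K) (i : Fin m) :
    diagOp V x i = V i (x i) := rfl

theorem adjoint_blockOp_apply [∀ i, CompleteSpace (K i)] [∀ k, CompleteSpace (G k)]
    (L : ∀ k i, K i →L[ℝ] G k) (v : PiLp 2 G) (i : Fin m) :
    ContinuousLinearMap.adjoint (blockOp L) v i
      = ∑ k, ContinuousLinearMap.adjoint (L k i) (v k) := by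
  have : ContinuousLinearMap.adjoint (blockOp L) v
      = WithLp.toLp 2 fun i => ∑ k, ContinuousLinearMap.adjoint (L k i) (v k) := by
    refine ext_inner_right ℝ fun x => ?_
    rw [ContinuousLinearMap.adjoint_inner_left, PiLp.inner_apply, PiLp.inner_apply]
    simp only [blockOp_apply, inner_sum, sum_inner, ContinuousLinearMap.adjoint_inner_left]
    exact Finset.sum_comm
  rw [this]

theorem sqNorm_diagOp (V : ∀ i, K i →L[ℝ] K i) (x : PiLp 2 K) :
    sqNorm (diagOp V) x = ∑ i, sqNorm (V i) (x i) := by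
  unfold sqNorm
  rw [PiLp.inner_apply]
  rfl

theorem isStronglyPositive_diagOp [∀ i, CompleteSpace (K i)] {V : ∀ i, K i →L[ℝ] K i}
    (hV : ∀ i, IsStronglyPositive (V i)) : IsStronglyPositive (diagOp V) := by
  choose hS χ hχ hpos using hV
  -- Any sufficiently small `c > 0` serves; arguing near `0` also covers an empty index set, where a
  -- minimum is not available.
  obtain ⟨c, hc, hc0⟩ : ∃ c, (∀ i, c ≤ χ i) ∧ 0 < c := by
    have h1 : ∀ᶠ c in 𝓝[>] (0 : ℝ), ∀ i, c ≤ χ i :=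
      eventually_all.2 fun i => by
        filter_upwards [Ioc_mem_nhdsGT (hχ i)] with c hc using hc.2
    exact (h1.and self_mem_nhdsWithin).exists
  refine ⟨?_, c, hc0, fun x => ?_⟩
  · rw [ContinuousLinearMap.isSelfAdjoint_iff_isSymmetric]
    intro x y
    change inner ℝ (diagOp V x) y = inner ℝ x (diagOp V y)
    rw [PiLp.inner_apply, PiLp.inner_apply]
    exact Finset.sum_congr rfl fun i _ => inner_map_symm (hS i) _ _
  · change _ ≤ sqNorm (diagOp V) x
    rw [sqNorm_diagOp, PiLp.norm_sq_eq_of_L2, Finset.mul_sum]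
    refine Finset.sum_le_sum fun i _ => ?_
    exact (mul_le_mul_of_nonneg_right (hc i) (by positivity)).trans (hpos i _)

theorem inverse_diagOp_apply [∀ i, CompleteSpace (K i)] {V : ∀ i, K i →L[ℝ] K i}
    (hV : ∀ i, IsStronglyPositive (V i)) (x : PiLp 2 K) (i : Fin m) :
    (diagOp V).inverse x i = (V i).inverse (x i) := by
  have h1 := (isStronglyPositive_diagOp hV).apply_inverse x
  have h2 : V i ((diagOp V).inverse x i) = x i := by
    rw [← diagOp_apply, h1]
  rw [← h2, (hV i).inverse_apply]

/-- The subdifferential of a separable sum. -/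
def blockSubdifferential (f : ∀ i, K i → EReal) (x : PiLp 2 K) : Set (PiLp 2 K) :=
  {u | ∀ i, u i ∈ subdifferential (f i) (x i)}

theorem blockSubdifferential_monotone {f : ∀ i, K i → EReal} (hf : ∀ i, IsGammaZero (f i))
    {x y u v : PiLp 2 K} (hu : u ∈ blockSubdifferential f x) (hv : v ∈ blockSubdifferential f y) :
    0 ≤ inner ℝ (x - y) (u - v) := by
  rw [PiLp.inner_apply]
  exact Finset.sum_nonneg fun i _ => (hf i).inner_sub_nonneg (hu i) (hv i)

theorem mem_subdifferential_sum {f : ∀ i, K i → EReal} {x u : PiLp 2 K} {r : Fin m → ℝ}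
    (hx : ∀ i, f i (x i) = r i) (hu : u ∈ blockSubdifferential f x) :
    u ∈ subdifferential (fun y : PiLp 2 K => ∑ i, f i (y i)) x := by
  intro y
  simp only [hx]
  rw [← coe_finsetSum_ereal, ← EReal.coe_add, PiLp.inner_apply, ← Finset.sum_add_distrib,
    coe_finsetSum_ereal]
  exact Finset.sum_le_sum fun i _ => coe_le_of_mem_subdifferential (hx i) (hu i) (y i)

variable [∀ i, CompleteSpace (K i)] [∀ k, CompleteSpace (G k)]

/-- The set-valued part of the primal-dual optimality system. -/
def kktOp (f : ∀ i, K i → EReal) (z : ∀ i, K i) (g : ∀ k, G k → EReal) (r : ∀ k, G k)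
    (L : ∀ k i, K i →L[ℝ] G k) (h : WithLp 2 (PiLp 2 K × PiLp 2 G)) :
    Set (WithLp 2 (PiLp 2 K × PiLp 2 G)) :=
  {u | u.fst - ContinuousLinearMap.adjoint (blockOp L) h.snd + WithLp.toLp 2 z
        ∈ blockSubdifferential f h.fst ∧
      u.snd + blockOp L h.fst - WithLp.toLp 2 r
        ∈ blockSubdifferential (fun k => conjugate (g k)) h.snd}

/-- The single-valued part of the primal-dual optimality system. -/
noncomputable def kktGrad (φ : PiLp 2 K → ℝ) (ℓ : ∀ k, G k → EReal)
    (h : WithLp 2 (PiLp 2 K × PiLp 2 G)) : WithLp 2 (PiLp 2 K × PiLp 2 G) :=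
  WithLp.toLp 2 (gradient φ h.fst, WithLp.toLp 2 fun k => gradConj (ℓ k) (h.snd k))

/-- The primal half of the resolvent step. -/
noncomputable def primalStep (f : ∀ i, K i → EReal) (z : ∀ i, K i) (V : ∀ i, K i →L[ℝ] K i)
    (x : PiLp 2 K) : PiLp 2 K :=
  WithLp.toLp 2 fun i => prox (f i) (V i).inverse (V i (x i + z i))

/-- The dual half of the resolvent step, given the result `p` of the primal half. -/
noncomputable def dualStep (g : ∀ k, G k → EReal) (r : ∀ k, G k) (L : ∀ k i, K i →L[ℝ] G k)
    (W : ∀ k, G k →L[ℝ] G k) (p : PiLp 2 K) (v : PiLp 2 G) : PiLp 2 G :=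
  WithLp.toLp 2 fun k => prox (conjugate (g k)) (W k).inverse
    (W k (v k + (2 : ℝ) • blockOp L p k - r k))

/-- The resolvent of `kktOp` in the primal-dual metric. -/
noncomputable def kktResolvent (f : ∀ i, K i → EReal) (z : ∀ i, K i) (g : ∀ k, G k → EReal)
    (r : ∀ k, G k) (L : ∀ k i, K i →L[ℝ] G k) (V : ∀ i, K i →L[ℝ] K i) (W : ∀ k, G k →L[ℝ] G k)
    (h : WithLp 2 (PiLp 2 K × PiLp 2 G)) : WithLp 2 (PiLp 2 K × PiLp 2 G) :=
  WithLp.toLp 2 (primalStep f z V h.fst, dualStep g r L W (primalStep f z V h.fst) h.snd)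

/-- The coupling `(x, v) ↦ (L* v, -L x)` is skew, so it drops out and only the monotone
subdifferentials remain. -/
theorem kktOp_monotone {f : ∀ i, K i → EReal} (hf : ∀ i, IsGammaZero (f i)) {z : ∀ i, K i}
    {g : ∀ k, G k → EReal} (hg : ∀ k, IsGammaZero (g k)) {r : ∀ k, G k}
    {L : ∀ k i, K i →L[ℝ] G k} {x y u v : WithLp 2 (PiLp 2 K × PiLp 2 G)}
    (hu : u ∈ kktOp f z g r L x) (hv : v ∈ kktOp f z g r L y) : 0 ≤ inner ℝ (x - y) (u - v) := by
  have h1 := blockSubdifferential_monotone hf hu.1 hv.1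
  have h2 := blockSubdifferential_monotone (fun k => (hg k).conjugate) hu.2 hv.2
  have e1 : u.fst - ContinuousLinearMap.adjoint (blockOp L) x.snd + WithLp.toLp 2 z
      - (v.fst - ContinuousLinearMap.adjoint (blockOp L) y.snd + WithLp.toLp 2 z)
      = (u.fst - v.fst) - ContinuousLinearMap.adjoint (blockOp L) (x.snd - y.snd) := by
    rw [map_sub]; abel
  have e2 : u.snd + blockOp L x.fst - WithLp.toLp 2 r - (v.snd + blockOp L y.fst - WithLp.toLp 2 r)
      = (u.snd - v.snd) + blockOp L (x.fst - y.fst) := by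
    rw [map_sub]; abel
  rw [e1, inner_sub_right, ContinuousLinearMap.adjoint_inner_right] at h1
  rw [e2, inner_add_right, real_inner_comm (blockOp L (x.fst - y.fst))] at h2
  rw [inner_prod_eq, WithLp.sub_fst, WithLp.sub_snd, WithLp.sub_fst, WithLp.sub_snd]
  linarith

/-- In the primal row of `U + A` the terms `-L* v` and `L* v` cancel, so `p` is found without `q`.
In the dual row the two terms `-L x` add up, which is why the dual step uses `2 L p`. -/
theorem kktResolvent_mem {f : ∀ i, K i → EReal} (hf : ∀ i, IsGammaZero (f i)) {z : ∀ i, K i}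
    {g : ∀ k, G k → EReal} (hg : ∀ k, IsGammaZero (g k)) {r : ∀ k, G k}
    {L : ∀ k i, K i →L[ℝ] G k} {V : ∀ i, K i →L[ℝ] K i} (hV : ∀ i, IsStronglyPositive (V i))
    {W : ∀ k, G k →L[ℝ] G k} (hW : ∀ k, IsStronglyPositive (W k))
    (h : WithLp 2 (PiLp 2 K × PiLp 2 G)) :
    h - primalDualMetric (diagOp V) (diagOp W) (blockOp L) (kktResolvent f z g r L V W h)
      ∈ kktOp f z g r L (kktResolvent f z g r L V W h) := by
  set p := primalStep f z V h.fst with hp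
  set q := dualStep g r L W p h.snd with hq
  have h1 : (kktResolvent f z g r L V W h).fst = p := rfl
  have h2 : (kktResolvent f z g r L V W h).snd = q := rfl
  refine ⟨?_, ?_⟩
  · rw [WithLp.sub_fst, primalDualMetric_fst, h1, h2]
    intro i
    have := map_sub_prox_mem_subdifferential (hf i) (hV i).inverse (V i (h.fst i + z i))
    have e : (h.fst - ((diagOp V).inverse p - ContinuousLinearMap.adjoint (blockOp L) q)
        - ContinuousLinearMap.adjoint (blockOp L) q + WithLp.toLp 2 z) i
        = (V i).inverse (V i (h.fst i + z i) - p i) := by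
      rw [map_sub, (hV i).inverse_apply, ← inverse_diagOp_apply hV]
      simp only [PiLp.add_apply, PiLp.sub_apply]
      abel
    rw [e]
    exact this
  · rw [WithLp.sub_snd, primalDualMetric_snd, h1, h2]
    intro k
    have := map_sub_prox_mem_subdifferential (hg k).conjugate (hW k).inverse
      (W k (h.snd k + (2 : ℝ) • blockOp L p k - r k))
    have e : (h.snd - ((diagOp W).inverse q - blockOp L p) + blockOp L p - WithLp.toLp 2 r) k
        = (W k).inverse (W k (h.snd k + (2 : ℝ) • blockOp L p k - r k) - q k) := by
      rw [map_sub, (hW k).inverse_apply, ← inverse_diagOp_apply hW, two_smul]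
      simp only [PiLp.add_apply, PiLp.sub_apply]
      abel
    rw [e]
    exact this

/-- Cocoercivity with constant `β̂`: the dual norm of `U` is bounded by the norms of `V` and `W`
with weights `(1 - ρ t)⁻¹` and `(1 - ρ t⁻¹)⁻¹`, and `t` is such that `β̂` times these weights is at
most `ν₀` and `μ₀`. -/
theorem exists_isForwardBackward_kkt {f : ∀ i, K i → EReal} (hf : ∀ i, IsGammaZero (f i))
    {z : ∀ i, K i} {g : ∀ k, G k → EReal} (hg : ∀ k, IsGammaZero (g k)) {r : ∀ k, G k}
    {L : ∀ k i, K i →L[ℝ] G k} {V : ∀ i, K i →L[ℝ] K i} (hV : ∀ i, IsStronglyPositive (V i))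
    {W : ∀ k, G k →L[ℝ] G k} (hW : ∀ k, IsStronglyPositive (W k)) {φ : PiLp 2 K → ℝ}
    {ℓ : ∀ k, G k → EReal} {ν₀ μ₀ : ℝ} (hν₀ : 0 < ν₀) (hμ₀ : 0 < μ₀)
    (hφcoco : ∀ x y : PiLp 2 K,
      ν₀ * ∑ i, sqNorm (V i) (gradient φ x i - gradient φ y i)
        ≤ ∑ i, inner ℝ (x i - y i) (gradient φ x i - gradient φ y i))
    (hℓcoco : ∀ v w : PiLp 2 G,
      μ₀ * ∑ k, sqNorm (W k) (gradConj (ℓ k) (v k) - gradConj (ℓ k) (w k))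
        ≤ ∑ k, inner ℝ (v k - w k) (gradConj (ℓ k) (v k) - gradConj (ℓ k) (w k)))
    (hβ : 1 / 2 < betaHat ν₀ μ₀ L V W) :
    ∃ χ : ℝ, IsForwardBackward (primalDualMetric (diagOp V) (diagOp W) (blockOp L))
      (primalDualMetric (diagOp V) (diagOp W) (blockOp L)).inverse (kktOp f z g r L)
      (kktResolvent f z g r L V W) (kktGrad φ ℓ) χ (betaHat ν₀ μ₀ L V W) := by
  obtain ⟨hρ1, t, ht, ht1, ht2, ht3, ht4⟩ :=
    exists_scaling_of_half_lt_betaXi hν₀ hμ₀ (norm_nonneg _) hβ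
  have hdV := isStronglyPositive_diagOp hV
  have hdW := isStronglyPositive_diagOp hW
  have hU := isStronglyPositive_primalDualMetric (L := blockOp L) hdV hdW hρ1
  obtain ⟨χ, hχ, hpos⟩ := hU.2
  refine ⟨χ, hU.1, hχ, hpos, hU.apply_inverse, fun x y u v => kktOp_monotone hf hg,
    kktResolvent_mem hf hg hV hW, hβ, fun x y => ?_⟩
  have h1 := sqNorm_inverse_primalDualMetric_le (L := blockOp L) hdV hdW rfl hρ1 ht ht1 ht2
    (kktGrad φ ℓ x - kktGrad φ ℓ y)
  have hβ0 : 0 ≤ betaHat ν₀ μ₀ L V W := by linarith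
  have h2 := mul_le_mul_of_nonneg_left h1 hβ0
  have h3 : ν₀ * sqNorm (diagOp V) (kktGrad φ ℓ x - kktGrad φ ℓ y).fst
      ≤ inner ℝ (x - y).fst (kktGrad φ ℓ x - kktGrad φ ℓ y).fst := by
    rw [sqNorm_diagOp, PiLp.inner_apply]
    exact hφcoco x.fst y.fst
  have h4 : μ₀ * sqNorm (diagOp W) (kktGrad φ ℓ x - kktGrad φ ℓ y).snd
      ≤ inner ℝ (x - y).snd (kktGrad φ ℓ x - kktGrad φ ℓ y).snd := by
    rw [sqNorm_diagOp, PiLp.inner_apply]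
    exact hℓcoco x.snd y.snd
  have h5 := mul_le_mul_of_nonneg_right ht3
    (hdV.sqNorm_nonneg (kktGrad φ ℓ x - kktGrad φ ℓ y).fst)
  have h6 := mul_le_mul_of_nonneg_right ht4
    (hdW.sqNorm_nonneg (kktGrad φ ℓ x - kktGrad φ ℓ y).snd)
  rw [inner_prod_eq]
  refine h2.trans ?_
  unfold betaHat rhoNorm at *
  linarith

/-- Unfolding the parallel sum splits `L x' - r` as `y₁ + y₂` with `v' ∈ ∂ℓ y₁` and `v' ∈ ∂g y₂`.
Strong convexity of `ℓ` identifies `y₁` with `∇ℓ* v'`, and `y₂ ∈ ∂g* v'`. -/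
theorem exists_kkt_zero {f : ∀ i, K i → EReal} {z : ∀ i, K i} {r : ∀ k, G k}
    {ℓ : ∀ k, G k → EReal} (hℓ : ∀ k, IsGammaZero (ℓ k)) (hℓsc : ∀ k, IsStronglyConvex (ℓ k))
    {g : ∀ k, G k → EReal} (hg : ∀ k, IsGammaZero (g k)) {L : ∀ k i, K i →L[ℝ] G k}
    {φ : PiLp 2 K → ℝ}
    (hqual : ∃ (x' : PiLp 2 K) (v' : PiLp 2 G),
      (∀ k, v' k ∈ parallelSum (subdifferential (ℓ k)) (subdifferential (g k))
        ((∑ j, L k j (x' j)) - r k)) ∧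
      ∀ i, ∃ u ∈ subdifferential (f i) (x' i),
        z i = u + (∑ k, ContinuousLinearMap.adjoint (L k i) (v' k)) + gradient φ x' i) :
    ∃ h : WithLp 2 (PiLp 2 K × PiLp 2 G), -kktGrad φ ℓ h ∈ kktOp f z g r L h := by
  obtain ⟨x, v, hv, hx⟩ := hqual
  refine ⟨WithLp.toLp 2 (x, v), fun i => ?_, fun k => ?_⟩
  · obtain ⟨u, hu, hz⟩ := hx i
    have e : ((-kktGrad φ ℓ (WithLp.toLp 2 (x, v))).fst
        - ContinuousLinearMap.adjoint (blockOp L) v + WithLp.toLp 2 z) i = u := by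
      have e1 : (-kktGrad φ ℓ (WithLp.toLp 2 (x, v))).fst i = -gradient φ x i := rfl
      rw [PiLp.add_apply, PiLp.sub_apply, e1, adjoint_blockOp_apply]
      change _ + z i = u
      rw [hz]
      abel
    change ((-kktGrad φ ℓ (WithLp.toLp 2 (x, v))).fst
        - ContinuousLinearMap.adjoint (blockOp L) v + WithLp.toLp 2 z) i ∈ _
    rw [e]
    exact hu
  · obtain ⟨y₁, hy₁, y₂, hy₂, hy⟩ := Set.mem_add.1 (show (∑ j, L k j (x j)) - r k
      ∈ setInv (subdifferential (ℓ k)) (v k) + setInv (subdifferential (g k)) (v k) from hv k)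
    have e : ((-kktGrad φ ℓ (WithLp.toLp 2 (x, v))).snd + blockOp L x - WithLp.toLp 2 r) k
        = y₂ := by
      have e1 : (-kktGrad φ ℓ (WithLp.toLp 2 (x, v))).snd k = -gradConj (ℓ k) (v k) := rfl
      rw [PiLp.sub_apply, PiLp.add_apply, e1, blockOp_apply, gradConj_eq (hℓ k) (hℓsc k) hy₁]
      change _ - r k = y₂
      rw [add_sub_assoc, ← hy]
      abel
    change ((-kktGrad φ ℓ (WithLp.toLp 2 (x, v))).snd + blockOp L x - WithLp.toLp 2 r) k ∈ _
    rw [e]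
    exact (hg k).mem_subdifferential_conjugate_iff.2 hy₂

/-- Zeros of the optimality system are pairs of primal and dual solutions. -/
theorem mem_solutions_of_kkt_zero {f : ∀ i, K i → EReal} (hf : ∀ i, IsGammaZero (f i))
    {z : ∀ i, K i} {r : ∀ k, G k}
    {ℓ : ∀ k, G k → EReal} (hℓ : ∀ k, IsGammaZero (ℓ k)) (hℓsc : ∀ k, IsStronglyConvex (ℓ k))
    {g : ∀ k, G k → EReal} (hg : ∀ k, IsGammaZero (g k)) {L : ∀ k i, K i →L[ℝ] G k}
    {φ : PiLp 2 K → ℝ} (hφconv : ConvexOn ℝ Set.univ φ) (hφdiff : Differentiable ℝ φ)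
    {h : WithLp 2 (PiLp 2 K × PiLp 2 G)} (hh : -kktGrad φ ℓ h ∈ kktOp f z g r L h) :
    h.fst ∈ primalSolutions f z ℓ g r L φ ∧ h.snd ∈ dualSolutions f z ℓ g r L φ := by
  set x := h.fst with hx
  set v := h.snd with hv
  set u : PiLp 2 K := (-kktGrad φ ℓ h).fst - ContinuousLinearMap.adjoint (blockOp L) v
    + WithLp.toLp 2 z with hu
  set y₂ : PiLp 2 G := (-kktGrad φ ℓ h).snd + blockOp L x - WithLp.toLp 2 r with hy₂
  set y₁ : PiLp 2 G := WithLp.toLp 2 fun k => gradConj (ℓ k) (v k) with hy₁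
  obtain ⟨hu', hy₂'⟩ : u ∈ blockSubdifferential f x ∧
    y₂ ∈ blockSubdifferential (fun k => conjugate (g k)) v := hh
  have hue : u = -gradient φ x - ContinuousLinearMap.adjoint (blockOp L) v + WithLp.toLp 2 z := rfl
  -- This splitting attains the infimal convolutions `ℓ k □ g k` of the primal objective, since `v
  -- k` is a subgradient of both functions there.
  have hye : y₁ + y₂ = blockOp L x - WithLp.toLp 2 r := by
    have : y₂ = -y₁ + blockOp L x - WithLp.toLp 2 r := rfl
    rw [this]; abel
  have hvℓ : ∀ k, v k ∈ subdifferential (ℓ k) (y₁ k) := fun k =>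
    mem_subdifferential_gradConj (hℓ k) (hℓsc k) (v k)
  have hvg : ∀ k, v k ∈ subdifferential (g k) (y₂ k) := fun k =>
    (hg k).mem_subdifferential_of_conjugate (hy₂' k)
  choose F hF using fun i => (hf i).exists_coe_of_mem_subdifferential (hu' i)
  choose a ha using fun k => (hℓ k).exists_coe_of_mem_subdifferential (hvℓ k)
  choose b hb using fun k => (hg k).exists_coe_of_mem_subdifferential (hvg k)
  have hφs := gradient_mem_subdifferential hφconv hφdiff x
  constructor
  · intro x' _
    have hlow : ((∑ i, (inner ℝ (x' i - x i) (u i) + F i - inner ℝ (x' i) (z i))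
        + ∑ k, (inner ℝ ((blockOp L x' - WithLp.toLp 2 r) k - (y₁ + y₂) k) (v k) + (a k + b k))
        + φ x' : ℝ) : EReal) ≤ primalObj f z ℓ g r L φ x' := by
      rw [EReal.coe_add, EReal.coe_add, coe_finsetSum_ereal, coe_finsetSum_ereal]
      refine add_le_add (add_le_add (Finset.sum_le_sum fun i _ => ?_)
        (Finset.sum_le_sum fun k _ => ?_)) le_rfl
      · rw [EReal.coe_sub]
        exact EReal.sub_le_sub (coe_le_of_mem_subdifferential (hF i) (hu' i) (x' i)) le_rfl
      · have := le_infConv_of_mem_subdifferential (ha k) (hb k) (hvℓ k) (hvg k)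
          ((∑ i, L k i (x' i)) - r k)
        rw [← blockOp_apply] at this
        exact this.trans (by rw [blockOp_apply])
    have hup : primalObj f z ℓ g r L φ x ≤ ((∑ i, (F i - inner ℝ (x i) (z i))
        + ∑ k, (a k + b k) + φ x : ℝ) : EReal) := by
      rw [EReal.coe_add, EReal.coe_add, coe_finsetSum_ereal, coe_finsetSum_ereal]
      refine add_le_add (add_le_add (Finset.sum_le_sum fun i _ => ?_)
        (Finset.sum_le_sum fun k _ => ?_)) le_rfl
      · rw [EReal.coe_sub, hF i]
      · have h1 := infConv_le_of_eq_coe (ha k) (hb k)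
        have h2 : y₁ k + y₂ k = (∑ i, L k i (x i)) - r k := by
          rw [← PiLp.add_apply, hye, PiLp.sub_apply, blockOp_apply]
        rw [h2] at h1
        exact h1
    refine hup.trans (le_trans ?_ hlow)
    -- As `u = -∇φ x - L* v + z`, the linear terms collapse and only the gradient inequality of `φ`
    -- between `x` and `x'` is left.
    rw [EReal.coe_le_coe_iff]
    have h1 := add_inner_gradient_le hφconv hφdiff x x'
    have h2 : ∑ k, inner ℝ ((blockOp L x' - WithLp.toLp 2 r) k - (y₁ + y₂) k) (v k)
        = inner ℝ (x' - x) (ContinuousLinearMap.adjoint (blockOp L) v) := by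
      rw [ContinuousLinearMap.adjoint_inner_right, PiLp.inner_apply, hye]
      refine Finset.sum_congr rfl fun k _ => ?_
      rw [map_sub]
      simp only [PiLp.sub_apply]
      congr 1
      abel
    have h3 : ∑ i, inner ℝ (x' i - x i) (u i) = inner ℝ (x' - x) u := by
      rw [PiLp.inner_apply]; rfl
    have h4 : ∑ i, inner ℝ (x' i) (z i) - ∑ i, inner ℝ (x i) (z i)
        = inner ℝ (x' - x) (WithLp.toLp 2 z) := by
      rw [inner_sub_left, PiLp.inner_apply, PiLp.inner_apply]
    simp only [Finset.sum_add_distrib, Finset.sum_sub_distrib]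
    rw [h2, h3, hue, inner_add_right, inner_sub_right, inner_neg_right]
    linarith
  · intro v' _
    have hxf : ∀ i, x i ∈ subdifferential (conjugate (f i)) (u i) := fun i =>
      mem_subdifferential_conjugate (hF i) (hu' i)
    have hxφ : x ∈ subdifferential (conjugate fun x : PiLp 2 K => (φ x : EReal)) (gradient φ x) :=
      mem_subdifferential_conjugate (r := φ x) rfl hφs
    have hyℓ : ∀ k, y₁ k ∈ subdifferential (conjugate (ℓ k)) (v k) := fun k =>
      mem_subdifferential_conjugate (ha k) (hvℓ k)
    have hΦ := conjugate_eq_of_mem_subdifferential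
      (f := fun x : PiLp 2 K => (φ x : EReal)) (r := φ x) rfl hφs
    have hF' := fun i => conjugate_eq_of_mem_subdifferential (hF i) (hu' i)
    have ha' := fun k => conjugate_eq_of_mem_subdifferential (ha k) (hvℓ k)
    have hb' := fun k => conjugate_eq_of_mem_subdifferential (hb k) (hvg k)
    set Φ := inner ℝ (gradient φ x) x - φ x
    set F' := fun i => inner ℝ (u i) (x i) - F i
    set a' := fun k => inner ℝ (v k) (y₁ k) - a k
    set b' := fun k => inner ℝ (v k) (y₂ k) - b k
    have hsum : (fun y : PiLp 2 K => ∑ i, conjugate (f i) (y i)) u = ((∑ i, F' i : ℝ) : EReal) := by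
      rw [coe_finsetSum_ereal]
      exact Finset.sum_congr rfl fun i _ => hF' i
    -- The roles are now exchanged: `x` is the common subgradient, of `φ*` at `∇φ x` and of `∑ f i*`
    -- at `u`, and these two points add up to `z - L* v`.
    have hxs : x ∈ subdifferential (fun y : PiLp 2 K => ∑ i, conjugate (f i) (y i)) u :=
      mem_subdifferential_sum (f := fun i => conjugate (f i)) hF' hxf
    have harg : ∀ w : PiLp 2 G, (WithLp.toLp 2 fun i => z i
        - ∑ k, ContinuousLinearMap.adjoint (L k i) (w k) : PiLp 2 K)
        = WithLp.toLp 2 z - ContinuousLinearMap.adjoint (blockOp L) w := by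
      intro w
      ext i
      rw [PiLp.sub_apply, adjoint_blockOp_apply]
    have hgu : gradient φ x + u = WithLp.toLp 2 z - ContinuousLinearMap.adjoint (blockOp L) v := by
      rw [hue]; abel
    have hlow : ((inner ℝ ((WithLp.toLp 2 z - ContinuousLinearMap.adjoint (blockOp L) v')
          - (gradient φ x + u)) x + (Φ + ∑ i, F' i)
        + ∑ k, ((inner ℝ (v' k - v k) (y₁ k) + a' k) + (inner ℝ (v' k - v k) (y₂ k) + b' k)
          + inner ℝ (v' k) (r k)) : ℝ) : EReal) ≤ dualObj f z ℓ g r L φ v' := by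
      rw [EReal.coe_add, coe_finsetSum_ereal]
      refine add_le_add ?_ (Finset.sum_le_sum fun k _ => ?_)
      · rw [harg]
        exact le_infConv_of_mem_subdifferential hΦ hsum hxφ hxs _
      · rw [EReal.coe_add, EReal.coe_add]
        exact add_le_add (add_le_add (coe_le_of_mem_subdifferential (ha' k) (hyℓ k) _)
          (coe_le_of_mem_subdifferential (hb' k) (hy₂' k) _)) le_rfl
    have hup : dualObj f z ℓ g r L φ v ≤ ((Φ + ∑ i, F' i
        + ∑ k, (a' k + b' k + inner ℝ (v k) (r k)) : ℝ) : EReal) := by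
      rw [EReal.coe_add, coe_finsetSum_ereal]
      refine add_le_add ?_ (Finset.sum_le_sum fun k _ => ?_)
      · rw [harg, ← hgu]
        exact infConv_le_of_eq_coe hΦ hsum
      · rw [ha', hb', EReal.coe_add, EReal.coe_add]
    refine hup.trans (le_trans ?_ hlow)
    -- Here the linear terms cancel completely, because `⟪v' - v, y₁ + y₂ + r⟫ = ⟪v' - v, L x⟫`.
    rw [EReal.coe_le_coe_iff, hgu]
    have e1 : WithLp.toLp 2 z - ContinuousLinearMap.adjoint (blockOp L) v'
        - (WithLp.toLp 2 z - ContinuousLinearMap.adjoint (blockOp L) v)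
        = -ContinuousLinearMap.adjoint (blockOp L) (v' - v) := by
      rw [map_sub]; abel
    rw [e1, inner_neg_left, ContinuousLinearMap.adjoint_inner_left]
    have e2 : ∑ k, inner ℝ (v' k - v k) (y₁ k) + ∑ k, inner ℝ (v' k - v k) (y₂ k)
        = inner ℝ (v' - v) (blockOp L x) - inner ℝ (v' - v) (WithLp.toLp 2 r) := by
      rw [← inner_sub_right, ← hye, inner_add_right, PiLp.inner_apply, PiLp.inner_apply]
      rfl
    have e3 : ∑ k, inner ℝ (v' k) (r k) - ∑ k, inner ℝ (v k) (r k)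
        = inner ℝ (v' - v) (WithLp.toLp 2 r) := by
      rw [inner_sub_left, PiLp.inner_apply, PiLp.inner_apply]
    simp only [Finset.sum_add_distrib]
    linarith

end Blocks

end PrimalDual

namespace PrimalDual

/-! ### The block algorithm as a resolvent iteration -/

section

variable {H : Type*} [NormedAddCommGroup H] [InnerProductSpace ℝ H] [CompleteSpace H]

/-- Weakly convergent sequences are bounded. -/
theorem InnerTendsto.exists_norm_le {u : ℕ → H} {x : H} (h : InnerTendsto atTop u x) :
    ∃ C, ∀ n, ‖u n‖ ≤ C := by
  obtain ⟨C, hC⟩ := banach_steinhaus (g := fun n => innerSL ℝ (u n)) fun y => by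
    obtain ⟨M, hM⟩ := (h y).norm.bddAbove_range
    exact ⟨M, fun n => hM ⟨n, rfl⟩⟩
  exact ⟨C, fun n => by simpa using hC n⟩

theorem InnerTendsto.map {H' : Type*} [NormedAddCommGroup H'] [InnerProductSpace ℝ H']
    [CompleteSpace H'] {ι : Type*} {l : Filter ι} {u : ι → H} {x : H} (h : InnerTendsto l u x)
    (T : H →L[ℝ] H') : InnerTendsto l (fun n => T (u n)) (T x) := by
  intro y
  simp only [← ContinuousLinearMap.adjoint_inner_right]
  exact h _

end

section

variable {m s : ℕ}
variable {K : Fin m → Type*} [∀ i, NormedAddCommGroup (K i)] [∀ i, InnerProductSpace ℝ (K i)]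
  [∀ i, CompleteSpace (K i)]
variable {G : Fin s → Type*} [∀ k, NormedAddCommGroup (G k)] [∀ k, InnerProductSpace ℝ (G k)]
  [∀ k, CompleteSpace (G k)]

/-- The components of the gradient of a separable function are subgradients of its summands. -/
theorem gradient_apply_mem_subdifferential {φ : PiLp 2 K → ℝ} (hc : ConvexOn ℝ Set.univ φ)
    (hd : Differentiable ℝ φ) {h : ∀ i, K i → ℝ} (hh : ∀ x : PiLp 2 K, φ x = ∑ i, h i (x i))
    (x : PiLp 2 K) (j : Fin m) :
    gradient φ x j ∈ subdifferential (fun w => (h j w : EReal)) (x j) := by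
  intro w
  -- Only coordinate `j` is moved, so the other summands cancel in the gradient inequality of `φ`.
  set x' : PiLp 2 K := WithLp.toLp 2 (Function.update (fun i => x i) j w) with hx'
  have hj : x' j = w := by simp [hx']
  have hne : ∀ i ∈ Finset.univ.erase j, x' i = x i := fun i hi => by
    simp [hx', Function.update_of_ne (Finset.ne_of_mem_erase hi)]
  have h1 := add_inner_gradient_le hc hd x x'
  rw [hh, hh, PiLp.inner_apply, ← Finset.add_sum_erase _ _ (Finset.mem_univ j),
    ← Finset.add_sum_erase _ _ (Finset.mem_univ j), ← Finset.add_sum_erase _ _ (Finset.mem_univ j),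
    hj] at h1
  have h2 : ∑ i ∈ Finset.univ.erase j, h i (x' i) = ∑ i ∈ Finset.univ.erase j, h i (x i) :=
    Finset.sum_congr rfl fun i hi => by rw [hne i hi]
  have h3 : ∑ i ∈ Finset.univ.erase j, inner ℝ ((x' - x) i) (gradient φ x i) = 0 :=
    Finset.sum_eq_zero fun i hi => by
      rw [PiLp.sub_apply, hne i hi, sub_self, inner_zero_left]
  rw [h2, h3, PiLp.sub_apply, hj] at h1
  change ((inner ℝ (w - x j) (gradient φ x j) : ℝ) : EReal) + (h j (x j) : EReal) ≤ (h j w : EReal)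
  norm_cast
  linarith

/-- One step of the block algorithm is a resolvent step. -/
theorem kktResolvent_eq {f : ∀ i, K i → EReal} {z : ∀ i, K i} {g : ∀ k, G k → EReal}
    {r : ∀ k, G k} {L : ∀ k i, K i →L[ℝ] G k} {V : ∀ i, K i →L[ℝ] K i}
    (hV : ∀ i, IsStronglyPositive (V i)) {W : ∀ k, G k →L[ℝ] G k}
    (hW : ∀ k, IsStronglyPositive (W k)) {a c t p y : PiLp 2 K} {b d u q : PiLp 2 G}
    (ht : ∀ i, t i = (∑ k, ContinuousLinearMap.adjoint (L k i) (d k)) + a i)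
    (hp : ∀ i, p i = prox (f i) (V i).inverse (c i - V i (t i - z i)))
    (hy : ∀ i, y i = (2 : ℝ) • p i - c i)
    (hu : ∀ k, u k = (∑ i, L k i (y i)) - b k)
    (hq : ∀ k, q k = prox (conjugate (g k)) (W k).inverse (d k + W k (u k - r k))) :
    kktResolvent f z g r L V W
      (primalDualMetric (diagOp V) (diagOp W) (blockOp L) (WithLp.toLp 2 (c, d))
        - WithLp.toLp 2 (a, b)) = WithLp.toLp 2 (p, q) := by
  set h := primalDualMetric (diagOp V) (diagOp W) (blockOp L) (WithLp.toLp 2 (c, d))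
        - WithLp.toLp 2 (a, b) with hh
  have hpe : primalStep f z V h.fst = p := by
    ext i
    rw [hp]
    change prox (f i) (V i).inverse (V i (h.fst i + z i)) = _
    congr 1
    have e : h.fst i = (V i).inverse (c i) - ContinuousLinearMap.adjoint (blockOp L) d i - a i := by
      rw [← inverse_diagOp_apply hV]; rfl
    rw [e, ht, adjoint_blockOp_apply, map_add, map_sub, map_sub, (hV i).apply_inverse, map_sub,
      map_add]
    abel
  have hqe : dualStep g r L W p h.snd = q := by
    ext k
    rw [hq]
    change prox (conjugate (g k)) (W k).inverse (W k (h.snd k + (2 : ℝ) • blockOp L p k - r k)) = _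
    congr 1
    have e : h.snd k = (W k).inverse (d k) - blockOp L c k - b k := by
      rw [← inverse_diagOp_apply hW]; rfl
    -- The extrapolation `y = 2 p - c` produces at once the `2 L p` of the dual resolvent and the
    -- `-L c` of the metric applied to `(c, d)`.
    have e2 : u k = (2 : ℝ) • blockOp L p k - blockOp L c k - b k := by
      rw [hu, blockOp_apply, blockOp_apply]
      simp only [hy, map_sub, map_smul, Finset.sum_sub_distrib, Finset.smul_sum]
    have e3 : h.snd k + (2 : ℝ) • blockOp L p k - r k = (W k).inverse (d k) + (u k - r k) := by
      rw [e, e2]; abel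
    rw [e3, map_add, (hW k).apply_inverse]
  unfold kktResolvent
  rw [hpe, hqe]

end

end PrimalDual

/-! ### The main theorem -/

theorem mainTheorem4
    {m s : ℕ} (hm : 0 < m) (hs : 0 < s)
    -- the separable real Hilbert spaces `K i` and `G k`
    (K : Fin m → Type*) [∀ i, NormedAddCommGroup (K i)] [∀ i, InnerProductSpace ℝ (K i)]
    [∀ i, CompleteSpace (K i)] [∀ i, SecondCountableTopology (K i)]
    [∀ i, MeasurableSpace (K i)] [∀ i, BorelSpace (K i)]
    (G : Fin s → Type*) [∀ k, NormedAddCommGroup (G k)] [∀ k, InnerProductSpace ℝ (G k)]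
    [∀ k, CompleteSpace (G k)] [∀ k, SecondCountableTopology (G k)]
    [∀ k, MeasurableSpace (G k)] [∀ k, BorelSpace (G k)]
    {Ω : Type*} [MeasurableSpace Ω] (P : Measure Ω) [IsProbabilityMeasure P]
    -- the minimization problem
    (z : ∀ i, K i) (f : ∀ i, K i → EReal) (hf : ∀ i, IsGammaZero (f i))
    (r : ∀ k, G k) (ℓ : ∀ k, G k → EReal) (hℓ : ∀ k, IsGammaZero (ℓ k))
    (hℓsc : ∀ k, IsStronglyConvex (ℓ k))
    (g : ∀ k, G k → EReal) (hg : ∀ k, IsGammaZero (g k))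
    (L : ∀ k i, K i →L[ℝ] G k)
    (φ : PiLp 2 K → ℝ) (hφconv : ConvexOn ℝ Set.univ φ) (hφdiff : Differentiable ℝ φ)
    (hφlip : ∃ C : ℝ≥0, LipschitzWith C (gradient φ))
    -- the qualification condition
    (hqual : ∃ (x' : PiLp 2 K) (v' : PiLp 2 G),
      (∀ k, v' k ∈ parallelSum (subdifferential (ℓ k)) (subdifferential (g k))
        ((∑ j, L k j (x' j)) - r k)) ∧
      ∀ i, ∃ u ∈ subdifferential (f i) (x' i),
        z i = u + (∑ k, ContinuousLinearMap.adjoint (L k i) (v' k)) + gradient φ x' i)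
    (hP : (primalSolutions f z ℓ g r L φ).Nonempty)
    -- the metrics and the cocoercivity constants
    (V : ∀ i, K i →L[ℝ] K i) (hV : ∀ i, IsStronglyPositive (V i))
    (ν₀ : ℝ) (hν₀ : 0 < ν₀)
    (hφcoco : ∀ x y : PiLp 2 K,
      ν₀ * ∑ i, sqNorm (V i) (gradient φ x i - gradient φ y i)
        ≤ ∑ i, inner ℝ (x i - y i) (gradient φ x i - gradient φ y i))
    (W : ∀ k, G k →L[ℝ] G k) (hW : ∀ k, IsStronglyPositive (W k))
    (μ₀ : ℝ) (hμ₀ : 0 < μ₀)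
    (hℓcoco : ∀ v w : PiLp 2 G,
      μ₀ * ∑ k, sqNorm (W k) (gradConj (ℓ k) (v k) - gradConj (ℓ k) (w k))
        ≤ ∑ k, inner ℝ (v k - w k) (gradConj (ℓ k) (v k) - gradConj (ℓ k) (w k)))
    (hβ : 1 / 2 < betaHat ν₀ μ₀ L V W)
    -- the parameters of the algorithm
    (ε : ℝ) (hε : ε ∈ Set.Ioo 0 (min 1 (betaHat ν₀ μ₀ L V W)))
    (lam : ℕ → ℝ) (hlam : ∀ n, lam n ∈ Set.Icc ε 1)
    (α : ℕ → ℝ) (hα : ∀ n, α n ∈ Set.Icc 0 (1 - ε))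
    -- the stochastic gradients and the processes generated by the algorithm
    (a : ℕ → Ω → PiLp 2 K) (ha : ∀ n, Measurable (a n)) (ha2 : ∀ n, MemLp (a n) 2 P)
    (b : ℕ → Ω → PiLp 2 G) (hb : ∀ n, Measurable (b n)) (hb2 : ∀ n, MemLp (b n) 2 P)
    (x c t p y : ℕ → Ω → PiLp 2 K) (v d u q : ℕ → Ω → PiLp 2 G)
    (hx0 : Measurable (x 0)) (hx02 : MemLp (x 0) 2 P)
    (hv0 : Measurable (v 0)) (hv02 : MemLp (v 0) 2 P)
    -- `0 - 1 = 0` in `ℕ`, which is the convention `x₋₁ = x₀`, `v₋₁ = v₀`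
    (hc : ∀ n ω i, c n ω i = x n ω i + α n • (x n ω i - x (n - 1) ω i))
    (hd : ∀ n ω k, d n ω k = v n ω k + α n • (v n ω k - v (n - 1) ω k))
    (ht : ∀ n ω i, t n ω i
      = (∑ k, ContinuousLinearMap.adjoint (L k i) (d n ω k)) + a n ω i)
    (hp : ∀ n ω i, p n ω i
      = prox (f i) (V i).inverse (c n ω i - V i (t n ω i - z i)))
    (hy : ∀ n ω i, y n ω i = (2 : ℝ) • p n ω i - c n ω i)
    (hx : ∀ n ω i, x (n + 1) ω i = x n ω i + lam n • (p n ω i - x n ω i))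
    (hu : ∀ n ω k, u n ω k = (∑ i, L k i (y n ω i)) - b n ω k)
    (hq : ∀ n ω k, q n ω k
      = prox (conjugate (g k)) (W k).inverse (d n ω k + W k (u n ω k - r k)))
    (hv : ∀ n ω k, v (n + 1) ω k = v n ω k + lam n • (q n ω k - v n ω k))
    -- the filtration generated by the iterates, and the conditions on the processes
    (F : ℕ → MeasurableSpace Ω)
    (hF : ∀ n, F n = pastSigma (fun j ω => (x j ω, v j ω)) n)
    (hEa : ∀ n, P[a n | F n] =ᵐ[P] fun ω => gradient φ (c n ω))
    (hEb : ∀ n, P[b n | F n] =ᵐ[P] fun ω => WithLp.toLp 2 fun k => gradConj (ℓ k) (d n ω k))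
    (hvar : ∀ᵐ ω ∂P, Summable fun n =>
      (P[fun ω' => (∑ i, ‖a n ω' i - gradient φ (c n ω') i‖ ^ 2)
          + ∑ k, ‖b n ω' k - gradConj (ℓ k) (d n ω' k)‖ ^ 2 | F n]) ω)
    (hxbdd : ∀ᵐ ω ∂P, ∀ i, BddAbove (Set.range fun n => ‖x n ω i - x (n - 1) ω i‖))
    (hvbdd : ∀ᵐ ω ∂P, ∀ k, BddAbove (Set.range fun n => ‖v n ω k - v (n - 1) ω k‖))
    (hαsum : Summable α) :
    ∃ (xbar : Ω → PiLp 2 K) (vbar : Ω → PiLp 2 G),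
      Measurable xbar ∧ Measurable vbar ∧
      (∀ᵐ ω ∂P, xbar ω ∈ primalSolutions f z ℓ g r L φ ∧
        vbar ω ∈ dualSolutions f z ℓ g r L φ) ∧
      -- weak convergence
      (∀ᵐ ω ∂P, (∀ i, WeakTendsto (fun n => x n ω i) (xbar ω i)) ∧
        ∀ k, WeakTendsto (fun n => v n ω k) (vbar ω k)) ∧
      -- strong convergence under uniform convexity of `φ`
      (∀ᵐ ω ∂P, UniformlyConvexAt (fun x' => (φ x' : EReal)) (xbar ω) →
        ∀ i, Tendsto (fun n => x n ω i) atTop (𝓝 (xbar ω i))) ∧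
      -- strong convergence under uniform convexity of some `(ℓ j)*`
      (∀ j, ∀ᵐ ω ∂P, UniformlyConvexAt (conjugate (ℓ j)) (vbar ω j) →
        Tendsto (fun n => v n ω j) atTop (𝓝 (vbar ω j))) ∧
      -- strong convergence under uniform convexity of a separable component of `φ`
      (∀ h : ∀ i, K i → ℝ, (∀ i, ConvexOn ℝ Set.univ (h i)) → (∀ i, Differentiable ℝ (h i)) →
        (∀ x' : PiLp 2 K, φ x' = ∑ i, h i (x' i)) →
        ∀ j, ∀ᵐ ω ∂P, UniformlyConvexAt (fun w => (h j w : EReal)) (xbar ω j) →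
          Tendsto (fun n => x n ω j) atTop (𝓝 (xbar ω j))) := by
  let E := WithLp 2 (PiLp 2 K × PiLp 2 G)
  obtain ⟨χ, fb⟩ := exists_isForwardBackward_kkt (z := z) (r := r) hf hg hV hW hν₀ hμ₀ hφcoco
    hℓcoco hβ
  have hZ := exists_kkt_zero (f := f) (z := z) (r := r) (L := L) (φ := φ) hℓ hℓsc hg hqual
  set U := primalDualMetric (diagOp V) (diagOp W) (blockOp L) with hU
  -- On the product space the algorithm is a single sequence `X` with extrapolated points `w` and
  -- stochastic gradients `e`.
  let X : ℕ → Ω → E := fun n ω => WithLp.toLp 2 (x n ω, v n ω)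
  let w : ℕ → Ω → E := fun n ω => WithLp.toLp 2 (c n ω, d n ω)
  let e : ℕ → Ω → E := fun n ω => WithLp.toLp 2 (a n ω, b n ω)
  have hwX : ∀ n ω, w n ω = X n ω + α n • (X n ω - X (n - 1) ω) := by
    intro n ω
    refine (WithLp.ofLp_injective 2) (Prod.ext ?_ ?_)
    · ext i; exact hc n ω i
    · ext k; exact hd n ω k
  have hres : ∀ n ω, kktResolvent f z g r L V W (U (w n ω) - e n ω)
      = WithLp.toLp 2 (p n ω, q n ω) := fun n ω =>
    kktResolvent_eq hV hW (ht n ω) (hp n ω) (hy n ω) (hu n ω) (hq n ω)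
  have hXX : ∀ n ω, X (n + 1) ω = X n ω
      + lam n • (kktResolvent f z g r L V W (U (w n ω) - e n ω) - X n ω) := by
    intro n ω
    rw [hres]
    refine (WithLp.ofLp_injective 2) (Prod.ext ?_ ?_)
    · ext i; exact hx n ω i
    · ext k; exact hv n ω k
  have hmk : ∀ {mΩ : MeasurableSpace Ω} {x : Ω → PiLp 2 K} {v : Ω → PiLp 2 G},
      Measurable[mΩ] x → Measurable[mΩ] v →
      Measurable[mΩ] fun ω => (WithLp.toLp 2 (x ω, v ω) : E) := fun hx hv =>
    (WithLp.measurable_toLp 2 _).comp (hx.prodMk hv)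
  have hem : ∀ n, Measurable (e n) := fun n => hmk (ha n) (hb n)
  obtain ⟨CJ, hCJ⟩ := fb.lipschitz_resolvent
  have hXm : ∀ n, Measurable (X n) := by
    intro n
    induction n using Nat.strong_induction_on with
    | _ n ih =>
      cases n with
      | zero => exact hmk hx0 hv0
      | succ n =>
        have h1 := ih n (Nat.lt_succ_self n)
        have h2 := ih (n - 1) (by omega)
        have hwm : Measurable (w n) := by
          rw [show w n = fun ω => X n ω + α n • (X n ω - X (n - 1) ω) from funext (hwX n)]
          exact h1.add ((h1.sub h2).const_smul (α n))
        rw [show X (n + 1) = fun ω => X n ω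
          + lam n • (kktResolvent f z g r L V W (U (w n ω) - e n ω) - X n ω) from funext (hXX n)]
        exact h1.add (((hCJ.continuous.measurable.comp
          ((U.continuous.measurable.comp hwm).sub (hem n))).sub h1).const_smul (lam n))
  have hxm : ∀ n, Measurable fun ω => (x n ω, v n ω) := fun n =>
    (WithLp.measurable_ofLp 2 _).comp (hXm n)
  let ℱ : Filtration ℕ ‹MeasurableSpace Ω› :=
    { seq := F
      mono' := fun i j hij => by
        rw [hF, hF]
        exact biSup_mono fun k hk => le_trans hk hij
      le' := fun n => by
        rw [hF]
        exact iSup₂_le fun k _ => (hxm k).comap_le }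
  have hXad : StronglyAdapted ℱ X := by
    intro n
    have h1 : Measurable[F n] fun ω => (x n ω, v n ω) := by
      rw [hF]
      exact (comap_measurable _).mono
        (le_iSup₂_of_le (f := fun j (_ : j ∈ Set.Iic n) =>
          MeasurableSpace.comap (fun ω => (x j ω, v j ω)) inferInstance) n (Set.mem_Iic.2 le_rfl) le_rfl) le_rfl
    have h2 : Measurable[F n] (X n) := (WithLp.measurable_toLp 2 _).comp h1
    exact h2.stronglyMeasurable
  have hX0 : MemLp (X 0) 2 P := memLp_prodLp_iff.2 ⟨hx02, hv02⟩
  have he2 : ∀ n, MemLp (e n) 2 P := fun n => memLp_prodLp_iff.2 ⟨ha2 n, hb2 n⟩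
  -- Conditional expectation commutes with the two continuous projections, so the unbiasedness of `a
  -- n` and `b n` combines into that of `e n`.
  have hE : ∀ n, P[e n | ℱ n] =ᵐ[P] fun ω => kktGrad φ ℓ (w n ω) := by
    intro n
    have hei : Integrable (e n) P := (he2 n).integrable one_le_two
    have h1 := (WithLp.fstL 2 ℝ (PiLp 2 K) (PiLp 2 G)).comp_condExp_comm (m := F n) hei
    have h2 := (WithLp.sndL 2 ℝ (PiLp 2 K) (PiLp 2 G)).comp_condExp_comm (m := F n) hei
    filter_upwards [h1, h2, hEa n, hEb n] with ω k1 k2 k3 k4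
    refine (WithLp.ofLp_injective 2) (Prod.ext ?_ ?_)
    · exact k1.trans k3
    · exact k2.trans k4
  have hvar' : ∀ᵐ ω ∂P, Summable fun n =>
      (P[fun ω' => ‖e n ω' - kktGrad φ ℓ (w n ω')‖ ^ 2 | ℱ n]) ω := by
    have h1 : ∀ n, (fun ω' => ‖e n ω' - kktGrad φ ℓ (w n ω')‖ ^ 2)
        = fun ω' => (∑ i, ‖a n ω' i - gradient φ (c n ω') i‖ ^ 2)
          + ∑ k, ‖b n ω' k - gradConj (ℓ k) (d n ω' k)‖ ^ 2 := by
      intro n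
      ext ω'
      rw [WithLp.prod_norm_sq_eq_of_L2, PiLp.norm_sq_eq_of_L2, PiLp.norm_sq_eq_of_L2]
      rfl
    simp only [h1]
    exact hvar
  have hbdd : ∀ᵐ ω ∂P, BddAbove (Set.range fun n => ‖X n ω - X (n - 1) ω‖) := by
    filter_upwards [hxbdd, hvbdd] with ω h1 h2
    choose M hM using h1
    choose N hN using h2
    refine ⟨Real.sqrt (∑ i, M i ^ 2 + ∑ k, N k ^ 2), ?_⟩
    rintro _ ⟨n, rfl⟩
    apply Real.le_sqrt_of_sq_le
    rw [WithLp.prod_norm_sq_eq_of_L2, PiLp.norm_sq_eq_of_L2, PiLp.norm_sq_eq_of_L2]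
    exact add_le_add
      (Finset.sum_le_sum fun i _ => pow_le_pow_left₀ (norm_nonneg _) (hM i ⟨n, rfl⟩) 2)
      (Finset.sum_le_sum fun k _ => pow_le_pow_left₀ (norm_nonneg _) (hN k ⟨n, rfl⟩) 2)
  obtain ⟨Xbar, hXbar, hconv⟩ := fb.exists_ae_innerTendsto (ℱ := ℱ) hε.1 hlam
    (fun n => ⟨(hα n).1, (hα n).2.trans (by linarith [hε.1])⟩) hαsum hXad hX0 he2 hwX hXX hE hvar'
    hbdd hZ
  have hproj : ∀ i, Continuous fun h : E => h.fst i := fun i =>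
    ((PiLp.proj 2 K i) ∘L (WithLp.fstL 2 ℝ (PiLp 2 K) (PiLp 2 G))).continuous
  have hproj' : ∀ k, Continuous fun h : E => h.snd k := fun k =>
    ((PiLp.proj 2 G k) ∘L (WithLp.sndL 2 ℝ (PiLp 2 K) (PiLp 2 G))).continuous
  have hfst : Continuous fun h : E => h.fst := (WithLp.fstL 2 ℝ (PiLp 2 K) (PiLp 2 G)).continuous
  have hwbdd : ∀ ω, InnerTendsto atTop (fun n => X n ω) (Xbar ω) →
      Tendsto (fun n => w n ω - X n ω) atTop (𝓝 0) → ∃ C, ∀ n, ‖w n ω‖ ≤ C := fun ω h1 h2 =>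
    (h1.of_sub h2).exists_norm_le
  -- The gradients are evaluated at the extrapolated points `c n`, `d n`. Strong convergence is
  -- proved for these first and then carried over to `x n`, `v n`.
  have hsub : ∀ ω, Tendsto (fun n => w n ω - X n ω) atTop (𝓝 0) →
      (∀ i, Tendsto (fun n => c n ω i - x n ω i) atTop (𝓝 0)) ∧
      ∀ k, Tendsto (fun n => d n ω k - v n ω k) atTop (𝓝 0) := fun ω h =>
    ⟨fun i => ((hproj i).tendsto 0).comp h, fun k => ((hproj' k).tendsto 0).comp h⟩
  refine ⟨fun ω => (Xbar ω).fst, fun ω => (Xbar ω).snd,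
    measurable_fst.comp ((WithLp.measurable_ofLp 2 _).comp hXbar),
    measurable_snd.comp ((WithLp.measurable_ofLp 2 _).comp hXbar), ?_, ?_, ?_, ?_, ?_⟩
  · filter_upwards [hconv] with ω h
    exact mem_solutions_of_kkt_zero hf hℓ hℓsc hg hφconv hφdiff h.1
  · filter_upwards [hconv] with ω h
    exact ⟨fun i => (h.2.1.map ((PiLp.proj 2 K i) ∘L
        (WithLp.fstL 2 ℝ (PiLp 2 K) (PiLp 2 G)))).weakTendsto,
      fun k => (h.2.1.map ((PiLp.proj 2 G k) ∘L
        (WithLp.sndL 2 ℝ (PiLp 2 K) (PiLp 2 G)))).weakTendsto⟩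
  · filter_upwards [hconv] with ω ⟨_, h1, h2, h3⟩ huc i
    obtain ⟨C, hC⟩ := hwbdd ω h1 h2
    have h4 : Tendsto (fun n => gradient φ (c n ω)) atTop (𝓝 (gradient φ (Xbar ω).fst)) :=
      (hfst.tendsto _).comp h3
    have h5 : Tendsto (fun n => c n ω) atTop (𝓝 (Xbar ω).fst) :=
      huc.tendsto (fun _ => EReal.coe_ne_bot _)
        (fun n => (WithLp.norm_fst_le _ (w n ω)).trans (hC n))
        (fun n => gradient_mem_subdifferential hφconv hφdiff _)
        (gradient_mem_subdifferential hφconv hφdiff _) h4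
    have h6 := (((PiLp.proj (𝕜 := ℝ) 2 K i).continuous.tendsto _).comp h5).sub ((hsub ω h2).1 i)
    rw [sub_zero] at h6
    refine h6.congr fun n => ?_
    exact sub_sub_cancel _ _
  · intro j
    filter_upwards [hconv] with ω ⟨_, h1, h2, h3⟩ huc
    obtain ⟨C, hC⟩ := hwbdd ω h1 h2
    have h4 : Tendsto (fun n => gradConj (ℓ j) (d n ω j)) atTop
        (𝓝 (gradConj (ℓ j) ((Xbar ω).snd j))) := ((hproj' j).tendsto _).comp h3
    -- Convergence of `B (w n)` holds blockwise, so uniform convexity of the single conjugate `ℓ j*`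
    -- is enough for its own block.
    have hmem : ∀ u, gradConj (ℓ j) u ∈ subdifferential (conjugate (ℓ j)) u := fun u =>
      (hℓ j).mem_subdifferential_conjugate_iff.2 (mem_subdifferential_gradConj (hℓ j) (hℓsc j) u)
    have h5 : Tendsto (fun n => d n ω j) atTop (𝓝 ((Xbar ω).snd j)) :=
      huc.tendsto (hℓ j).conjugate.ne_bot
        (fun n => (PiLp.norm_apply_le (d n ω) j).trans
          ((WithLp.norm_snd_le _ (w n ω)).trans (hC n)))
        (fun n => hmem _) (hmem _) h4
    have h6 := h5.sub ((hsub ω h2).2 j)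
    rw [sub_zero] at h6
    refine h6.congr fun n => ?_
    exact sub_sub_cancel _ _
  · intro h _ _ hh j
    filter_upwards [hconv] with ω ⟨_, h1, h2, h3⟩ huc
    obtain ⟨C, hC⟩ := hwbdd ω h1 h2
    have h4 : Tendsto (fun n => gradient φ (c n ω) j) atTop
        (𝓝 (gradient φ (Xbar ω).fst j)) := ((hproj j).tendsto _).comp h3
    have h5 : Tendsto (fun n => c n ω j) atTop (𝓝 ((Xbar ω).fst j)) :=
      huc.tendsto (fun _ => EReal.coe_ne_bot _)
        (fun n => (PiLp.norm_apply_le (c n ω) j).trans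
          ((WithLp.norm_fst_le _ (w n ω)).trans (hC n)))
        (fun n => gradient_apply_mem_subdifferential hφconv hφdiff hh _ j)
        (gradient_apply_mem_subdifferential hφconv hφdiff hh _ j) h4
    have h6 := h5.sub ((hsub ω h2).1 j)
    rw [sub_zero] at h6
    refine h6.congr fun n => ?_
    exact sub_sub_cancel _ _
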